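/- **Setting.** Let $n,p\ge 1$, $N=np$, $\mathcal S=\{1,\dots,n\}\times\{1,\dots,p\}$. Let $\mathbf U_t=(U_{1t},\dots,U_{nt})$, $t\in\mathbb Z$, be i.i.d. random vectors whose coordinates are uniform on $[0,1]$, and let $Y_t=(y_{1t},\dots,y_{nt})$, $t\in\mathbb Z$, satisfy almost surely, for every $k$, $$y_{kt}=\theta_{0k}(U_{kt})+\sum_{(l,j)\in\mathcal S}\theta^{(j)}_{lk}(U_{kt})\,y_{l,t-j}=W_t^\top\Theta_k(U_{kt}),\qquad W_t=(1,Y_{t-1}^\top,\dots,Y_{t-p}^\top)^\top,$$ where the coefficient functions are continuous on $[0,1]$. Put $\mathcal F_t=\sigma(Y_s:s\le t)$, $\|g\|_2=(\int_0^1 g^2)^{1/2}$ and $\mathcal S_{0i}=\{(l,j)\in\mathcal S:\|\theta^{(j)}_{li}\|_2=0\}$. Assume: * (bounds) $\mathrm{lb}_k\le y_{kt}\le \mathrm{ub}_k$ almost surely for known $\mathrm{lb}_k<\mathrm{ub}_k$; put $\Delta_k=\mathrm{ub}_k-\mathrm{lb}_k$; * (max–min vertices) let $v_0=(1,\mathrm{lb}_1,\dots,\mathrm{lb}_n,\dots,\mathrm{lb}_1,\dots,\mathrm{lb}_n)$,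 and let $v_l^{(j)}$ be $v_0$ with $N\Delta_l$ added to the entry of $y_{l,t-j}$; then $\frac{d}{du}v^\top\Theta_k(u)>0$ on $(0,1)$ for each of these vertices $v$ and every $k$; * (stability) for some $m\ge 1$, $\sup_{u_1,\dots,u_m\in[0,1]^n}\|\mathcal A(u_1)\cdots\mathcal A(u_m)\|_2<1$, where $\mathcal A(u)$ is the companion matrix of the autoregression with coefficients $\theta_{lk}^{(j)}(u_k)$. The max–min coordinates $C_t$ of $W_t$ are $c_{l,t-j}=(y_{l,t-j}-\mathrm{lb}_l)/(N\Delta_l)$ and $c_{0t}=1-\sum_{(l,j)}c_{l,t-j}$. Fix $i$ and put $\phi_{0i}=v_0^\top\Theta_i$, $\phi_{li}^{(j)}=v_l^{(j)\top}\Theta_i=\phi_{0i}+N\Delta_l\theta_{li}^{(j)}$, $m_{it}(\tau)=C_t^\top\Phi_i(\tau)=W_t^\top\Theta_i(\tau)$. Assume further: * (density) the conditional law of $y_{it}$ given $\mathcal F_{t-1}$ has a density $f_{it}$, bounded uniformly in $t$ and $\omega$, which on the interval $\{m_{it}(\tau):0<\tau<1\}$ is Lipschitz with a uniform constant; and for some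 $c_f>0$ and all $\tau\in(0,1)$, $f_{it}\ge c_f$ on a neighbourhood of $m_{it}(\tau)$; * (basis) $b_1,b_2,\dots$ are continuous on $[0,1]$; with $\mathbf b_H=(b_1,\dots,b_H)^\top$ the eigenvalues of $\int_0^1\mathbf b_H\mathbf b_H^\top$ lie in a fixed compact subset of $(0,\infty)$ for all $H$; the parameter space is a product of sets $\mathcal G_{0,H},\mathcal G_{l,H}^{(j)}\subseteq\mathbb R^H$ with $\mathcal G_{0,H}\subseteq\mathcal G_{l,H}^{(j)}$ for all $(l,j)$, on which $|\mathbf b_H(u)^\top\gamma|$ is bounded uniformly in $u\in[0,1]$, $\gamma$ and $H$; for some $\pi>0$ and all large $H$ there is a parameter $(\gamma_{0i},\gamma_{li}^{(j)})$ in the parameter space with $\|\mathbf b_H^\top(\gamma_{li}^{(j)}-\gamma_{0i})\|_2=0$ for $(l,j)\in\mathcal S_{0i}$, $\sup_{[0,1]}|\phi_{0i}-\mathbf b_H^\top\gamma_{0i}|=O(H^{-\pi})$ and $\sup_{[0,1]}|\phi_{li}^{(j)}-\mathbf b_H^\top\gamma_{li}^{(j)}|=O(H^{-\pi})$; * (matrices)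 with $\tau_\ell=\ell/(1+L)$ and $\xi_t(\tau)=C_t\otimes\mathbf b_H(\tau)$, for all large $T$ the eigenvalues of $(LT)^{-1}\sum_{\ell\le L}\sum_{t\le T}\mathbb E[\xi_t(\tau_\ell)\xi_t(\tau_\ell)^\top]$ and of $(LT)^{-1}\sum_{\ell\le L}\sum_{t\le T}\mathbb E[f_{it}(m_{it}(\tau_\ell))\xi_t(\tau_\ell)\xi_t(\tau_\ell)^\top]$ lie in fixed compact subsets of $(0,\infty)$, and those of $(L^2T)^{-1}\sum_{\ell,\ell'\le L}\sum_{t\le T}\mathbb E[\xi_t(\tau_\ell)\xi_t(\tau_{\ell'})^\top]\min\{\tau_\ell,\tau_{\ell'}\}(1-\max\{\tau_\ell,\tau_{\ell'}\})$ are bounded above by a constant; * (tuning) as $T\to\infty$: $L\to\infty$, $H\to\infty$, $\lambda\to0$, $\lambda/(T^{-1/2}+H^{1/2-\pi})\to\infty$, $T^{1/2}H^{1/2-\pi}=O(1)$, $H/\sqrt T\to0$. **Estimator.** Let $\rho_\tau(x)=x(\tau-\mathbf 1\{x<0\})$ and let $s_\lambda$ be the SCAD penalty with constant $a>1$: $s_\lambda(x)=\lambda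 x$ for $0\le x\le\lambda$, $s_\lambda(x)=-\frac{x^2-2a\lambda x+\lambda^2}{2(a-1)}$ for $\lambda<x\le a\lambda$, and $s_\lambda(x)=\frac{(a+1)\lambda^2}{2}$ for $x>a\lambda$. Let $\hat\gamma_i$ be any (measurable) minimizer over the parameter space of $$\frac1{LT}\sum_{\ell\le L}\sum_{t\le T}\rho_{\tau_\ell}\bigl(y_{it}-\xi_t(\tau_\ell)^\top\gamma\bigr)+\sum_{(l,j)\in\mathcal S}s_\lambda\bigl(\|\mathbf b_H^\top(\gamma_l^{(j)}-\gamma_0)\|_2\bigr),$$ and let $\hat\theta_{li}^{(j)}(u)=\mathbf b_H(u)^\top(\hat\gamma_{li}^{(j)}-\hat\gamma_{0i})/(N\Delta_l)$. **Theorem (consistent model selection).** Under these assumptions, for every $(l,j)\in\mathcal S_{0i}$, $$\Pr\bigl(\|\hat\theta_{li}^{(j)}\|_2=0\bigr)\to1\qquad(T\to\infty).$$ -/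

import Mathlib

open MeasureTheory ProbabilityTheory Filter Topology Set

noncomputable section

namespace SQVAR

/-- Indices of the `N + 1 = n p + 1` regressors: `none` is the intercept and `some (l, j)` is the
lag of order `j + 1` of the `l`-th series (lags are numbered from `0` in `Fin p`). -/
abbrev Idx (n p : ℕ) := Option (Fin n × Fin p)

/-- The norm `‖g‖₂ = (∫₀¹ g(u)² du)^{1/2}`. -/
def l2norm (g : ℝ → ℝ) : ℝ := Real.sqrt (∫ u in (0 : ℝ)..1, g u ^ 2)

section TimeSeries

variable {Ω : Type*} {n p : ℕ}

/-- The regressor vector `W_t = (1, Y_{t-1}, …, Y_{t-p})`. -/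
def regressor (y : ℤ → Ω → Fin n → ℝ) (t : ℤ) (ω : Ω) : Idx n p → ℝ
  | none => 1
  | some (l, j) => y (t - ((j : ℕ) + 1)) ω l

/-- The information set `𝓕_t = σ(Y_s : s ≤ t)`. -/
@[reducible] def past (y : ℤ → Ω → Fin n → ℝ) (t : ℤ) : MeasurableSpace Ω :=
  ⨆ s : Set.Iic t, MeasurableSpace.comap (y s) inferInstance

/-- The set of `w` at which `u ↦ wᵀ Θ(u)` has a positive derivative on the whole of `(0, 1)`. -/
def SMER (θ : Idx n p → ℝ → ℝ) : Set (Idx n p → ℝ) :=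
  {w | ∀ u ∈ Ioo (0 : ℝ) 1, 0 < deriv (fun v => ∑ q, w q * θ q v) u}

/-- The vertices of the max-min coordinate system: `v₀ = (1, lb, …, lb)`, and `v_l^{(j)}` is `v₀`
with `N Δ_l = n p (ub_l - lb_l)` added to the entry `(l, j)`. -/
def vertex (lb ub : Fin n → ℝ) : Idx n p → Idx n p → ℝ
  | _, none => 1
  | none, some q => lb q.1
  | some r, some q => lb q.1 + if q = r then ((n * p : ℕ) : ℝ) * (ub q.1 - lb q.1) else 0

/-- The max-min barycentric coordinates `C_t` of `W_t`: `c_{l,t-j} = (y_{l,t-j} - lb_l) / (N Δ_l)`,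
and `c_{0t}` is one minus their sum. -/
def coord (lb ub : Fin n → ℝ) (y : ℤ → Ω → Fin n → ℝ) (t : ℤ) (ω : Ω) : Idx n p → ℝ
  | some (l, j) =>
      (y (t - ((j : ℕ) + 1)) ω l - lb l) / (((n * p : ℕ) : ℝ) * (ub l - lb l))
  | none => 1 - ∑ q : Fin n × Fin p,
      (y (t - ((q.2 : ℕ) + 1)) ω q.1 - lb q.1) / (((n * p : ℕ) : ℝ) * (ub q.1 - lb q.1))

/-- The transformed coefficient functions `φ_r(u) = v_rᵀ Θ(u)`. -/
def phi (lb ub : Fin n → ℝ) (θ : Idx n p → ℝ → ℝ) (r : Idx n p) (u : ℝ) : ℝ :=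
  ∑ q, vertex lb ub r q * θ q u

/-- The conditional quantile `m_t(τ) = C_tᵀ Φ(τ)`. -/
def quant (lb ub : Fin n → ℝ) (θ : Idx n p → ℝ → ℝ) (y : ℤ → Ω → Fin n → ℝ)
    (t : ℤ) (ω : Ω) (τ : ℝ) : ℝ :=
  ∑ r, coord lb ub y t ω r * phi lb ub θ r τ

/-- The companion matrix `𝒜(u)` of the random-coefficient vector autoregression. The state vector
has the entries `y_{l,t-j}`; the first block row carries the coefficients, the others shift. -/
def companion (θ : Fin n → Idx n p → ℝ → ℝ) (u : Fin n → ℝ) :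
    Matrix (Fin n × Fin p) (Fin n × Fin p) ℝ :=
  Matrix.of fun k q =>
    if (k.2 : ℕ) = 0 then θ k.1 (some q) (u k.1)
    else if q.1 = k.1 ∧ (q.2 : ℕ) + 1 = (k.2 : ℕ) then 1 else 0

/-- The data generating process: `θ k` are the coefficient functions of the `k`-th equation, `U_t`
the vector of rank variables, `y_t` the vector of observables with known bounds `lb`, `ub`. -/
structure Model [MeasurableSpace Ω] (μ : Measure Ω) (θ : Fin n → Idx n p → ℝ → ℝ)
    (lb ub : Fin n → ℝ) (U y : ℤ → Ω → Fin n → ℝ) : Prop where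
  measurable_U : ∀ t, Measurable (U t)
  measurable_y : ∀ t, Measurable (y t)
  indep : iIndepFun U μ
  identical : ∀ s t, μ.map (U s) = μ.map (U t)
  uniform : ∀ t k, μ.map (fun ω => U t ω k) = (volume : Measure ℝ).restrict (Icc 0 1)
  continuous_coef : ∀ k q, ContinuousOn (θ k q) (Icc 0 1)
  dgp : ∀ t, ∀ᵐ ω ∂μ, ∀ k, y t ω k = ∑ q, regressor y t ω q * θ k q (U t ω k)
  lb_lt_ub : ∀ k, lb k < ub k
  bounded : ∀ t, ∀ᵐ ω ∂μ, ∀ k, y t ω k ∈ Icc (lb k) (ub k)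
  vertex_mem : ∀ k r, vertex lb ub r ∈ SMER (θ k)
  /-- For some `m`, the spectral norms of all products of `m` companion matrices are bounded by a
  number smaller than one. -/
  contraction : ∃ m : ℕ, ∃ r < (1 : ℝ), ∀ u : Fin m → Fin n → ℝ,
    (∀ s k, u s k ∈ Icc (0 : ℝ) 1) →
      ‖Matrix.toEuclideanCLM (𝕜 := ℝ) (List.ofFn fun s => companion θ (u s)).prod‖ ≤ r

/-- `f t ω` is a version of the density of `y_{it}` given `𝓕_{t-1}`, with the regularity required:
uniformly bounded, and on the interval `{m_t(τ) : 0 < τ < 1}` of conditional quantiles (the interior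
of the conditional support) uniformly Lipschitz and uniformly bounded away from zero. -/
structure CondDensity [MeasurableSpace Ω] (μ : Measure Ω) (θ : Fin n → Idx n p → ℝ → ℝ)
    (lb ub : Fin n → ℝ) (y : ℤ → Ω → Fin n → ℝ) (i : Fin n) (f : ℤ → Ω → ℝ → ℝ) : Prop where
  measurable : ∀ t, Measurable[(past y (t - 1)).prod (borel ℝ)] (Function.uncurry (f t))
  nonneg : ∀ t ω s, 0 ≤ f t ω s
  cdf : ∀ t x, μ[Set.indicator {ω | y t ω i ≤ x} (fun _ => (1 : ℝ)) | past y (t - 1)]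
    =ᵐ[μ] fun ω => ∫ s in Iic x, f t ω s
  bounded : ∃ B : ℝ, ∀ t, ∀ᵐ ω ∂μ, ∀ s, f t ω s ≤ B
  lipschitz : ∃ K : NNReal, ∀ t, ∀ᵐ ω ∂μ,
    LipschitzOnWith K (f t ω) (quant lb ub (θ i) y t ω '' Ioo 0 1)
  lower : ∃ c > (0 : ℝ), ∀ t, ∀ᵐ ω ∂μ, ∀ τ ∈ Ioo (0 : ℝ) 1,
    ∀ᶠ s in 𝓝 (quant lb ub (θ i) y t ω τ), c ≤ f t ω s

end TimeSeries

section Estimation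

variable {Ω : Type*} {n p : ℕ}

/-- The series `b_H(u)ᵀ γ` with coefficient vector `γ ∈ ℝ^H` in the basis `b₁, …, b_H`
(numbered from `0`). -/
def series (b : ℕ → ℝ → ℝ) {H : ℕ} (γ : Fin H → ℝ) (u : ℝ) : ℝ := ∑ h : Fin H, b h u * γ h

/-- The grid point `τ_ℓ = ℓ / (1 + L)`. -/
def grid (L ℓ : ℕ) : ℝ := (ℓ : ℝ) / (1 + (L : ℝ))

/-- The vector `ξ_t(τ) = C_t ⊗ b_H(τ)`. -/
def xi (lb ub : Fin n → ℝ) (y : ℤ → Ω → Fin n → ℝ) (b : ℕ → ℝ → ℝ) (H : ℕ)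
    (t : ℤ) (ω : Ω) (τ : ℝ) (q : Idx n p × Fin H) : ℝ :=
  coord lb ub y t ω q.1 * b q.2 τ

/-- The check function `ρ_τ(x) = x (τ - 1{x < 0})`. -/
def check (τ x : ℝ) : ℝ := x * (τ - if x < 0 then 1 else 0)

/-- The SCAD penalty function with parameters `a` and `lam`. -/
def scad (a lam x : ℝ) : ℝ :=
  if x ≤ lam then lam * x
  else if x ≤ a * lam then -(x ^ 2 - 2 * a * lam * x + lam ^ 2) / (2 * (a - 1))
  else (a + 1) * lam ^ 2 / 2

/-- The penalty in max-min coordinates: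
`P(γ) = ∑_{(l,j)} s_λ(‖b_H(·)ᵀ (γ_l^{(j)} - γ_0)‖₂)`. -/
def penalty (b : ℕ → ℝ → ℝ) (a lam : ℝ) {H : ℕ} (γ : Idx n p → Fin H → ℝ) : ℝ :=
  ∑ q : Fin n × Fin p, scad a lam (l2norm (series b (γ (some q) - γ none)))

/-- The penalized quantile regression criterion for the `i`-th series with observations
`t = 1, …, T` and quantile levels `τ_1, …, τ_L`. -/
def objective (lb ub : Fin n → ℝ) (y : ℤ → Ω → Fin n → ℝ) (i : Fin n) (b : ℕ → ℝ → ℝ)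
    (a lam : ℝ) (L T H : ℕ) (ω : Ω) (γ : Idx n p → Fin H → ℝ) : ℝ :=
  1 / ((L : ℝ) * T) * ∑ ℓ ∈ Finset.Icc 1 L, ∑ t ∈ Finset.Icc 1 T,
      check (grid L ℓ)
        (y t ω i - ∑ q : Idx n p × Fin H, xi lb ub y b H t ω (grid L ℓ) q * γ q.1 q.2)
    + penalty b a lam γ

/-- The estimated coefficient function
`θ̂_l^{(j)}(u) = (φ̂_l^{(j)}(u) - φ̂_0(u)) / (N Δ_l)`, where `φ̂_r = b_H(·)ᵀ γ_r`. -/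
def thetaHat (lb ub : Fin n → ℝ) (b : ℕ → ℝ → ℝ) {H : ℕ} (γ : Idx n p → Fin H → ℝ)
    (q : Fin n × Fin p) (u : ℝ) : ℝ :=
  (series b (γ (some q)) u - series b (γ none) u) / (((n * p : ℕ) : ℝ) * (ub q.1 - lb q.1))

/-- Basis functions and parameter spaces. `G H r` is the set of admissible coefficient vectors of
`φ_r`; sign or order restrictions that enforce monotonicity are part of it. -/
structure Basis (θ : Idx n p → ℝ → ℝ) (lb ub : Fin n → ℝ) (b : ℕ → ℝ → ℝ)
    (G : (H : ℕ) → Idx n p → Set (Fin H → ℝ)) (π : ℝ) : Prop where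
  continuous_basis : ∀ h, ContinuousOn (b h) (Icc 0 1)
  gram : ∃ c > (0 : ℝ), ∃ C : ℝ, ∀ H : ℕ,
    spectrum ℝ (Matrix.of fun h h' : Fin H => ∫ u in (0 : ℝ)..1, b h u * b h' u) ⊆ Icc c C
  bounded : ∃ M : ℝ, ∀ H r, ∀ γ ∈ G H r, ∀ u ∈ Icc (0 : ℝ) 1, |series b γ u| ≤ M
  /-- The restrictions `γ_l^{(j)} = γ_0` are compatible with the parameter space. -/
  compatible : ∀ H q, G H none ⊆ G H (some q)
  pi_pos : 0 < π
  /-- The `φ_r` are approximated at the rate `H^{-π}` by admissible vectors that respect the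
  sparsity pattern. -/
  approx : ∃ C : ℝ, ∀ᶠ H : ℕ in atTop, ∃ γ : Idx n p → Fin H → ℝ,
    (∀ r, γ r ∈ G H r) ∧
    (∀ q, l2norm (θ (some q)) = 0 → l2norm (series b (γ (some q) - γ none)) = 0) ∧
    ∀ r, ∀ u ∈ Icc (0 : ℝ) 1, |phi lb ub θ r u - series b (γ r) u| ≤ C * (H : ℝ) ^ (-π)

/-- `(LT)⁻¹ ∑_ℓ ∑_t 𝔼[w_t(τ_ℓ) ξ_t(τ_ℓ) ξ_t(τ_ℓ)ᵀ]`. -/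
def designMatrix [MeasurableSpace Ω] (μ : Measure Ω) (lb ub : Fin n → ℝ)
    (y : ℤ → Ω → Fin n → ℝ) (b : ℕ → ℝ → ℝ) (w : ℤ → Ω → ℝ → ℝ) (L T H : ℕ) :
    Matrix (Idx n p × Fin H) (Idx n p × Fin H) ℝ :=
  Matrix.of fun q q' => 1 / ((L : ℝ) * T) * ∑ ℓ ∈ Finset.Icc 1 L, ∑ t ∈ Finset.Icc 1 T,
    ∫ ω, w t ω (grid L ℓ) * xi lb ub y b H t ω (grid L ℓ) q * xi lb ub y b H t ω (grid L ℓ) q' ∂μ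

/-- `(L²T)⁻¹ ∑_ℓ ∑_ℓ' ∑_t 𝔼[ξ_t(τ_ℓ) ξ_t(τ_ℓ')ᵀ] min{τ_ℓ, τ_ℓ'} (1 - max{τ_ℓ, τ_ℓ'})`. -/
def scoreMatrix [MeasurableSpace Ω] (μ : Measure Ω) (lb ub : Fin n → ℝ)
    (y : ℤ → Ω → Fin n → ℝ) (b : ℕ → ℝ → ℝ) (L T H : ℕ) :
    Matrix (Idx n p × Fin H) (Idx n p × Fin H) ℝ :=
  Matrix.of fun q q' => 1 / ((L : ℝ) ^ 2 * T) *
    ∑ ℓ ∈ Finset.Icc 1 L, ∑ ℓ' ∈ Finset.Icc 1 L, ∑ t ∈ Finset.Icc 1 T,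
      (∫ ω, xi lb ub y b H t ω (grid L ℓ) q * xi lb ub y b H t ω (grid L ℓ') q' ∂μ) *
        (min (grid L ℓ) (grid L ℓ') * (1 - max (grid L ℓ) (grid L ℓ')))

/-- Eigenvalue bounds, for all sufficiently large `T`. -/
structure Nonsingular [MeasurableSpace Ω] (μ : Measure Ω) (θ : Idx n p → ℝ → ℝ)
    (lb ub : Fin n → ℝ) (y : ℤ → Ω → Fin n → ℝ) (b : ℕ → ℝ → ℝ) (f : ℤ → Ω → ℝ → ℝ)
    (H L : ℕ → ℕ) : Prop where
  design : ∃ c > (0 : ℝ), ∃ C : ℝ, ∀ᶠ T in atTop,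
    spectrum ℝ (designMatrix (p := p) μ lb ub y b (fun _ _ _ => 1) (L T) T (H T)) ⊆ Icc c C
  score : ∃ C : ℝ, ∀ᶠ T in atTop,
    spectrum ℝ (scoreMatrix (p := p) μ lb ub y b (L T) T (H T)) ⊆ Iic C
  weighted : ∃ c > (0 : ℝ), ∃ C : ℝ, ∀ᶠ T in atTop,
    spectrum ℝ (designMatrix (p := p) μ lb ub y b
      (fun t ω τ => f t ω (quant lb ub θ y t ω τ)) (L T) T (H T)) ⊆ Icc c C

/-- Rates of the tuning parameters: number `H` of basis functions, number `L` of quantile levels,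
penalty parameter `lam`. -/
structure Tuning (π : ℝ) (H L : ℕ → ℕ) (lam : ℕ → ℝ) : Prop where
  lam_zero : Tendsto lam atTop (𝓝 0)
  lam_rate : Tendsto
    (fun T : ℕ => lam T / ((T : ℝ) ^ (-(1 / 2) : ℝ) + (H T : ℝ) ^ (1 / 2 - π))) atTop atTop
  H_top : Tendsto H atTop atTop
  H_lower : (fun T : ℕ => (T : ℝ) ^ (1 / 2 : ℝ) * (H T : ℝ) ^ (1 / 2 - π))
    =O[atTop] fun _ => (1 : ℝ)
  H_upper : Tendsto (fun T : ℕ => (H T : ℝ) / Real.sqrt T) atTop (𝓝 0)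
  L_top : Tendsto L atTop atTop

end Estimation

end SQVAR

end

namespace SQVAR

/-- Lebesgue measure on the unit interval. -/
noncomputable abbrev unif : Measure ℝ := (volume : Measure ℝ).restrict (Icc 0 1)

instance isProbabilityMeasure_unif : IsProbabilityMeasure unif :=
  ⟨by simp [unif]⟩

/-- The increments of `m` on the unit interval are comparable with those of the identity. -/
def SlopeBounds (B c : ℝ) (m : ℝ → ℝ) : Prop :=
  ∀ u ∈ Icc (0 : ℝ) 1, ∀ v ∈ Icc (0 : ℝ) 1, u ≤ v → v - u ≤ B * (m v - m u) ∧ c * (m v - m u) ≤ v - u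

/-- The distribution function (with strict inequality) of `m` under the uniform distribution. -/
noncomputable def levelCdf (m : ℝ → ℝ) (x : ℝ) : ℝ := unif.real {u | m u < x}

section LevelCdf

variable {m : ℝ → ℝ} {B c : ℝ}

theorem levelCdf_mono (m : ℝ → ℝ) : Monotone (levelCdf m) := fun _ _ h =>
  measureReal_mono (fun _ hu => lt_of_lt_of_le hu h)

theorem levelCdf_nonneg (m : ℝ → ℝ) (x : ℝ) : 0 ≤ levelCdf m x := measureReal_nonneg

theorem levelCdf_le_one (m : ℝ → ℝ) (x : ℝ) : levelCdf m x ≤ 1 := measureReal_le_one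

theorem levelCdf_eq (hm : Measurable m) (x : ℝ) :
    levelCdf m x = volume.real (Icc 0 1 ∩ {u | m u < x}) := by
  rw [levelCdf, measureReal_restrict_apply (measurableSet_lt hm measurable_const), inter_comm]

theorem SlopeBounds.lt (h : SlopeBounds B c m) {u v : ℝ} (hu : u ∈ Icc (0 : ℝ) 1)
    (hB : 0 < B) (hv : v ∈ Icc (0 : ℝ) 1) (huv : u < v) : m u < m v := by
  have h1 := (h u hu v hv huv.le).1
  by_contra hc
  have : B * (m v - m u) ≤ 0 := mul_nonpos_of_nonneg_of_nonpos hB.le (by linarith)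
  linarith

theorem SlopeBounds.levelCdf_sub_le (h : SlopeBounds B c m) (hB : 0 < B) (hm : Measurable m)
    {x y : ℝ} (hxy : x ≤ y) : levelCdf m y - levelCdf m x ≤ B * (y - x) := by
  have hsub : Icc (0 : ℝ) 1 ∩ {u | m u < y} ⊆
      (Icc 0 1 ∩ {u | m u < x}) ∪ (Icc 0 1 ∩ {u | x ≤ m u ∧ m u < y}) := by
    rintro u ⟨hu, hy⟩
    rcases lt_or_ge (m u) x with h' | h'
    · exact Or.inl ⟨hu, h'⟩
    · exact Or.inr ⟨hu, h', hy⟩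
  have hfin : ∀ s : Set ℝ, volume (Icc (0 : ℝ) 1 ∩ s) ≠ ⊤ := fun s =>
    ne_top_of_le_ne_top (by simp) (measure_mono (inter_subset_left (s := Icc (0 : ℝ) 1)))
  have hvol : volume.real (Icc (0 : ℝ) 1 ∩ {u | x ≤ m u ∧ m u < y}) ≤ B * (y - x) := by
    have hnn : 0 ≤ B * (y - x) := mul_nonneg hB.le (by linarith)
    refine ENNReal.toReal_le_of_le_ofReal hnn ((Real.volume_le_diam _).trans ?_)
    refine Metric.ediam_le fun u hu v hv => ?_
    rw [edist_dist, Real.dist_eq]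
    refine ENNReal.ofReal_le_ofReal ?_
    obtain ⟨hu0, hu1, hu2⟩ := hu
    obtain ⟨hv0, hv1, hv2⟩ := hv
    rcases le_total u v with huv | huv
    · have := (h u hu0 v hv0 huv).1
      rw [abs_sub_comm, abs_of_nonneg (by linarith)]
      nlinarith
    · have := (h v hv0 u hu0 huv).1
      rw [abs_of_nonneg (by linarith)]
      nlinarith
  have h1 : volume.real (Icc (0 : ℝ) 1 ∩ {u | m u < y}) ≤
      volume.real (Icc (0 : ℝ) 1 ∩ {u | m u < x}) +
        volume.real (Icc (0 : ℝ) 1 ∩ {u | x ≤ m u ∧ m u < y}) :=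
    (measureReal_mono hsub
      (ne_top_of_le_ne_top (ENNReal.add_ne_top.2 ⟨hfin _, hfin _⟩) (measure_union_le _ _))).trans
      (measureReal_union_le _ _)
  rw [levelCdf_eq hm, levelCdf_eq hm]
  linarith

theorem SlopeBounds.abs_levelCdf_sub_le (h : SlopeBounds B c m) (hB : 0 < B) (hm : Measurable m)
    (x y : ℝ) : |levelCdf m x - levelCdf m y| ≤ B * |x - y| := by
  rcases le_total x y with hxy | hxy
  · rw [abs_sub_comm, abs_sub_comm x, abs_of_nonneg (sub_nonneg.2 (levelCdf_mono m hxy)),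
      abs_of_nonneg (by linarith)]
    exact h.levelCdf_sub_le hB hm hxy
  · rw [abs_of_nonneg (sub_nonneg.2 (levelCdf_mono m hxy)), abs_of_nonneg (by linarith)]
    exact h.levelCdf_sub_le hB hm hxy

theorem SlopeBounds.levelCdf_apply (h : SlopeBounds B c m) (hB : 0 < B) (hm : Measurable m)
    {τ : ℝ} (hτ : τ ∈ Icc (0 : ℝ) 1) : levelCdf m (m τ) = τ := by
  have : Icc (0 : ℝ) 1 ∩ {u | m u < m τ} = Ico 0 τ := by
    ext u
    simp only [mem_inter_iff, mem_Icc, mem_ofPred_eq, mem_Ico]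
    constructor
    · rintro ⟨⟨h0, h1⟩, hu⟩
      refine ⟨h0, ?_⟩
      by_contra hc
      rcases (not_lt.1 hc).eq_or_lt with he | hl
      · rw [he] at hu; exact lt_irrefl _ hu
      · exact absurd (h.lt hτ hB ⟨h0, h1⟩ hl) (not_lt.2 hu.le)
    · rintro ⟨h0, h1⟩
      exact ⟨⟨h0, h1.le.trans hτ.2⟩, h.lt ⟨h0, h1.le.trans hτ.2⟩ hB hτ h1⟩
  rw [levelCdf_eq hm, this, Real.volume_real_Ico_of_le hτ.1, sub_zero]

theorem SlopeBounds.le_levelCdf_sub (h : SlopeBounds B c m) (hB : 0 < B) (hc : 0 < c)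
    (hm : Measurable m) {τ s : ℝ} (hτ : τ ∈ Icc (0 : ℝ) 1) (hs : m τ ≤ s) :
    min (c * (s - m τ)) (1 - τ) ≤ levelCdf m s - τ := by
  have hsub : Ico 0 (min 1 (τ + c * (s - m τ))) ⊆ Icc (0 : ℝ) 1 ∩ {u | m u < s} := by
    rintro u ⟨h0, h1⟩
    have hu1 : u < 1 := h1.trans_le (min_le_left _ _)
    have hu2 : u < τ + c * (s - m τ) := h1.trans_le (min_le_right _ _)
    refine ⟨⟨h0, hu1.le⟩, ?_⟩
    rcases lt_or_ge u τ with hl | hl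
    · exact (h.lt ⟨h0, hu1.le⟩ hB hτ hl).trans_le hs
    · have := (h τ hτ u ⟨h0, hu1.le⟩ hl).2
      have h3 : c * (m u - m τ) < c * (s - m τ) := by linarith
      have := lt_of_mul_lt_mul_left h3 hc.le
      simp only [mem_ofPred_eq]; linarith
  have hnn : 0 ≤ c * (s - m τ) := mul_nonneg hc.le (by linarith)
  have h1 : min 1 (τ + c * (s - m τ)) ≤ levelCdf m s := by
    rw [levelCdf_eq hm]
    have h2 := measureReal_mono hsub
      (ne_top_of_le_ne_top (by simp) (measure_mono (inter_subset_left (s := Icc (0 : ℝ) 1))))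
      (μ := volume)
    rwa [Real.volume_real_Ico_of_le (le_min zero_le_one (by linarith [hτ.1])), sub_zero] at h2
  rcases le_total 1 (τ + c * (s - m τ)) with h' | h'
  · rw [min_eq_left h'] at h1
    rw [min_eq_right (by linarith)]; linarith
  · rw [min_eq_right h'] at h1
    rw [min_eq_left (by linarith)]; linarith

theorem SlopeBounds.le_sub_levelCdf (h : SlopeBounds B c m) (hc : 0 < c) (hB : 0 < B)
    (hm : Measurable m) {τ s : ℝ} (hτ : τ ∈ Icc (0 : ℝ) 1) (hs : s ≤ m τ) :
    min (c * (m τ - s)) τ ≤ τ - levelCdf m s := by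
  have hsub : Icc (0 : ℝ) 1 ∩ {u | m u < s} ⊆ Icc 0 (τ - c * (m τ - s)) := by
    rintro u ⟨⟨h0, h1⟩, hu⟩
    simp only [mem_ofPred_eq] at hu
    refine ⟨h0, ?_⟩
    have hl : u < τ := by
      by_contra hcon
      rcases (not_lt.1 hcon).eq_or_lt with he | hl
      · rw [he] at hs; linarith
      · have := h.lt hτ hB ⟨h0, h1⟩ hl; linarith
    have := (h u ⟨h0, h1⟩ τ hτ hl.le).2
    have h3 : c * (m τ - s) ≤ c * (m τ - m u) := mul_le_mul_of_nonneg_left (by linarith) hc.le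
    linarith
  have h2 := measureReal_mono hsub (by simp) (μ := volume)
  rw [← levelCdf_eq hm, Real.volume_real_Icc] at h2
  rcases le_total (τ - c * (m τ - s)) 0 with h' | h'
  · rw [sub_zero, max_eq_right h'] at h2
    exact (min_le_right _ _).trans (by linarith)
  · rw [sub_zero, max_eq_left h'] at h2
    exact (min_le_left _ _).trans (by linarith)

end LevelCdf

section Excess

variable {F : ℝ → ℝ} {B c τ x₀ : ℝ}

theorem _root_.Monotone.intervalIntegrable_sub_const (hF : Monotone F) (τ a b : ℝ) :
    IntervalIntegrable (fun s => F s - τ) volume a b :=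
  hF.intervalIntegrable.sub intervalIntegrable_const

/-- If `F - τ` is at least `h ≥ 0` on the last part of length `δ` of `[x₀, x]`, its integral is at
least `δ h`. -/
theorem mul_le_integral_of_monotone (hF : Monotone F) (h0 : F x₀ = τ) {x δ h : ℝ} (hδ : 0 ≤ δ)
    (hx : x₀ ≤ x - δ) (hh : h ≤ F (x - δ) - τ) : δ * h ≤ ∫ s in x₀..x, (F s - τ) := by
  have h1 : ∫ s in (x - δ)..x, h = δ * h := by simp
  have h2 : ∫ s in (x - δ)..x, h ≤ ∫ s in (x - δ)..x, (F s - τ) := by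
    refine intervalIntegral.integral_mono_on (by linarith) (by simp)
      (hF.intervalIntegrable_sub_const _ _ _) fun s hs => ?_
    have := hF hs.1; linarith
  have h3 : 0 ≤ ∫ s in x₀..(x - δ), (F s - τ) := by
    refine intervalIntegral.integral_nonneg hx fun s hs => ?_
    have := hF hs.1; linarith
  have h4 := intervalIntegral.integral_add_adjacent_intervals
    (hF.intervalIntegrable_sub_const τ x₀ (x - δ)) (hF.intervalIntegrable_sub_const τ (x - δ) x)
  linarith

/-- The mirror image of `mul_le_integral_of_monotone` to the left of `x₀`. -/
theorem mul_le_integral_of_monotone' (hF : Monotone F) (h0 : F x₀ = τ) {x δ h : ℝ} (hδ : 0 ≤ δ)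
    (hx : x + δ ≤ x₀) (hh : h ≤ τ - F (x + δ)) : δ * h ≤ ∫ s in x₀..x, (F s - τ) := by
  have hG : Monotone fun s => -F (-s) := fun a b hab => neg_le_neg (hF (neg_le_neg hab))
  have := mul_le_integral_of_monotone (F := fun s => -F (-s)) (τ := -τ) (x₀ := -x₀) (x := -x)
    (h := h) hG (by simp [h0]) hδ (by linarith)
    (by simp only [neg_sub_neg]; rw [show -(-x - δ) = x + δ by ring]; linarith)
  refine this.trans_eq ?_
  have h2 := intervalIntegral.integral_comp_neg (a := -x₀) (b := -x) (fun s => τ - F s)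
  simp only [neg_neg] at h2
  rw [intervalIntegral.integral_symm x x₀, ← intervalIntegral.integral_neg]
  refine Eq.trans (intervalIntegral.integral_congr fun s _ => ?_)
    (h2.trans (intervalIntegral.integral_congr fun s _ => ?_)) <;> ring

theorem sq_le_integral_sub (hF : Monotone F) (hB : 0 < B)
    (hlip : ∀ s t, |F s - F t| ≤ B * |s - t|) (h0 : F x₀ = τ) (x : ℝ) :
    (F x - τ) ^ 2 / (4 * B) ≤ ∫ s in x₀..x, (F s - τ) := by
  rcases le_total x₀ x with hx | hx
  · have hh : 0 ≤ F x - τ := by have := hF hx; linarith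
    have hl : F x - τ ≤ B * (x - x₀) := by
      have := hlip x x₀
      rwa [h0, abs_of_nonneg hh, abs_of_nonneg (by linarith)] at this
    have hd : (F x - τ) / (2 * B) ≤ x - x₀ := by
      rw [div_le_iff₀ (by positivity)]; nlinarith
    have hd0 : 0 ≤ (F x - τ) / (2 * B) := by positivity
    have := mul_le_integral_of_monotone hF h0 (x := x) (δ := (F x - τ) / (2 * B))
      (h := (F x - τ) / 2) hd0 (by linarith) (by
        have h1 := (abs_le.1 (hlip x (x - (F x - τ) / (2 * B)))).2
        rw [sub_sub_cancel, abs_of_nonneg hd0] at h1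
        have : B * ((F x - τ) / (2 * B)) = (F x - τ) / 2 := by field_simp
        linarith)
    refine le_trans (le_of_eq ?_) this
    field_simp; ring
  · have hh : 0 ≤ τ - F x := by have := hF hx; linarith
    have hl : τ - F x ≤ B * (x₀ - x) := by
      have := hlip x₀ x
      rwa [h0, abs_of_nonneg hh, abs_of_nonneg (by linarith)] at this
    have hd : (τ - F x) / (2 * B) ≤ x₀ - x := by
      rw [div_le_iff₀ (by positivity)]; nlinarith
    have hd0 : 0 ≤ (τ - F x) / (2 * B) := by positivity
    have := mul_le_integral_of_monotone' hF h0 (x := x) (δ := (τ - F x) / (2 * B))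
      (h := (τ - F x) / 2) hd0 (by linarith) (by
        have h1 := (abs_le.1 (hlip (x + (τ - F x) / (2 * B)) x)).2
        rw [add_sub_cancel_left, abs_of_nonneg hd0] at h1
        have : B * ((τ - F x) / (2 * B)) = (τ - F x) / 2 := by field_simp
        linarith)
    refine le_trans (le_of_eq ?_) this
    field_simp; ring

theorem integral_sub_le_sq (hB : 0 < B)
    (hlip : ∀ s t, |F s - F t| ≤ B * |s - t|) (h0 : F x₀ = τ) (x : ℝ) :
    ∫ s in x₀..x, (F s - τ) ≤ B * (x - x₀) ^ 2 := by
  have h1 : ‖∫ s in x₀..x, (F s - τ)‖ ≤ (B * |x - x₀|) * |x - x₀| := by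
    refine intervalIntegral.norm_integral_le_of_norm_le_const fun s hs => ?_
    rw [Real.norm_eq_abs]
    have h2 := hlip s x₀
    rw [h0] at h2
    refine h2.trans (mul_le_mul_of_nonneg_left ?_ hB.le)
    exact abs_sub_left_of_mem_uIcc (uIoc_subset_uIcc hs)
  rw [mul_assoc, ← sq, sq_abs] at h1
  exact (le_abs_self _).trans h1

theorem min_le_integral_sub (hF : Monotone F) (h0 : F x₀ = τ)
    (hτ : τ ∈ Icc (0 : ℝ) 1)
    (hup : ∀ s, x₀ ≤ s → min (c * (s - x₀)) (1 - τ) ≤ F s - τ)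
    (hlow : ∀ s, s ≤ x₀ → min (c * (x₀ - s)) τ ≤ τ - F s) (x : ℝ) :
    1 / 4 * min (c * (x - x₀) ^ 2) (min τ (1 - τ) * |x - x₀|) ≤ ∫ s in x₀..x, (F s - τ) := by
  have key : ∀ d κ : ℝ, 0 ≤ d → min τ (1 - τ) ≤ κ → 1 / 4 * min (c * d ^ 2) (min τ (1 - τ) * d) ≤
      d / 2 * min (c * (d / 2)) κ := by
    intro d κ hd hκ
    rw [mul_min_of_nonneg _ _ (by positivity : (0 : ℝ) ≤ d / 2)]
    refine le_min ?_ ?_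
    · refine (mul_le_mul_of_nonneg_left (min_le_left _ _) (by norm_num)).trans (le_of_eq (by ring))
    · refine (mul_le_mul_of_nonneg_left (min_le_right _ _) (by norm_num)).trans ?_
      have h3 : min τ (1 - τ) * d ≤ κ * d := mul_le_mul_of_nonneg_right hκ hd
      have h4 : 0 ≤ min τ (1 - τ) * d := mul_nonneg (le_min hτ.1 (by linarith [hτ.2])) hd
      linarith
  rcases le_total x₀ x with hx | hx
  · rw [abs_of_nonneg (by linarith)]
    refine (key (x - x₀) (1 - τ) (by linarith) (min_le_right _ _)).trans ?_
    refine mul_le_integral_of_monotone hF h0 (by linarith) (by linarith) ?_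
    refine le_trans (le_of_eq ?_) (hup (x - (x - x₀) / 2) (by linarith))
    congr 2; ring
  · rw [abs_sub_comm, abs_of_nonneg (by linarith), ← neg_sub x₀ x, neg_sq]
    refine (key (x₀ - x) τ (by linarith) (min_le_left _ _)).trans ?_
    refine mul_le_integral_of_monotone' hF h0 (by linarith) (by linarith) ?_
    refine le_trans (le_of_eq ?_) (hlow (x + (x₀ - x) / 2) (by linarith))
    congr 2; ring

end Excess

section CheckFunction

theorem monotone_indicator_lt (y : ℝ) : Monotone fun s : ℝ => if y < s then (1 : ℝ) else 0 := by
  intro a b hab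
  simp only
  split_ifs with h1 h2
  · exact le_rfl
  · exact absurd (h1.trans_le hab) h2
  · exact zero_le_one
  · exact le_rfl

theorem check_eq (τ x : ℝ) : check τ x = max (τ * x) ((τ - 1) * x) := by
  unfold check
  split_ifs with h
  · rw [max_eq_right (by nlinarith)]; ring
  · rw [max_eq_left (by nlinarith)]; ring

theorem check_sub_le (τ y x x' : ℝ) :
    check τ (y - x') - check τ (y - x) ≤ ((if y < x' then (1 : ℝ) else 0) - τ) * (x' - x) := by
  have h1 := le_max_left (τ * (y - x)) ((τ - 1) * (y - x))
  have h2 := le_max_right (τ * (y - x)) ((τ - 1) * (y - x))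
  rw [← check_eq] at h1 h2
  by_cases h : y < x'
  · rw [if_pos h, check, if_pos (by linarith)]
    nlinarith
  · rw [if_neg h, check, if_neg (by linarith)]
    nlinarith

theorem integral_indicator_lt (y a b : ℝ) :
    ∫ s in a..b, (if y < s then (1 : ℝ) else 0) = max (b - y) 0 - max (a - y) 0 := by
  have key : ∀ a b : ℝ, a ≤ b →
      ∫ s in a..b, (if y < s then (1 : ℝ) else 0) = max (b - y) 0 - max (a - y) 0 := by
    intro a b hab
    rw [intervalIntegral.integral_of_le hab]
    have h1 : (fun s : ℝ => if y < s then (1 : ℝ) else 0) = (Ioi y).indicator 1 := by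
      ext s; simp [indicator_apply]
    rw [h1, integral_indicator_one measurableSet_Ioi,
      measureReal_restrict_apply measurableSet_Ioi, inter_comm, Ioc_inter_Ioi,
      Real.volume_real_Ioc]
    simp only [max_def]
    split_ifs <;> linarith
  rcases le_total a b with h | h
  · exact key a b h
  · rw [intervalIntegral.integral_symm, key b a h]; ring

theorem check_sub_check (τ y x x' : ℝ) :
    check τ (y - x) - check τ (y - x') =
      ∫ s in x'..x, ((if y < s then (1 : ℝ) else 0) - τ) := by
  rw [intervalIntegral.integral_sub (monotone_indicator_lt y).intervalIntegrable (by simp),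
    integral_indicator_lt, intervalIntegral.integral_const, smul_eq_mul, check, check]
  rcases lt_or_ge y x with h | h <;> rcases lt_or_ge y x' with h' | h' <;>
    [rw [if_pos (by linarith), if_pos (by linarith), max_eq_left (by linarith), max_eq_left (by linarith)];
    rw [if_pos (by linarith), if_neg (by linarith), max_eq_left (by linarith), max_eq_right (by linarith)];
    rw [if_neg (by linarith), if_pos (by linarith), max_eq_right (by linarith), max_eq_left (by linarith)];
    rw [if_neg (by linarith), if_neg (by linarith), max_eq_right (by linarith), max_eq_right (by linarith)]] <;>
  ring

end CheckFunction

section Chaining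

variable {Ω : Type*} [MeasurableSpace Ω] {μ : Measure Ω}

theorem measure_lt_le_exp {Y : Ω → ℝ} (hY : Measurable Y) {θ v x : ℝ} (hθ : 0 ≤ θ)
    (h : ∫⁻ ω, ENNReal.ofReal (Real.exp (θ * Y ω)) ∂μ ≤ ENNReal.ofReal (Real.exp v)) :
    μ {ω | x < Y ω} ≤ ENNReal.ofReal (Real.exp (v - θ * x)) := by
  have hmeas : Measurable fun ω => ENNReal.ofReal (Real.exp (θ * Y ω)) := by fun_prop
  have hpos : 0 < Real.exp (θ * x) := Real.exp_pos _
  have h1 : μ {ω | x < Y ω} ≤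
      μ {ω | ENNReal.ofReal (Real.exp (θ * x)) ≤ ENNReal.ofReal (Real.exp (θ * Y ω))} := by
    refine measure_mono fun ω hω => ENNReal.ofReal_le_ofReal (Real.exp_le_exp.2 ?_)
    exact mul_le_mul_of_nonneg_left (le_of_lt hω) hθ
  refine h1.trans ((meas_ge_le_lintegral_div hmeas.aemeasurable
    (by simpa using hpos) ENNReal.ofReal_ne_top).trans ?_)
  rw [Real.exp_sub, ENNReal.ofReal_div_of_pos hpos]
  exact ENNReal.div_le_div_right h _

theorem measure_lt_abs_le_exp {Y : Ω → ℝ} (hY : Measurable Y) {θ v x : ℝ} (hθ : 0 ≤ θ)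
    (h1 : ∫⁻ ω, ENNReal.ofReal (Real.exp (θ * Y ω)) ∂μ ≤ ENNReal.ofReal (Real.exp v))
    (h2 : ∫⁻ ω, ENNReal.ofReal (Real.exp (-θ * Y ω)) ∂μ ≤ ENNReal.ofReal (Real.exp v)) :
    μ {ω | x < |Y ω|} ≤ ENNReal.ofReal (2 * Real.exp (v - θ * x)) := by
  have hsub : {ω | x < |Y ω|} ⊆ {ω | x < Y ω} ∪ {ω | x < -Y ω} := by
    intro ω hω
    have h : x < |Y ω| := hω
    exact lt_abs.1 h
  have h3 := measure_lt_le_exp (Y := fun ω => -Y ω) (x := x) hY.neg hθ (v := v)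
    (by simpa only [mul_neg, neg_mul] using h2)
  refine (measure_mono hsub).trans ((measure_union_le _ _).trans ?_)
  rw [two_mul, ENNReal.ofReal_add (Real.exp_nonneg _) (Real.exp_nonneg _)]
  exact add_le_add (measure_lt_le_exp hY hθ h1) h3

variable {ι : Type*}

/-- The points of the dyadic grid of level `k` on `[-M, M]^ι`. -/
noncomputable def gridPt (M : ℝ) (k : ℕ) (j : ι → ℕ) (r : ι) : ℝ := -M + 2 * M * ((j r : ℝ) / 2 ^ k)

theorem abs_gridPt_le {M : ℝ} (hM : 0 ≤ M) {k : ℕ} {j : ι → ℕ} (hj : ∀ r, j r ≤ 2 ^ k) (r : ι) :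
    |gridPt M k j r| ≤ M := by
  have h0 : (0 : ℝ) ≤ (j r : ℝ) / 2 ^ k := by positivity
  have h1 : (j r : ℝ) / 2 ^ k ≤ 1 := by
    rw [div_le_one (by positivity)]; exact_mod_cast hj r
  rw [gridPt, abs_le]
  constructor <;> nlinarith

theorem gridPt_parent {M : ℝ} (hM : 0 ≤ M) (k : ℕ) (j : ι → ℕ) (r : ι) :
    gridPt M k (fun s => j s / 2) r ≤ gridPt M (k + 1) j r ∧
      gridPt M (k + 1) j r - gridPt M k (fun s => j s / 2) r ≤ 2 * M / 2 ^ (k + 1) := by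
  have h1 : 2 * (j r / 2) ≤ j r := Nat.mul_div_le _ _
  have h2 : j r ≤ 2 * (j r / 2) + 1 := by omega
  have h1' : (2 : ℝ) * ((j r / 2 : ℕ) : ℝ) ≤ (j r : ℝ) := by exact_mod_cast h1
  have h2' : (j r : ℝ) ≤ 2 * ((j r / 2 : ℕ) : ℝ) + 1 := by exact_mod_cast h2
  have e : ((j r / 2 : ℕ) : ℝ) / 2 ^ k = (2 * ((j r / 2 : ℕ) : ℝ)) / 2 ^ (k + 1) := by
    rw [pow_succ]; field_simp
  have hp : (0 : ℝ) < 2 ^ (k + 1) := by positivity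
  simp only [gridPt]
  rw [e]
  have h3 := div_le_div_of_nonneg_right h1' hp.le
  have h4 := div_le_div_of_nonneg_right h2' hp.le
  rw [add_div] at h4
  constructor
  · nlinarith
  · have : 2 * M / 2 ^ (k + 1) = 2 * M * (1 / 2 ^ (k + 1)) := by ring
    rw [this]; nlinarith

theorem exists_gridPt {M : ℝ} (hM : 0 < M) (k : ℕ) {g : ι → ℝ} (hg : ∀ r, |g r| ≤ M) :
    ∃ j j' : ι → ℕ, (∀ r, j r ≤ 2 ^ k) ∧ (∀ r, j' r ≤ 2 ^ k) ∧
      (∀ r, gridPt M k j r ≤ g r ∧ g r ≤ gridPt M k j' r ∧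
        gridPt M k j' r - gridPt M k j r ≤ 2 * M / 2 ^ k) := by
  have hp : (0 : ℝ) < 2 ^ k := by positivity
  have key : ∀ r, ∃ j j' : ℕ, j ≤ 2 ^ k ∧ j' ≤ 2 ^ k ∧
      -M + 2 * M * ((j : ℝ) / 2 ^ k) ≤ g r ∧ g r ≤ -M + 2 * M * ((j' : ℝ) / 2 ^ k) ∧
      (-M + 2 * M * ((j' : ℝ) / 2 ^ k)) - (-M + 2 * M * ((j : ℝ) / 2 ^ k)) ≤ 2 * M / 2 ^ k := by
    intro r
    obtain ⟨h1, h2⟩ := abs_le.1 (hg r)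
    set x : ℝ := (g r + M) / (2 * M) * 2 ^ k with hx
    have hx0 : 0 ≤ x := mul_nonneg (div_nonneg (by linarith) (by linarith)) hp.le
    have hx1 : x ≤ 2 ^ k := by
      have : (g r + M) / (2 * M) ≤ 1 := by rw [div_le_one (by linarith)]; linarith
      nlinarith
    have hgx : g r = -M + 2 * M * (x / 2 ^ k) := by rw [hx]; field_simp; ring
    have mono : ∀ a b : ℝ, a ≤ b → -M + 2 * M * (a / 2 ^ k) ≤ -M + 2 * M * (b / 2 ^ k) := by
      intro a b hab
      have := mul_le_mul_of_nonneg_left (div_le_div_of_nonneg_right hab hp.le)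
        (by linarith : 0 ≤ 2 * M)
      linarith
    refine ⟨⌊x⌋₊, min (⌊x⌋₊ + 1) (2 ^ k), ?_, min_le_right _ _, ?_, ?_, ?_⟩
    · exact Nat.floor_le_of_le (by exact_mod_cast hx1)
    · rw [hgx]; exact mono _ _ (Nat.floor_le hx0)
    · rw [hgx]; refine mono _ _ ?_
      push_cast
      exact le_min (Nat.lt_floor_add_one x).le hx1
    · have h3 := mono _ _ (show ((min (⌊x⌋₊ + 1) (2 ^ k) : ℕ) : ℝ) ≤ (⌊x⌋₊ : ℝ) + 1 by
        push_cast; exact min_le_left _ _)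
      have : -M + 2 * M * (((⌊x⌋₊ : ℝ) + 1) / 2 ^ k) =
        -M + 2 * M * ((⌊x⌋₊ : ℝ) / 2 ^ k) + 2 * M / 2 ^ k := by ring
      linarith
  choose j j' h using key
  exact ⟨j, j', fun r => (h r).1, fun r => (h r).2.1, fun r => (h r).2.2⟩

theorem sum_range_mul_geometric_le (A x : ℝ) (hA : 0 ≤ A) (hx : 0 ≤ x) (K : ℕ) :
    ∑ k ∈ Finset.range K, (A * k + x) * (3 / 4 : ℝ) ^ k ≤ 12 * A + 4 * x := by
  have hr : ‖(3 / 4 : ℝ)‖ < 1 := by norm_num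
  have h1 := hasSum_coe_mul_geometric_of_norm_lt_one hr
  have h2 := hasSum_geometric_of_norm_lt_one hr
  have h3 := (h1.mul_left A).add (h2.mul_left x)
  have h4 := sum_le_hasSum (Finset.range K) (fun k _ => by positivity) h3
  refine le_trans (le_of_eq (Finset.sum_congr rfl fun k _ => by ring)) (h4.trans (le_of_eq ?_))
  norm_num; ring

/-- A maximal inequality by dyadic chaining, for a process `X` on the box `[-M, M]^ι` with
exponential increments up to the scale `R` and a bracketing property that controls it below. -/
theorem measure_exists_lt_abs_le [Fintype ι] {X : (ι → ℝ) → Ω → ℝ} (hX : ∀ g, Measurable (X g))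
    {M V R : ℝ} (hM : 0 < M) (hR : 1 ≤ R) (hV : 0 ≤ V)
    (hroot : ∀ g, (∀ r, |g r| ≤ M) → ∀ θ : ℝ, |θ| ≤ 1 →
      ∫⁻ ω, ENNReal.ofReal (Real.exp (θ * X g ω)) ∂μ ≤ ENNReal.ofReal (Real.exp V))
    (hincr : ∀ g g' : ι → ℝ, (∀ r, |g r| ≤ M) → (∀ r, |g' r| ≤ M) → ∀ η : ℝ,
      (∀ r, g' r ≤ g r ∧ g r - g' r ≤ η) → ∀ θ : ℝ, |θ| ≤ R →
      ∫⁻ ω, ENNReal.ofReal (Real.exp (θ * (X g ω - X g' ω))) ∂μ ≤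
        ENNReal.ofReal (Real.exp (θ ^ 2 * (V * η))))
    (hbr : ∀ᵐ ω ∂μ, ∀ g h g' : ι → ℝ, ∀ η : ℝ,
      (∀ r, g r ≤ h r ∧ h r ≤ g' r ∧ g' r - g r ≤ η) →
        X g ω - R * (V * η) ≤ X h ω ∧ X h ω ≤ X g' ω + R * (V * η))
    {x : ℝ} (hx : 0 ≤ x) :
    μ {ω | ∃ g : ι → ℝ, (∀ r, |g r| ≤ M) ∧
        12 * (Fintype.card ι + 1) + 5 * x + 4 * V * M < |X g ω|} ≤
      ENNReal.ofReal (6 * Real.exp (2 * V * M + V + Fintype.card ι - x)) := by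
  classical
  set d : ℕ := Fintype.card ι with hd
  obtain ⟨K, hK1, hK2⟩ := exists_nat_pow_near hR (by norm_num : (1 : ℝ) < 2)
  set e : ℕ → ℝ := fun k => (((d : ℝ) + 1) * k + x) * (3 / 4 : ℝ) ^ k with he
  set val : (k : ℕ) → (ι → Fin (2 ^ k + 1)) → ι → ℕ := fun k j r => (j r : ℕ) with hval
  have hvle : ∀ k (j : ι → Fin (2 ^ k + 1)) r, val k j r ≤ 2 ^ k := fun k j r =>
    Nat.lt_succ_iff.1 (j r).2
  set E0 : Set Ω := ⋃ j : ι → Fin (2 ^ 0 + 1), {ω | x < |X (gridPt M 0 (val 0 j)) ω|} with hE0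
  set E : ℕ → Set Ω := fun k => ⋃ j : ι → Fin (2 ^ (k + 1) + 1),
    {ω | e (k + 1) < |X (gridPt M (k + 1) (val (k + 1) j)) ω -
      X (gridPt M k (fun s => val (k + 1) j s / 2)) ω|} with hE
  have hcard : ∀ k : ℕ, ((Fintype.card (ι → Fin (2 ^ k + 1)) : ℕ) : ℝ) ≤
      Real.exp ((k + 1) * d) := by
    intro k
    have h1 : Fintype.card (ι → Fin (2 ^ k + 1)) = (2 ^ k + 1) ^ d := by simp [hd]
    have h2 : ((2 : ℝ) ^ k + 1) ≤ Real.exp (k + 1) := by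
      have h3 : (2 : ℝ) ≤ Real.exp 1 := by have := Real.add_one_le_exp (1 : ℝ); linarith
      have h4 : (1 : ℝ) ≤ 2 ^ k := one_le_pow₀ (by norm_num)
      calc (2 : ℝ) ^ k + 1 ≤ 2 ^ (k + 1) := by rw [pow_succ]; linarith
        _ ≤ Real.exp 1 ^ (k + 1) := pow_le_pow_left₀ (by norm_num) h3 _
        _ = Real.exp (k + 1) := by rw [← Real.exp_nat_mul]; push_cast; ring_nf
    rw [h1]
    push_cast
    calc ((2 : ℝ) ^ k + 1) ^ d ≤ Real.exp (k + 1) ^ d := pow_le_pow_left₀ (by positivity) h2 _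
      _ = Real.exp ((k + 1) * d) := by rw [← Real.exp_nat_mul]; ring_nf
  have hunion : ∀ (k : ℕ) (s : (ι → Fin (2 ^ k + 1)) → Set Ω) (b : ℝ),
      (∀ j, μ (s j) ≤ ENNReal.ofReal (2 * Real.exp b)) →
      μ (⋃ j, s j) ≤ ENNReal.ofReal (2 * Real.exp ((k + 1) * d + b)) := by
    intro k s b hs
    refine (measure_iUnion_fintype_le μ s).trans ((Finset.sum_le_sum fun j _ => hs j).trans ?_)
    rw [Finset.sum_const, Finset.card_univ, nsmul_eq_mul, ← ENNReal.ofReal_natCast,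
      ← ENNReal.ofReal_mul (Nat.cast_nonneg _)]
    refine ENNReal.ofReal_le_ofReal ?_
    rw [Real.exp_add]
    have := mul_le_mul_of_nonneg_right (hcard k) (by positivity : 0 ≤ 2 * Real.exp b)
    linarith
  have hμ0 : μ E0 ≤ ENNReal.ofReal (2 * Real.exp (2 * V * M + V + d - x)) := by
    refine (hunion 0 _ (V - x) fun j => ?_).trans (ENNReal.ofReal_le_ofReal ?_)
    · have hb := abs_gridPt_le hM.le (hvle 0 j)
      have := measure_lt_abs_le_exp (μ := μ) (x := x) (hX (gridPt M 0 (val 0 j))) zero_le_one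
        (hroot _ hb 1 (by simp)) (hroot _ hb (-1) (by simp))
      rwa [one_mul] at this
    · have : (0 : ℝ) ≤ 2 * V * M := by positivity
      refine mul_le_mul_of_nonneg_left (Real.exp_le_exp.2 ?_) (by norm_num)
      push_cast; linarith
  have hμ : ∀ k < K, μ (E k) ≤
      ENNReal.ofReal (2 * Real.exp (2 * V * M + V + d - x) * (1 / 2) ^ (k + 1)) := by
    intro k hk
    have hθ0 : (0 : ℝ) ≤ (4 / 3) ^ (k + 1) := by positivity
    have hθR : (4 / 3 : ℝ) ^ (k + 1) ≤ R :=
      ((pow_le_pow_left₀ (by norm_num) (by norm_num : (4 / 3 : ℝ) ≤ 2) _).trans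
        (pow_le_pow_right₀ (by norm_num) hk)).trans hK1
    have hvar : ((4 / 3 : ℝ) ^ (k + 1)) ^ 2 * (V * (2 * M / 2 ^ (k + 1))) ≤ 2 * V * M := by
      have h1 : ((4 / 3 : ℝ) ^ (k + 1)) ^ 2 ≤ 2 ^ (k + 1) := by
        rw [← pow_mul, mul_comm, pow_mul]
        exact pow_le_pow_left₀ (by norm_num) (by norm_num) _
      calc ((4 / 3 : ℝ) ^ (k + 1)) ^ 2 * (V * (2 * M / 2 ^ (k + 1)))
          ≤ 2 ^ (k + 1) * (V * (2 * M / 2 ^ (k + 1))) :=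
            mul_le_mul_of_nonneg_right h1 (by positivity)
        _ = 2 * V * M := by field_simp
    have hmono : Real.exp (((4 / 3 : ℝ) ^ (k + 1)) ^ 2 * (V * (2 * M / 2 ^ (k + 1)))) ≤
        Real.exp (2 * V * M) := Real.exp_le_exp.2 hvar
    refine (hunion (k + 1) _ (2 * V * M - (((d : ℝ) + 1) * ((k + 1 : ℕ) : ℝ) + x)) fun j => ?_).trans
      (ENNReal.ofReal_le_ofReal ?_)
    · have hb := abs_gridPt_le hM.le (hvle (k + 1) j)
      have hb' : ∀ r, |gridPt M k (fun s => val (k + 1) j s / 2) r| ≤ M := by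
        refine abs_gridPt_le hM.le fun r => ?_
        have := hvle (k + 1) j r
        rw [pow_succ] at this
        omega
      have hp := gridPt_parent hM.le k (val (k + 1) j)
      have h1 := hincr _ _ hb hb' (2 * M / 2 ^ (k + 1)) hp ((4 / 3) ^ (k + 1))
        (by rwa [abs_of_nonneg hθ0])
      have h2 := hincr _ _ hb hb' (2 * M / 2 ^ (k + 1)) hp (-(4 / 3) ^ (k + 1))
        (by rwa [abs_neg, abs_of_nonneg hθ0])
      rw [neg_sq] at h2
      have := measure_lt_abs_le_exp (μ := μ) (x := e (k + 1))
        ((hX (gridPt M (k + 1) (val (k + 1) j))).sub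
          (hX (gridPt M k (fun s => val (k + 1) j s / 2)))) hθ0
        (h1.trans (ENNReal.ofReal_le_ofReal hmono)) (h2.trans (ENNReal.ofReal_le_ofReal hmono))
      refine this.trans (le_of_eq ?_)
      have h5 : (4 / 3 : ℝ) ^ (k + 1) * e (k + 1) = ((d : ℝ) + 1) * ((k + 1 : ℕ) : ℝ) + x := by
        simp only [he]
        rw [mul_comm, mul_assoc, ← mul_pow]
        norm_num
      rw [h5]
    · have h6 : Real.exp (-((k + 1 : ℕ) : ℝ)) ≤ (1 / 2) ^ (k + 1) := by
        rw [Real.exp_neg, ← Real.exp_one_pow, one_div, inv_pow]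
        refine inv_anti₀ (by positivity) (pow_le_pow_left₀ (by norm_num) ?_ _)
        have := Real.add_one_le_exp (1 : ℝ); linarith
      refine (mul_le_mul_of_nonneg_left ?_ zero_le_two).trans_eq (mul_assoc _ _ _).symm
      calc Real.exp ((((k + 1 : ℕ) : ℝ) + 1) * d +
            (2 * V * M - (((d : ℝ) + 1) * ((k + 1 : ℕ) : ℝ) + x)))
          ≤ Real.exp ((2 * V * M + V + d - x) + -((k + 1 : ℕ) : ℝ)) :=
            Real.exp_le_exp.2 (by nlinarith)
        _ = Real.exp (2 * V * M + V + d - x) * Real.exp (-((k + 1 : ℕ) : ℝ)) := Real.exp_add _ _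
        _ ≤ _ := mul_le_mul_of_nonneg_left h6 (Real.exp_nonneg _)
  have hbad : {ω | ∃ g : ι → ℝ, (∀ r, |g r| ≤ M) ∧
        12 * ((d : ℝ) + 1) + 5 * x + 4 * V * M < |X g ω|} ≤ᵐ[μ]
      (E0 ∪ ⋃ k ∈ Finset.range K, E k : Set Ω) := by
    filter_upwards [hbr] with ω hω
    rintro ⟨g, hg, hlt⟩
    by_contra hcon
    have hcon' : ω ∉ (E0 ∪ ⋃ k ∈ Finset.range K, E k : Set Ω) := hcon
    rw [mem_union, not_or] at hcon'
    obtain ⟨h0, hk⟩ := hcon'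
    have h0' : ∀ j : ι → Fin (2 ^ 0 + 1), |X (gridPt M 0 (val 0 j)) ω| ≤ x := by
      intro j
      by_contra hc
      exact h0 (mem_iUnion.2 ⟨j, not_le.1 hc⟩)
    have hk' : ∀ k < K, ∀ j : ι → Fin (2 ^ (k + 1) + 1),
        |X (gridPt M (k + 1) (val (k + 1) j)) ω -
          X (gridPt M k (fun s => val (k + 1) j s / 2)) ω| ≤ e (k + 1) := by
      intro k hkK j
      by_contra hc
      exact hk (mem_biUnion (Finset.mem_coe.2 (Finset.mem_range.2 hkK))
        (mem_iUnion.2 ⟨j, not_le.1 hc⟩))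
    have hbound : ∀ k ≤ K, ∀ j : ι → ℕ, (∀ r, j r ≤ 2 ^ k) →
        |X (gridPt M k j) ω| ≤ x + ∑ i ∈ Finset.range k, e (i + 1) := by
      intro k
      induction k with
      | zero =>
        intro _ j hj
        have := h0' fun r => ⟨j r, Nat.lt_succ_of_le (hj r)⟩
        simpa using this
      | succ k ih =>
        intro hkK j hj
        have h1 := hk' k hkK fun r => ⟨j r, Nat.lt_succ_of_le (hj r)⟩
        have h2 := ih (by omega) (fun s => j s / 2) fun r => by
          have := hj r
          rw [pow_succ] at this
          omega
        rw [Finset.sum_range_succ]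
        have h3 := abs_sub_abs_le_abs_sub (X (gridPt M (k + 1) j) ω)
          (X (gridPt M k (fun s => j s / 2)) ω)
        have h4 : |X (gridPt M (k + 1) j) ω - X (gridPt M k (fun s => j s / 2)) ω| ≤ e (k + 1) := h1
        linarith
    have hsum : ∑ i ∈ Finset.range K, e (i + 1) ≤ 12 * ((d : ℝ) + 1) + 4 * x := by
      have h1 := sum_range_mul_geometric_le ((d : ℝ) + 1) x (by positivity) hx (K + 1)
      rw [Finset.sum_range_succ'] at h1
      have h2 : (0 : ℝ) ≤ (((d : ℝ) + 1) * ((0 : ℕ) : ℝ) + x) * (3 / 4) ^ 0 := by simpa using hx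
      simp only [he]
      linarith
    obtain ⟨j, j', hj, hj', hjj⟩ := exists_gridPt hM K hg
    obtain ⟨hlo, hhi⟩ := hω _ g _ _ hjj
    have hb1 := abs_le.1 (hbound K le_rfl j hj)
    have hb2 := abs_le.1 (hbound K le_rfl j' hj')
    have hRV : R * (V * (2 * M / 2 ^ K)) ≤ 4 * V * M := by
      have h1 : R / 2 ^ K ≤ 2 := by
        rw [div_le_iff₀ (by positivity)]
        rw [pow_succ] at hK2
        linarith
      calc R * (V * (2 * M / 2 ^ K)) = (R / 2 ^ K) * (2 * V * M) := by ring
        _ ≤ 2 * (2 * V * M) := mul_le_mul_of_nonneg_right h1 (by positivity)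
        _ = _ := by ring
    have : |X g ω| ≤ 12 * ((d : ℝ) + 1) + 5 * x + 4 * V * M := by
      rw [abs_le]; constructor <;> linarith [hb1.1, hb2.2]
    linarith
  refine (measure_mono_ae hbad).trans ((measure_union_le _ _).trans ?_)
  have hsumE : μ (⋃ k ∈ Finset.range K, E k) ≤
      ENNReal.ofReal (4 * Real.exp (2 * V * M + V + d - x)) := by
    refine (measure_biUnion_finset_le _ _).trans
      ((Finset.sum_le_sum fun k hk => hμ k (Finset.mem_range.1 hk)).trans ?_)
    rw [← ENNReal.ofReal_sum_of_nonneg fun k _ => by positivity]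
    refine ENNReal.ofReal_le_ofReal ?_
    rw [← Finset.mul_sum]
    have h1 : ∑ k ∈ Finset.range K, (1 / 2 : ℝ) ^ (k + 1) ≤ 2 := by
      have h2 := sum_le_hasSum (Finset.range (K + 1)) (fun k _ => by positivity)
        hasSum_geometric_two
      rw [Finset.sum_range_succ'] at h2
      have : (0 : ℝ) ≤ (1 / 2) ^ 0 := by norm_num
      linarith
    nlinarith [Real.exp_pos (2 * V * M + V + d - x)]
  refine (add_le_add hμ0 hsumE).trans (le_of_eq ?_)
  rw [← ENNReal.ofReal_add (by positivity) (by positivity)]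
  congr 1; ring

end Chaining

section Independence

variable {Ω α β : Type*} [MeasurableSpace Ω] [MeasurableSpace α] [MeasurableSpace β]
  {μ : Measure Ω} [IsProbabilityMeasure μ]

theorem _root_.ProbabilityTheory.IndepFun.lintegral_comp_prodMk {W : Ω → α} {V : Ω → β}
    (hind : IndepFun W V μ) (hW : Measurable W) (hV : Measurable V) {h : α × β → ENNReal}
    (hh : Measurable h) :
    ∫⁻ ω, h (W ω, V ω) ∂μ = ∫⁻ ω, ∫⁻ u, h (W ω, u) ∂(μ.map V) ∂μ := by
  have h1 := (indepFun_iff_map_prod_eq_prod_map_map hW.aemeasurable hV.aemeasurable).1 hind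
  have : IsProbabilityMeasure (μ.map V) := Measure.isProbabilityMeasure_map hV.aemeasurable
  rw [← lintegral_map (f := h) hh (hW.prodMk hV), h1, lintegral_prod _ hh.aemeasurable,
    lintegral_map (hh.lintegral_prod_right') hW]

end Independence

section ExponentialMoments

theorem exp_le_one_add_add_sq {x : ℝ} (hx : |x| ≤ 1) : Real.exp x ≤ 1 + x + x ^ 2 := by
  have := (abs_le.1 (Real.abs_exp_sub_one_sub_id_le hx)).2
  linarith

theorem lintegral_exp_indicator_le {α : Type*} [MeasurableSpace α] (ν : Measure α)
    [IsProbabilityMeasure ν] {A : Set α} (hA : MeasurableSet A) {z θ : ℝ} (hz0 : 0 ≤ z)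
    (hz1 : z ≤ 1) (hθ : |θ| ≤ 1) :
    ∫⁻ u, ENNReal.ofReal (Real.exp (θ * (z * (A.indicator 1 u - ν.real A)))) ∂ν ≤
      ENNReal.ofReal (Real.exp (θ ^ 2 * ν.real A)) := by
  set δ := ν.real A with hδ
  have hδ0 : 0 ≤ δ := measureReal_nonneg
  have hδ1 : δ ≤ 1 := measureReal_le_one
  have hc : ν.real Aᶜ = 1 - δ := by rw [measureReal_compl hA]; simp [hδ]
  have hθz : |θ * z| ≤ 1 := by
    rw [abs_mul, abs_of_nonneg hz0]
    exact mul_le_one₀ hθ hz0 hz1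
  rw [← lintegral_add_compl _ hA]
  have h1 : ∫⁻ u in A, ENNReal.ofReal (Real.exp (θ * (z * (A.indicator 1 u - δ)))) ∂ν =
      ENNReal.ofReal (Real.exp (θ * z * (1 - δ)) * δ) := by
    rw [setLIntegral_congr_fun hA (g := fun _ => ENNReal.ofReal (Real.exp (θ * z * (1 - δ))))
      (fun u hu => by simp [indicator_of_mem hu, mul_assoc]), setLIntegral_const,
      ENNReal.ofReal_mul (Real.exp_nonneg _), hδ, ofReal_measureReal]
  have h2 : ∫⁻ u in Aᶜ, ENNReal.ofReal (Real.exp (θ * (z * (A.indicator 1 u - δ)))) ∂ν =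
      ENNReal.ofReal (Real.exp (θ * z * (-δ)) * (1 - δ)) := by
    rw [setLIntegral_congr_fun hA.compl (g := fun _ => ENNReal.ofReal (Real.exp (θ * z * (-δ))))
      (fun u hu => by simp [indicator_of_notMem hu, mul_assoc]), setLIntegral_const,
      ENNReal.ofReal_mul (Real.exp_nonneg _), ← hc, ofReal_measureReal]
  rw [h1, h2, ← ENNReal.ofReal_add (by positivity) (mul_nonneg (Real.exp_nonneg _) (by linarith))]
  refine ENNReal.ofReal_le_ofReal ?_
  have e1 := exp_le_one_add_add_sq (x := θ * z * (1 - δ)) (by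
    rw [abs_mul, abs_of_nonneg (by linarith : 0 ≤ 1 - δ)]
    exact mul_le_one₀ hθz (by linarith) (by linarith))
  have e2 := exp_le_one_add_add_sq (x := θ * z * (-δ)) (by
    rw [abs_mul, abs_neg, abs_of_nonneg hδ0]
    exact mul_le_one₀ hθz hδ0 hδ1)
  have e3 := Real.add_one_le_exp (θ ^ 2 * δ)
  have e4 : (θ * z) ^ 2 ≤ θ ^ 2 := by
    rw [mul_pow]
    have : z ^ 2 ≤ 1 := by nlinarith
    nlinarith [sq_nonneg θ]
  have e5 : (θ * z) ^ 2 * (δ * (1 - δ)) ≤ θ ^ 2 * δ := by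
    have h6 : δ * (1 - δ) ≤ δ := by nlinarith
    have h7 : 0 ≤ δ * (1 - δ) := mul_nonneg hδ0 (by linarith)
    exact mul_le_mul e4 h6 h7 (sq_nonneg _)
  have e6 := mul_le_mul_of_nonneg_right e1 hδ0
  have e7 := mul_le_mul_of_nonneg_right e2 (by linarith : 0 ≤ 1 - δ)
  nlinarith

variable {Ω ζ : Type*} [MeasurableSpace Ω] [MeasurableSpace ζ] {μ : Measure Ω}
  [IsProbabilityMeasure μ]

/-- The moment generating function of a sum of martingale differences `ψ (Z_t, V_t)` for which
`V_t` is independent of the past, when the conditional moment generating functions are bounded. -/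
theorem lintegral_exp_sum_le {Z : ℕ → Ω → ζ} {V X : ℕ → Ω → ℝ} {ψ : ζ → ℝ → ℝ}
    (hψ : Measurable (Function.uncurry ψ)) (hZ : ∀ t, Measurable (Z t))
    (hV : ∀ t, Measurable (V t)) (hX : ∀ t, Measurable (X t))
    (hXψ : ∀ t, ∀ᵐ ω ∂μ, X t ω = ψ (Z t ω) (V t ω))
    (hind : ∀ t, IndepFun (fun ω => (∑ s ∈ Finset.Icc 1 t, X s ω, Z (t + 1) ω)) (V (t + 1)) μ)
    {θ w : ℝ} (hmgf : ∀ t, ∀ᵐ ω ∂μ,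
      ∫⁻ u, ENNReal.ofReal (Real.exp (θ * ψ (Z t ω) u)) ∂(μ.map (V t)) ≤
        ENNReal.ofReal (Real.exp w)) (T : ℕ) :
    ∫⁻ ω, ENNReal.ofReal (Real.exp (θ * ∑ t ∈ Finset.Icc 1 T, X t ω)) ∂μ ≤
      ENNReal.ofReal (Real.exp (T * w)) := by
  induction T with
  | zero => simp
  | succ T ih =>
    have hS : Measurable fun ω => ∑ s ∈ Finset.Icc 1 T, X s ω :=
      Finset.measurable_sum _ fun s _ => hX s
    set h : (ℝ × ζ) × ℝ → ENNReal := fun p =>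
      ENNReal.ofReal (Real.exp (θ * p.1.1)) * ENNReal.ofReal (Real.exp (θ * ψ p.1.2 p.2)) with hh
    have hψ' : Measurable fun p : (ℝ × ζ) × ℝ => ψ p.1.2 p.2 :=
      hψ.comp (measurable_fst.snd.prodMk measurable_snd)
    have hmeas : Measurable h := by
      refine Measurable.mul (f := fun p : (ℝ × ζ) × ℝ => ENNReal.ofReal (Real.exp (θ * p.1.1)))
        (g := fun p => ENNReal.ofReal (Real.exp (θ * ψ p.1.2 p.2))) ?_ ?_
      · fun_prop
      · exact (Real.measurable_exp.comp (hψ'.const_mul θ)).ennreal_ofReal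
    have h1 : ∫⁻ ω, ENNReal.ofReal (Real.exp (θ * ∑ t ∈ Finset.Icc 1 (T + 1), X t ω)) ∂μ =
        ∫⁻ ω, h ((∑ s ∈ Finset.Icc 1 T, X s ω, Z (T + 1) ω), V (T + 1) ω) ∂μ := by
      refine lintegral_congr_ae ?_
      filter_upwards [hXψ (T + 1)] with ω hω
      rw [Finset.sum_Icc_succ_top (by omega), mul_add, Real.exp_add,
        ENNReal.ofReal_mul (Real.exp_nonneg _), hω]
    rw [h1, (hind T).lintegral_comp_prodMk (hS.prodMk (hZ _)) (hV _) hmeas]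
    have h2 : ∀ᵐ ω ∂μ, ∫⁻ u, h ((∑ s ∈ Finset.Icc 1 T, X s ω, Z (T + 1) ω), u)
          ∂(μ.map (V (T + 1))) ≤
        ENNReal.ofReal (Real.exp (θ * ∑ t ∈ Finset.Icc 1 T, X t ω)) *
          ENNReal.ofReal (Real.exp w) := by
      filter_upwards [hmgf (T + 1)] with ω hω
      simp only [hh]
      rw [lintegral_const_mul']
      · exact mul_le_mul_right hω _
      · exact ENNReal.ofReal_ne_top
    refine (lintegral_mono_ae h2).trans ?_
    rw [lintegral_mul_const' _ _ ENNReal.ofReal_ne_top]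
    refine (mul_le_mul_left ih _).trans (le_of_eq ?_)
    rw [← ENNReal.ofReal_mul (Real.exp_nonneg _), ← Real.exp_add]
    congr 2; push_cast; ring

end ExponentialMoments

section EmpiricalProcess

variable {ι : Type*} [Fintype ι]

/-- The function `u ↦ zᵀ φ(u)`. -/
def mix (φ : ι → ℝ → ℝ) (z : ι → ℝ) (u : ℝ) : ℝ := ∑ r, z r * φ r u

theorem measurable_mix {φ : ι → ℝ → ℝ} (hφ : ∀ r, Measurable (φ r)) :
    Measurable fun p : (ι → ℝ) × ℝ => mix φ p.1 p.2 :=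
  Finset.measurable_sum _ fun r _ =>
    ((measurable_pi_apply r).comp measurable_fst).mul ((hφ r).comp measurable_snd)

theorem measurable_mix_right {φ : ι → ℝ → ℝ} (hφ : ∀ r, Measurable (φ r)) (z : ι → ℝ) :
    Measurable (mix φ z) := (measurable_mix hφ).comp measurable_prodMk_left

theorem measurable_levelCdf_mix {φ : ι → ℝ → ℝ} (hφ : ∀ r, Measurable (φ r)) :
    Measurable fun p : (ι → ℝ) × ℝ => levelCdf (mix φ p.1) p.2 := by
  have hs : MeasurableSet {p : ((ι → ℝ) × ℝ) × ℝ | mix φ p.1.1 p.2 < p.1.2} :=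
    measurableSet_lt ((measurable_mix hφ).comp (measurable_fst.fst.prodMk measurable_snd))
      measurable_fst.snd
  exact (measurable_measure_prodMk_left (ν := unif) hs).ennreal_toReal

theorem measurable_sum_mul_const (g : ι → ℝ) :
    Measurable fun z : ι → ℝ => ∑ s, z s * g s :=
  Finset.measurable_sum _ fun s _ => (measurable_pi_apply s).mul_const _

/-- A process `Y_t = C_tᵀ φ(V_t)` in which the weights `C_t` form a convex combination and depend on
the past `P t` only, while the uniform innovation `V_t` is independent of the past. -/
structure Driven {Ω : Type*} [mΩ : MeasurableSpace Ω] (μ : Measure Ω) (P : ℕ → MeasurableSpace Ω)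
    (φ : ι → ℝ → ℝ) (B c : ℝ) (C : ℕ → Ω → ι → ℝ) (Y V : ℕ → Ω → ℝ) : Prop where
  B_pos : 0 < B
  c_pos : 0 < c
  measurable_coef : ∀ r, Measurable (φ r)
  past_le : ∀ t, P t ≤ mΩ
  past_mono : Monotone P
  measurable_weight : ∀ t, Measurable[P t] (C t)
  measurable_obs : ∀ t, Measurable[P (t + 1)] (Y t)
  measurable_innov : ∀ t, Measurable (V t)
  indep : ∀ t, Indep (P t) (MeasurableSpace.comap (V t) inferInstance) μ
  law : ∀ t, μ.map (V t) = unif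
  obs_eq : ∀ t, ∀ᵐ ω ∂μ, Y t ω = mix φ (C t ω) (V t ω)
  weight_nonneg : ∀ t, ∀ᵐ ω ∂μ, ∀ r, 0 ≤ C t ω r
  weight_sum : ∀ t, ∀ᵐ ω ∂μ, ∑ r, C t ω r = 1
  slope : ∀ t, ∀ᵐ ω ∂μ, SlopeBounds B c (mix φ (C t ω))

variable {Ω : Type*} [MeasurableSpace Ω] {μ : Measure Ω} [IsProbabilityMeasure μ]
  {P : ℕ → MeasurableSpace Ω} {φ : ι → ℝ → ℝ} {B c : ℝ} {C : ℕ → Ω → ι → ℝ} {Y V : ℕ → Ω → ℝ}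

/-- The centred and weighted indicator of the event that an observation `y = zᵀ φ(u)` lies below
the level `zᵀ g`. -/
noncomputable def score (φ : ι → ℝ → ℝ) (r : ι) (g : ι → ℝ) (z : ι → ℝ) (y : ℝ) : ℝ :=
  z r * ((if y < ∑ s, z s * g s then 1 else 0) - levelCdf (mix φ z) (∑ s, z s * g s))

theorem measurable_score (hφ : ∀ r, Measurable (φ r)) (r : ι) (g : ι → ℝ) :
    Measurable fun p : (ι → ℝ) × ℝ => score φ r g p.1 p.2 := by
  have h1 : Measurable fun p : (ι → ℝ) × ℝ => ∑ s, p.1 s * g s :=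
    (measurable_sum_mul_const g).comp measurable_fst
  refine ((measurable_pi_apply r).comp measurable_fst).mul (Measurable.sub ?_ ?_)
  · exact Measurable.ite (measurableSet_lt measurable_snd h1) measurable_const measurable_const
  · exact (measurable_levelCdf_mix hφ).comp (measurable_fst.prodMk h1)

theorem levelCdf_sub_eq {m : ℝ → ℝ} (hm : Measurable m) {x' x : ℝ} (h : x' ≤ x) :
    levelCdf m x - levelCdf m x' = unif.real {u | x' ≤ m u ∧ m u < x} := by
  have h1 : {u | x' ≤ m u ∧ m u < x} = {u | m u < x} \ {u | m u < x'} := by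
    ext u; simp [and_comm]
  have h2 : {u | m u < x'} ⊆ {u | m u < x} := fun u hu => lt_of_lt_of_le hu h
  rw [h1, measureReal_sdiff h2 (measurableSet_lt hm measurable_const)]
  rfl

theorem Driven.lintegral_exp_sum_le (hD : Driven μ P φ B c C Y V) {ψ : (ι → ℝ) → ℝ → ℝ}
    (hψ : Measurable fun p : (ι → ℝ) × ℝ => ψ p.1 p.2) {θ w : ℝ}
    (hmgf : ∀ t, ∀ᵐ ω ∂μ, ∫⁻ u, ENNReal.ofReal
        (Real.exp (θ * ψ (C t ω) (mix φ (C t ω) u))) ∂unif ≤ ENNReal.ofReal (Real.exp w)) (T : ℕ) :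
    ∫⁻ ω, ENNReal.ofReal (Real.exp (θ * ∑ t ∈ Finset.Icc 1 T, ψ (C t ω) (Y t ω))) ∂μ ≤
      ENNReal.ofReal (Real.exp (T * w)) := by
  have hC : ∀ t, Measurable (C t) := fun t => (hD.measurable_weight t).mono (hD.past_le t) le_rfl
  have hY : ∀ t, Measurable (Y t) := fun t =>
    (hD.measurable_obs t).mono (hD.past_le (t + 1)) le_rfl
  refine SQVAR.lintegral_exp_sum_le (ψ := fun z u => ψ z (mix φ z u)) (Z := C) (V := V)
    (hψ.comp (measurable_fst.prodMk (measurable_mix hD.measurable_coef))) hC hD.measurable_innov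
    (fun t => hψ.comp ((hC t).prodMk (hY t))) (fun t => ?_) (fun t => ?_) (fun t => ?_) T
  · filter_upwards [hD.obs_eq t] with ω hω
    simp only [Function.comp_apply, hω]
  · have hm : Measurable[P (t + 1)]
        fun ω => (∑ s ∈ Finset.Icc 1 t, ψ (C s ω) (Y s ω), C (t + 1) ω) := by
      refine Measurable.prodMk (Finset.measurable_sum _ fun s hs => ?_) (hD.measurable_weight _)
      have hst : s ≤ t := (Finset.mem_Icc.1 hs).2
      exact hψ.comp (((hD.measurable_weight s).mono (hD.past_mono (by omega)) le_rfl).prodMk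
        ((hD.measurable_obs s).mono (hD.past_mono (by omega)) le_rfl))
    rw [IndepFun_iff_Indep]
    exact indep_of_indep_of_le_left (hD.indep (t + 1)) hm.comap_le
  · rw [hD.law t]
    exact hmgf t

theorem sum_mul_le_of_le {z g g' : ι → ℝ} (hz : ∀ r, 0 ≤ z r) (h : ∀ r, g r ≤ g' r) :
    ∑ r, z r * g r ≤ ∑ r, z r * g' r :=
  Finset.sum_le_sum fun r _ => mul_le_mul_of_nonneg_left (h r) (hz r)

theorem sum_mul_sub_le {z g g' : ι → ℝ} {η : ℝ} (hz : ∀ r, 0 ≤ z r) (hz1 : ∑ r, z r = 1)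
    (h : ∀ r, g' r - g r ≤ η) : ∑ r, z r * g' r - ∑ r, z r * g r ≤ η := by
  have h1 : ∑ r, z r * (g' r - g r) ≤ ∑ r, z r * η :=
    Finset.sum_le_sum fun r _ => mul_le_mul_of_nonneg_left (h r) (hz r)
  rw [← Finset.sum_mul, hz1, one_mul] at h1
  simpa only [mul_sub, Finset.sum_sub_distrib] using h1

theorem le_one_of_simplex {z : ι → ℝ} (hz : ∀ r, 0 ≤ z r) (hz1 : ∑ r, z r = 1) (r : ι) :
    z r ≤ 1 := hz1 ▸ Finset.single_le_sum (fun s _ => hz s) (Finset.mem_univ r)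

theorem score_le_score_add {z g h : ι → ℝ} {η y : ℝ} (hB : 0 < B) (hφ : ∀ r, Measurable (φ r))
    (hz : ∀ r, 0 ≤ z r) (hz1 : ∑ r, z r = 1) (hs : SlopeBounds B c (mix φ z)) (r : ι)
    (hgh : ∀ r, g r ≤ h r ∧ h r - g r ≤ η) :
    score φ r g z y ≤ score φ r h z y + B * η := by
  have h1 := sum_mul_le_of_le hz fun r => (hgh r).1
  have h2 := sum_mul_sub_le hz hz1 fun r => (hgh r).2
  have h3 := hs.levelCdf_sub_le hB (measurable_mix_right hφ z) h1
  have h4 := levelCdf_mono (mix φ z) h1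
  have h5 := monotone_indicator_lt y h1
  have h6 := le_one_of_simplex hz hz1 r
  have h7 : B * (∑ s, z s * h s - ∑ s, z s * g s) ≤ B * η := mul_le_mul_of_nonneg_left h2 hB.le
  simp only [score]
  simp only at h5
  have h8 := mul_le_mul_of_nonneg_left h5 (hz r)
  have h9 := mul_le_mul_of_nonneg_right h6 (sub_nonneg.2 h4)
  nlinarith

/-- Tightness of the weighted empirical process, uniformly over bounded linear quantile models. -/
theorem Driven.exists_forall_measure_score_le (hD : Driven μ P φ B c C Y V) {M : ℝ} (hM : 0 < M)
    (r : ι) {ε : ℝ} (hε : 0 < ε) :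
    ∃ K : ℝ, ∀ T : ℕ, 1 ≤ T → μ {ω | ∃ g : ι → ℝ, (∀ s, |g s| ≤ M) ∧
      K * √T < |∑ t ∈ Finset.Icc 1 T, score φ r g (C t ω) (Y t ω)|} ≤ ENNReal.ofReal ε := by
  have hC : ∀ t, Measurable (C t) := fun t => (hD.measurable_weight t).mono (hD.past_le t) le_rfl
  have hY : ∀ t, Measurable (Y t) := fun t =>
    (hD.measurable_obs t).mono (hD.past_le (t + 1)) le_rfl
  have hBp := hD.B_pos
  set D : ℝ := 2 * (B + 1) * M + (B + 1) + Fintype.card ι with hDdef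
  obtain ⟨x, hx0, hx⟩ : ∃ x : ℝ, 0 ≤ x ∧ 6 * Real.exp (D - x) ≤ ε := by
    have h1 : Tendsto (fun x : ℝ => 6 * Real.exp (D - x)) atTop (𝓝 (6 * 0)) :=
      (Real.tendsto_exp_atBot.comp (tendsto_atBot_add_const_left _ D
        tendsto_neg_atTop_atBot)).const_mul 6
    rw [mul_zero] at h1
    obtain ⟨x, h2, h3⟩ := ((h1.eventually_le_const hε).and (eventually_ge_atTop 0)).exists
    exact ⟨x, h3, h2⟩
  refine ⟨12 * (Fintype.card ι + 1) + 5 * x + 4 * (B + 1) * M, fun T hT => ?_⟩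
  have hT' : (1 : ℝ) ≤ T := by exact_mod_cast hT
  have hR : 1 ≤ √(T : ℝ) := Real.one_le_sqrt.2 hT'
  have hR0 : 0 < √(T : ℝ) := by linarith
  have hRR : √(T : ℝ) * √(T : ℝ) = T := Real.mul_self_sqrt (by linarith)
  set X : (ι → ℝ) → Ω → ℝ := fun g ω =>
    (∑ t ∈ Finset.Icc 1 T, score φ r g (C t ω) (Y t ω)) / √(T : ℝ) with hX
  have hφ := hD.measurable_coef
  have key := measure_exists_lt_abs_le (μ := μ) (X := X) (M := M) (V := B + 1) (R := √(T : ℝ))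
    (fun g => (Finset.measurable_sum _ fun t _ =>
      (measurable_score hφ r g).comp ((hC t).prodMk (hY t))).div_const _)
    hM hR (by linarith) ?_ ?_ ?_ hx0
  · refine le_trans (measure_mono ?_) (key.trans (ENNReal.ofReal_le_ofReal hx))
    rintro ω ⟨g, hg, hlt⟩
    refine ⟨g, hg, ?_⟩
    rw [hX, abs_div, abs_of_pos hR0, lt_div_iff₀ hR0]
    exact hlt
  · intro g hg θ hθ
    have h1 : |θ / √(T : ℝ)| ≤ 1 := by
      rw [abs_div, abs_of_pos hR0]
      exact (div_le_one hR0).2 (hθ.trans hR)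
    have h2 := hD.lintegral_exp_sum_le (θ := θ / √(T : ℝ)) (w := (θ / √(T : ℝ)) ^ 2)
      (measurable_score hφ r g) (fun t => ?_) T
    · refine le_trans (le_of_eq ?_) (h2.trans (ENNReal.ofReal_le_ofReal (Real.exp_le_exp.2 ?_)))
      · simp only [hX]
        refine lintegral_congr fun ω => ?_
        congr 2; ring
      · rw [div_pow, Real.sq_sqrt (by linarith), mul_div_cancel₀ _ (by linarith)]
        have := (sq_le_one_iff_abs_le_one θ).2 hθ
        linarith
    · filter_upwards [hD.weight_nonneg t, hD.weight_sum t] with ω hz hz1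
      have h3 := lintegral_exp_indicator_le unif (A := {u | mix φ (C t ω) u < ∑ s, C t ω s * g s})
        (measurableSet_lt (measurable_mix_right hφ _) measurable_const) (hz r)
        (le_one_of_simplex hz hz1 r) h1
      refine le_trans (le_of_eq ?_) (h3.trans (ENNReal.ofReal_le_ofReal (Real.exp_le_exp.2 ?_)))
      · refine lintegral_congr fun u => ?_
        simp only [score, indicator_apply, levelCdf]
        rfl
      · exact mul_le_of_le_one_right (sq_nonneg _) measureReal_le_one
  · intro g g' hg hg' η hη θ hθ
    have h1 : |θ / √(T : ℝ)| ≤ 1 := by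
      rw [abs_div, abs_of_pos hR0]
      exact (div_le_one hR0).2 hθ
    have h2 := hD.lintegral_exp_sum_le (θ := θ / √(T : ℝ))
      (w := (θ / √(T : ℝ)) ^ 2 * ((B + 1) * η))
      (ψ := fun z y => score φ r g z y - score φ r g' z y)
      ((measurable_score hφ r g).sub (measurable_score hφ r g')) (fun t => ?_) T
    · refine le_trans (le_of_eq ?_) (h2.trans (ENNReal.ofReal_le_ofReal (Real.exp_le_exp.2 ?_)))
      · simp only [hX, Finset.sum_sub_distrib]
        refine lintegral_congr fun ω => ?_
        congr 2; ring
      · rw [div_pow, Real.sq_sqrt (by linarith), ← mul_assoc, mul_div_cancel₀ _ (by linarith)]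
    · filter_upwards [hD.weight_nonneg t, hD.weight_sum t, hD.slope t] with ω hz hz1 hs
      have hm := measurable_mix_right hφ (C t ω)
      have hle := sum_mul_le_of_le hz fun s => (hη s).1
      have hle2 := sum_mul_sub_le hz hz1 fun s => (hη s).2
      have h3 := lintegral_exp_indicator_le unif
        (A := {u | ∑ s, C t ω s * g' s ≤ mix φ (C t ω) u ∧ mix φ (C t ω) u < ∑ s, C t ω s * g s})
        ((measurableSet_le measurable_const hm).inter (measurableSet_lt hm measurable_const)) (hz r)
        (le_one_of_simplex hz hz1 r) h1
      rw [← levelCdf_sub_eq hm hle] at h3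
      refine le_trans (le_of_eq ?_) (h3.trans (ENNReal.ofReal_le_ofReal (Real.exp_le_exp.2 ?_)))
      · refine lintegral_congr fun u => ?_
        congr 3
        have : indicator {u | ∑ s, C t ω s * g' s ≤ mix φ (C t ω) u ∧
            mix φ (C t ω) u < ∑ s, C t ω s * g s} (1 : ℝ → ℝ) u =
            (if mix φ (C t ω) u < ∑ s, C t ω s * g s then 1 else 0) -
              (if mix φ (C t ω) u < ∑ s, C t ω s * g' s then 1 else 0) := by
          rw [indicator_apply]
          simp only [mem_ofPred_eq, Pi.one_apply]
          split_ifs with a b d e b d <;> simp_all <;> linarith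
        rw [this, score, score]; ring
      · refine mul_le_mul_of_nonneg_left ?_ (sq_nonneg _)
        refine (hs.levelCdf_sub_le hBp hm hle).trans ?_
        have h4 : 0 ≤ η := by linarith
        nlinarith
  · have hall : ∀ᵐ ω ∂μ, ∀ t, (∀ r, 0 ≤ C t ω r) ∧ ∑ r, C t ω r = 1 ∧
        SlopeBounds B c (mix φ (C t ω)) := by
      rw [ae_all_iff]
      intro t
      filter_upwards [hD.weight_nonneg t, hD.weight_sum t, hD.slope t] with ω h1 h2 h3
      exact ⟨h1, h2, h3⟩
    filter_upwards [hall] with ω hω g h g' η hη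
    have hη0 : 0 ≤ η := by
      obtain ⟨h1, h2, -⟩ := hω 0
      have h3 := sum_mul_sub_le h1 h2 fun s => (hη s).2.2
      have h4 := sum_mul_le_of_le h1 fun s => (hη s).1.trans (hη s).2.1
      linarith
    have step : ∀ a b : ι → ℝ, (∀ s, a s ≤ b s ∧ b s - a s ≤ η) →
        X a ω ≤ X b ω + √(T : ℝ) * ((B + 1) * η) := by
      intro a b hab
      have h1 : ∑ t ∈ Finset.Icc 1 T, score φ r a (C t ω) (Y t ω) ≤
          ∑ t ∈ Finset.Icc 1 T, (score φ r b (C t ω) (Y t ω) + (B + 1) * η) := by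
        refine Finset.sum_le_sum fun t _ => ?_
        refine (score_le_score_add hBp hφ (hω t).1 (hω t).2.1 (hω t).2.2 r hab).trans ?_
        nlinarith
      rw [Finset.sum_add_distrib, Finset.sum_const, Nat.card_Icc, nsmul_eq_mul] at h1
      simp only [hX]
      rw [div_le_iff₀ hR0, add_mul, div_mul_cancel₀ _ hR0.ne']
      refine h1.trans (le_of_eq ?_)
      rw [Nat.add_sub_cancel]
      linear_combination (-(B + 1) * η) * hRR
    constructor
    · have := step g h fun s => ⟨(hη s).1, by linarith [(hη s).2.1, (hη s).2.2]⟩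
      linarith
    · exact step h g' fun s => ⟨(hη s).2.1, by linarith [(hη s).1, (hη s).2.2]⟩

end EmpiricalProcess

section Clip

/-- The projection of the real line onto the unit interval. -/
noncomputable def clip (u : ℝ) : ℝ := max 0 (min 1 u)

theorem clip_mem (u : ℝ) : clip u ∈ Icc (0 : ℝ) 1 :=
  ⟨le_max_left _ _, max_le zero_le_one (min_le_left _ _)⟩

theorem clip_of_mem {u : ℝ} (hu : u ∈ Icc (0 : ℝ) 1) : clip u = u := by
  rw [clip, min_eq_right hu.2, max_eq_right hu.1]

theorem continuous_clip : Continuous clip := by unfold clip; fun_prop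

theorem abs_clip_sub_clip_le (u v : ℝ) : |clip u - clip v| ≤ |u - v| := by
  unfold clip
  refine (abs_max_sub_max_le_max _ _ _ _).trans (max_le (by simp) ?_)
  exact (abs_min_sub_min_le_max _ _ _ _).trans (by simp)

theorem continuous_comp_clip {g : ℝ → ℝ} (hg : ContinuousOn g (Icc 0 1)) :
    Continuous fun u => g (clip u) :=
  hg.comp_continuous continuous_clip clip_mem

end Clip

section Recursion

variable {Ω : Type*} {n p : ℕ}

/-- The stacked vector `(y_{l,t-j})_{l,j}`. -/
def state (y : ℤ → Ω → Fin n → ℝ) (t : ℤ) (ω : Ω) (q : Fin n × Fin p) : ℝ :=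
  y (t - (q.2 : ℕ)) ω q.1

/-- The intercept of the companion form. -/
def shock (θ : Fin n → Idx n p → ℝ → ℝ) (u : Fin n → ℝ) (k : Fin n × Fin p) : ℝ :=
  if (k.2 : ℕ) = 0 then θ k.1 none (u k.1) else 0

open Matrix in
theorem state_eq {θ : Fin n → Idx n p → ℝ → ℝ} {y : ℤ → Ω → Fin n → ℝ} {t : ℤ} {ω : Ω}
    {u : Fin n → ℝ} (h : ∀ k, y t ω k = ∑ q, regressor y t ω q * θ k q (u k)) :
    state (p := p) y t ω = companion θ u *ᵥ state y (t - 1) ω + shock θ u := by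
  funext ⟨k, j⟩
  simp only [Pi.add_apply, mulVec, dotProduct, companion, Matrix.of_apply, shock]
  by_cases hj : (j : ℕ) = 0
  · simp only [if_pos hj]
    have h1 := h k
    rw [Fintype.sum_option] at h1
    simp only [state, hj, Nat.cast_zero, sub_zero]
    rw [h1, add_comm]
    congr 1
    · refine Finset.sum_congr rfl fun q _ => ?_
      rw [mul_comm]
      simp only [regressor]
      rw [sub_sub, add_comm (1 : ℤ)]
    · simp [regressor]
  · simp only [if_neg hj, add_zero]
    obtain ⟨j', hj'⟩ : ∃ j' : Fin p, (j' : ℕ) + 1 = j := ⟨⟨(j : ℕ) - 1, by omega⟩, by simp; omega⟩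
    rw [Finset.sum_eq_single (k, j')]
    · simp only [hj', and_self, if_true, one_mul, state]
      congr 1
      rw [← hj']; push_cast; ring
    · rintro ⟨l, i⟩ - hne
      rw [if_neg, zero_mul]
      rintro ⟨rfl, h2⟩
      refine hne (Prod.ext rfl (Fin.ext ?_))
      simp only at h2 ⊢
      omega
    · simp

open Matrix in
/-- The state at time `t` of the autoregression started from zero `K` periods earlier. -/
def approxState (θ : Fin n → Idx n p → ℝ → ℝ) (u : ℤ → Fin n → ℝ) : ℕ → ℤ → Fin n × Fin p → ℝ
  | 0, _ => 0
  | K + 1, t => companion θ (u t) *ᵥ approxState θ u K (t - 1) + shock θ (u t)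

open Matrix in
theorem state_sub_approxState_add {θ : Fin n → Idx n p → ℝ → ℝ} {y : ℤ → Ω → Fin n → ℝ} {ω : Ω}
    {u : ℤ → Fin n → ℝ} (h : ∀ t k, y t ω k = ∑ q, regressor y t ω q * θ k q (u t k))
    (K m : ℕ) (t : ℤ) :
    state (p := p) y t ω - approxState θ u (K + m) t =
      (List.ofFn fun s : Fin m => companion θ (u (t - (s : ℕ)))).prod *ᵥ
        (state y (t - m) ω - approxState θ u K (t - m)) := by
  induction m generalizing t with
  | zero => simp
  | succ m ih =>
    rw [state_eq (h t), ← add_assoc, approxState, add_sub_add_right_eq_sub, ← mulVec_sub,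
      ih (t - 1), List.ofFn_succ, List.prod_cons, mulVec_mulVec]
    have h1 : t - 1 - (m : ℤ) = t - ((m + 1 : ℕ) : ℤ) := by push_cast; ring
    have h2 : ∀ s : Fin m, t - 1 - ((s : ℕ) : ℤ) = t - ((s.succ : ℕ) : ℤ) := fun s => by
      rw [Fin.val_succ]; push_cast; ring
    simp only [Fin.val_zero, Nat.cast_zero, sub_zero, h1, h2]

open Matrix in
theorem abs_state_sub_approxState_le {θ : Fin n → Idx n p → ℝ → ℝ} {y : ℤ → Ω → Fin n → ℝ}
    {ω : Ω} {u : ℤ → Fin n → ℝ} (h : ∀ t k, y t ω k = ∑ q, regressor y t ω q * θ k q (u t k))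
    (hu : ∀ t k, u t k ∈ Icc (0 : ℝ) 1) {m : ℕ} {r : ℝ}
    (hr : ∀ v : Fin m → Fin n → ℝ, (∀ s k, v s k ∈ Icc (0 : ℝ) 1) →
      ‖Matrix.toEuclideanCLM (𝕜 := ℝ) (List.ofFn fun s => companion θ (v s)).prod‖ ≤ r)
    {A : ℝ} (hA : ∀ t k, |y t ω k| ≤ A) (k : ℕ) (t : ℤ) (q : Fin n × Fin p) :
    |state y t ω q - approxState θ u (m * k) t q| ≤ r ^ k * √((n * p : ℕ) * A ^ 2) := by
  have hr0 : 0 ≤ r := (norm_nonneg _).trans (hr (fun s => u (t - (s : ℕ))) fun s k => hu _ k)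
  have key : ∀ (k : ℕ) (t : ℤ),
      ‖WithLp.toLp 2 (state (p := p) y t ω - approxState θ u (m * k) t)‖ ≤
        r ^ k * √((n * p : ℕ) * A ^ 2) := by
    intro k
    induction k with
    | zero =>
      intro t
      rw [mul_zero, pow_zero, one_mul, EuclideanSpace.norm_eq]
      refine Real.sqrt_le_sqrt ?_
      have h1 : ∀ q ∈ (Finset.univ : Finset (Fin n × Fin p)),
          ‖(WithLp.toLp 2 (state (p := p) y t ω - approxState θ u 0 t)) q‖ ^ 2 ≤ A ^ 2 := by
        intro q _
        simp only [approxState, sub_zero]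
        rw [Real.norm_eq_abs]
        exact pow_le_pow_left₀ (abs_nonneg _) (hA _ _) 2
      refine (Finset.sum_le_sum h1).trans (le_of_eq ?_)
      simp
    | succ k ih =>
      intro t
      rw [Nat.mul_succ, state_sub_approxState_add h, ← Matrix.toEuclideanCLM_toLp]
      refine (ContinuousLinearMap.le_opNorm _ _).trans ?_
      rw [pow_succ', mul_assoc]
      exact mul_le_mul (hr _ fun s k => hu _ k) (ih _) (norm_nonneg _) hr0
  refine le_trans ?_ (key k t)
  have := PiLp.norm_apply_le (WithLp.toLp 2 (state (p := p) y t ω - approxState θ u (m * k) t)) q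
  exact this

theorem measurable_approxState [m : MeasurableSpace Ω] {θ : Fin n → Idx n p → ℝ → ℝ}
    (hθ : ∀ k q, Measurable (θ k q)) {u : ℤ → Ω → Fin n → ℝ} (K : ℕ) (t : ℤ)
    (hu : ∀ s, t - K < s → s ≤ t → Measurable (u s)) :
    Measurable fun ω => approxState θ (fun s => u s ω) K t := by
  induction K generalizing t with
  | zero => exact measurable_const
  | succ K ih =>
    have hut : Measurable (u t) := hu t (by push_cast; omega) le_rfl
    have hprev := ih (t - 1) fun s h1 h2 => hu s (by push_cast; omega) (by omega)
    have hcoef : ∀ k q, Measurable fun ω => θ k q (u t ω k) := fun k q =>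
      (hθ k q).comp ((measurable_pi_apply k).comp hut)
    refine measurable_pi_lambda _ fun k => ?_
    simp only [approxState, Pi.add_apply, Matrix.mulVec, dotProduct, companion, Matrix.of_apply,
      shock]
    refine Measurable.add (Finset.measurable_sum _ fun q _ => ?_) ?_
    · refine Measurable.mul ?_ ((measurable_pi_apply q).comp hprev)
      split_ifs
      · exact hcoef _ _
      · exact measurable_const
      · exact measurable_const
    · split_ifs
      · exact hcoef _ _
      · exact measurable_const

theorem measurable_limsup_approxState [MeasurableSpace Ω] {θ : Fin n → Idx n p → ℝ → ℝ}
    (hθ : ∀ k q, Measurable (θ k q)) {u : ℤ → Ω → Fin n → ℝ} {t : ℤ}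
    (hu : ∀ s ≤ t, Measurable (u s)) (m : ℕ) (j : Fin p) :
    Measurable fun ω (s : Iic t) k =>
      limsup (fun i : ℕ => approxState θ (fun s => u s ω) (m * i) s (k, j)) atTop := by
  refine measurable_pi_lambda _ fun s => measurable_pi_lambda _ fun k => ?_
  exact Measurable.limsup fun i => (measurable_pi_apply _).comp
    (measurable_approxState hθ _ _ fun s' _ hs' => hu s' (hs'.trans s.2))

/-- The rank variables, moved into the unit cube on the null set where they are outside. -/
noncomputable def clipped (U : ℤ → Ω → Fin n → ℝ) (t : ℤ) (ω : Ω) (k : Fin n) : ℝ := clip (U t ω k)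

/-- The coefficient functions, extended by constants outside the unit interval. -/
noncomputable def extend (θ : Fin n → Idx n p → ℝ → ℝ) (k : Fin n) (q : Idx n p) (u : ℝ) : ℝ :=
  θ k q (clip u)

theorem measurable_clipped [MeasurableSpace Ω] {U : ℤ → Ω → Fin n → ℝ} {t : ℤ} (h : Measurable (U t)) :
    Measurable (clipped U t) :=
  measurable_pi_lambda _ fun k => continuous_clip.measurable.comp ((measurable_pi_apply k).comp h)

theorem past_eq_comap (y : ℤ → Ω → Fin n → ℝ) (t : ℤ) :
    past y t = MeasurableSpace.comap (fun ω (s : Iic t) => y s ω) inferInstance := by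
  change _ = MeasurableSpace.comap (fun ω (s : Iic t) => y s ω)
    (⨆ s : Iic t, MeasurableSpace.comap (fun b => b s) inferInstance)
  rw [past, MeasurableSpace.comap_iSup]
  refine iSup_congr fun s => ?_
  rw [MeasurableSpace.comap_comp]
  rfl

theorem measurable_past (y : ℤ → Ω → Fin n → ℝ) {s t : ℤ} (hst : s ≤ t) :
    Measurable[past y t] (y s) :=
  measurable_iff_comap_le.2
    (le_iSup (fun s : Iic t => MeasurableSpace.comap (y s) inferInstance) ⟨s, hst⟩)

theorem past_mono (y : ℤ → Ω → Fin n → ℝ) : Monotone (past y) := fun _ _ hst =>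
  iSup_le fun s => measurable_iff_comap_le.1 (measurable_past y (s.2.trans hst))

end Recursion

section Model

variable {Ω : Type*} [mΩ : MeasurableSpace Ω] {μ : Measure Ω} {n p : ℕ}
  {θ : Fin n → Idx n p → ℝ → ℝ} {lb ub : Fin n → ℝ} {U y : ℤ → Ω → Fin n → ℝ}

theorem Model.ae_mem_unitInterval (h : Model μ θ lb ub U y) : ∀ᵐ ω ∂μ, ∀ t k, U t ω k ∈ Icc (0 : ℝ) 1 := by
  rw [ae_all_iff]; intro t
  rw [ae_all_iff]; intro k
  have h1 : ∀ᵐ u ∂(μ.map fun ω => U t ω k), u ∈ Icc (0 : ℝ) 1 := by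
    rw [h.uniform t k]
    exact ae_restrict_mem measurableSet_Icc
  exact ae_of_ae_map ((measurable_pi_apply k).comp (h.measurable_U t)).aemeasurable h1

theorem Model.ae_dgp (h : Model μ θ lb ub U y) : ∀ᵐ ω ∂μ, ∀ t k,
    y t ω k = ∑ q, regressor y t ω q * extend θ k q (clipped U t ω k) := by
  have h1 : ∀ᵐ ω ∂μ, ∀ t, ∀ k, y t ω k = ∑ q, regressor y t ω q * θ k q (U t ω k) := by
    rw [ae_all_iff]; exact h.dgp
  filter_upwards [h1, h.ae_mem_unitInterval] with ω hω hU t k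
  rw [hω t k]
  refine Finset.sum_congr rfl fun q _ => ?_
  simp only [extend, clipped, clip_of_mem (hU t k)]

theorem Model.ae_bounded (h : Model μ θ lb ub U y) :
    ∀ᵐ ω ∂μ, ∀ t k, y t ω k ∈ Icc (lb k) (ub k) := by
  rw [ae_all_iff]; exact h.bounded

theorem Model.measurable_extend (h : Model μ θ lb ub U y) (k : Fin n) (q : Idx n p) :
    Measurable (extend θ k q) :=
  (continuous_comp_clip (h.continuous_coef k q)).measurable

/-- The process is approximated by functions of finitely many rank variables. -/
theorem Model.exists_approx (h : Model μ θ lb ub U y) :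
    ∃ (m : ℕ) (r A : ℝ), 0 ≤ r ∧ r < 1 ∧ ∀ᵐ ω ∂μ, ∀ (k : ℕ) (t : ℤ) (q : Fin n × Fin p),
      |state y t ω q - approxState (extend θ) (fun s => clipped U s ω) (m * k) t q| ≤ r ^ k * A := by
  obtain ⟨m, r, hr1, hr⟩ := h.contraction
  have hr' : ∀ v : Fin m → Fin n → ℝ, (∀ s k, v s k ∈ Icc (0 : ℝ) 1) →
      ‖Matrix.toEuclideanCLM (𝕜 := ℝ) (List.ofFn fun s => companion (extend θ) (v s)).prod‖ ≤ r := by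
    intro v hv
    have : (fun s => companion (extend θ) (v s)) = fun s => companion θ (v s) := by
      funext s
      ext k q
      simp only [companion, extend, Matrix.of_apply, clip_of_mem (hv s _)]
    rw [this]
    exact hr v hv
  have hr0 : 0 ≤ r :=
    (norm_nonneg _).trans (hr (fun _ _ => 0) fun _ _ => ⟨le_rfl, zero_le_one⟩)
  refine ⟨m, r, √((n * p : ℕ) * (∑ k, (|lb k| + |ub k|)) ^ 2), hr0, hr1, ?_⟩
  filter_upwards [h.ae_dgp, h.ae_bounded] with ω h1 h2 k t q
  refine abs_state_sub_approxState_le h1 (fun t k => clip_mem _) hr' (fun t k => ?_) k t q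
  have h3 : |lb k| + |ub k| ≤ ∑ k, (|lb k| + |ub k|) :=
    Finset.single_le_sum (f := fun k => |lb k| + |ub k|) (fun k _ => by positivity)
      (Finset.mem_univ k)
  refine le_trans (abs_le.2 ⟨?_, ?_⟩) h3
  · have := (h2 t k).1
    linarith [neg_abs_le (lb k), abs_nonneg (ub k)]
  · have := (h2 t k).2
    linarith [le_abs_self (ub k), abs_nonneg (lb k)]

theorem Model.past_le (h : Model μ θ lb ub U y) (t : ℤ) : past y t ≤ mΩ :=
  iSup_le fun s => measurable_iff_comap_le.1 (h.measurable_y s)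

theorem Model.indep_past (h : Model μ θ lb ub U y) (hp : 0 < p) (t : ℤ) :
    Indep (past y (t - 1)) (MeasurableSpace.comap (U t) inferInstance) μ := by
  obtain ⟨m, r, A, hr0, hr1, happ⟩ := h.exists_approx
  set y' : Ω → Iic (t - 1) → Fin n → ℝ := fun ω s k =>
    limsup (fun i : ℕ => approxState (extend θ) (fun s => clipped U s ω) (m * i) s (k, ⟨0, hp⟩))
      atTop with hy'
  have hae : y' =ᵐ[μ] fun ω (s : Iic (t - 1)) => y s ω := by
    filter_upwards [happ] with ω hω
    funext s k
    refine Tendsto.limsup_eq ?_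
    have h1 : Tendsto (fun i : ℕ => r ^ i * A) atTop (𝓝 0) := by
      simpa using (tendsto_pow_atTop_nhds_zero_of_lt_one hr0 hr1).mul_const A
    refine tendsto_iff_norm_sub_tendsto_zero.2 (squeeze_zero (fun _ => norm_nonneg _) (fun i => ?_) h1)
    rw [Real.norm_eq_abs, abs_sub_comm]
    have := hω i s (k, ⟨0, hp⟩)
    simpa [state] using this
  have hind : Indep (⨆ s ∈ Iic (t - 1), MeasurableSpace.comap (U s) inferInstance)
      (MeasurableSpace.comap (U t) inferInstance) μ := by
    have h1 := indep_iSup_of_disjoint (m := fun s => MeasurableSpace.comap (U s) inferInstance)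
      (fun s => (h.measurable_U s).comap_le) h.indep (S := Iic (t - 1)) (T := {t}) (by simp)
    rwa [iSup_singleton] at h1
  have hmeas : Measurable[⨆ s ∈ Iic (t - 1), MeasurableSpace.comap (U s) inferInstance] y' :=
    @measurable_limsup_approxState Ω n p (⨆ s ∈ Iic (t - 1), MeasurableSpace.comap (U s) inferInstance)
      _ h.measurable_extend _ (t - 1) (fun s hs => @measurable_clipped Ω n
        (⨆ s ∈ Iic (t - 1), MeasurableSpace.comap (U s) inferInstance) U s
        (measurable_iff_comap_le.2 (le_iSup₂ (f := fun s (_ : s ∈ Iic (t - 1)) =>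
          MeasurableSpace.comap (U s) inferInstance) s hs))) m ⟨0, hp⟩
  have h2 : IndepFun y' (U t) μ :=
    (IndepFun_iff_Indep _ _ _).2 (indep_of_indep_of_le_left hind hmeas.comap_le)
  rw [past_eq_comap]
  exact (IndepFun_iff_Indep _ _ _).1 (h2.congr hae EventuallyEq.rfl)

end Model

section WeakLaw

variable {Ω : Type*} [MeasurableSpace Ω] {μ : Measure Ω} [IsProbabilityMeasure μ]

theorem abs_covariance_le {X Y : Ω → ℝ} (hX : ∀ ω, X ω ∈ Icc (0 : ℝ) 1)
    (hY : ∀ ω, Y ω ∈ Icc (0 : ℝ) 1) : |cov[X, Y; μ]| ≤ 1 := by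
  have hmean : ∀ Z : Ω → ℝ, (∀ ω, Z ω ∈ Icc (0 : ℝ) 1) → (∫ ω, Z ω ∂μ) ∈ Icc (0 : ℝ) 1 := by
    intro Z hZ
    refine ⟨integral_nonneg fun ω => (hZ ω).1, ?_⟩
    have := norm_integral_le_of_norm_le_const (μ := μ) (f := Z) (C := 1)
      (Eventually.of_forall fun ω => by rw [Real.norm_eq_abs, abs_le]; constructor <;> linarith [(hZ ω).1, (hZ ω).2])
    simp only [probReal_univ, mul_one] at this
    exact (le_abs_self _).trans this
  have := norm_integral_le_of_norm_le_const (μ := μ) (C := 1)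
    (f := fun ω => (X ω - ∫ ω, X ω ∂μ) * (Y ω - ∫ ω, Y ω ∂μ)) (Eventually.of_forall fun ω => by
      rw [norm_mul, Real.norm_eq_abs, Real.norm_eq_abs]
      refine mul_le_one₀ ?_ (abs_nonneg _) ?_ <;> rw [abs_le] <;>
        constructor <;> linarith [(hX ω).1, (hX ω).2, (hY ω).1, (hY ω).2, (hmean X hX).1,
          (hmean X hX).2, (hmean Y hY).1, (hmean Y hY).2])
  simpa [covariance] using this

theorem variance_sum_le_of_finite_range {D : ℕ → Ω → ℝ} (hD : ∀ t, Measurable (D t))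
    (hD01 : ∀ t ω, D t ω ∈ Icc (0 : ℝ) 1) {K : ℕ}
    (hind : ∀ s t, s + K ≤ t → IndepFun (D s) (D t) μ) (T : ℕ) :
    Var[fun ω => ∑ t ∈ Finset.Icc 1 T, D t ω; μ] ≤ 2 * K * T := by
  have hL : ∀ t, MemLp (D t) 2 μ := fun t =>
    MemLp.of_bound (hD t).aestronglyMeasurable 1 (Eventually.of_forall fun ω => by
      rw [Real.norm_eq_abs, abs_le]; constructor <;> linarith [(hD01 t ω).1, (hD01 t ω).2])
  rw [variance_fun_sum' fun t _ => hL t]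
  have h1 : ∀ s ∈ Finset.Icc 1 T, ∑ t ∈ Finset.Icc 1 T, cov[D s, D t; μ] ≤ 2 * K := by
    intro s _
    calc ∑ t ∈ Finset.Icc 1 T, cov[D s, D t; μ]
        ≤ ∑ t ∈ Finset.Icc 1 T, if t ∈ Finset.Ico (s + 1 - K) (s + K) then (1 : ℝ) else 0 := by
          refine Finset.sum_le_sum fun t _ => ?_
          split_ifs with hst
          · exact (le_abs_self _).trans (abs_covariance_le (hD01 s) (hD01 t))
          · rw [Finset.mem_Ico, not_and_or, not_le, not_lt] at hst
            refine le_of_eq ?_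
            rcases hst with hst | hst
            · exact (hind t s (by omega)).symm.covariance_eq_zero (hL s) (hL t)
            · exact (hind s t hst).covariance_eq_zero (hL s) (hL t)
      _ ≤ ∑ t ∈ Finset.Ico (s + 1 - K) (s + K), (1 : ℝ) := by
          rw [← Finset.sum_filter]
          exact Finset.sum_le_sum_of_subset_of_nonneg
            (fun t ht => (Finset.mem_filter.1 ht).2) fun _ _ _ => zero_le_one
      _ ≤ 2 * K := by
          rw [Finset.sum_const, Nat.card_Ico, nsmul_eq_mul, mul_one]
          have : s + K - (s + 1 - K) ≤ 2 * K := by omega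
          exact_mod_cast this
  refine (Finset.sum_le_sum h1).trans (le_of_eq ?_)
  rw [Finset.sum_const, Nat.card_Icc, nsmul_eq_mul, Nat.add_sub_cancel]
  ring

/-- A weak law of large numbers for processes that are approximated uniformly by processes with
finite range of dependence. -/
theorem tendsto_measure_lt_abs_sum_sub {D : ℕ → Ω → ℝ} (hD : ∀ t, Measurable (D t))
    (happ : ∀ η > (0 : ℝ), ∃ (K : ℕ) (D' : ℕ → Ω → ℝ), (∀ t, Measurable (D' t)) ∧
      (∀ t ω, D' t ω ∈ Icc (0 : ℝ) 1) ∧ (∀ s t, s + K ≤ t → IndepFun (D' s) (D' t) μ) ∧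
      ∀ᵐ ω ∂μ, ∀ t, |D t ω - D' t ω| ≤ η) {ε : ℝ} (hε : 0 < ε) :
    Tendsto (fun T : ℕ => μ {ω | ε * T < |∑ t ∈ Finset.Icc 1 T, (D t ω - ∫ ω, D t ω ∂μ)|})
      atTop (𝓝 0) := by
  obtain ⟨K, D', hD', hD01, hind, happ⟩ := happ (ε / 4) (by linarith)
  have hint' : ∀ t, Integrable (D' t) μ := fun t =>
    Integrable.of_bound (hD' t).aestronglyMeasurable 1 (Eventually.of_forall fun ω => by
      rw [Real.norm_eq_abs, abs_le]; constructor <;> linarith [(hD01 t ω).1, (hD01 t ω).2])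
  have hint : ∀ t, Integrable (D t) μ := fun t =>
    Integrable.of_bound (hD t).aestronglyMeasurable (1 + ε / 4) (by
      filter_upwards [happ] with ω hω
      have := abs_le.1 (hω t)
      rw [Real.norm_eq_abs, abs_le]; constructor <;> linarith [(hD01 t ω).1, (hD01 t ω).2])
  have hmean : ∀ t, |(∫ ω, D t ω ∂μ) - ∫ ω, D' t ω ∂μ| ≤ ε / 4 := by
    intro t
    rw [← integral_sub (hint t) (hint' t)]
    have := norm_integral_le_of_norm_le_const (μ := μ) (f := fun ω => D t ω - D' t ω) (C := ε / 4)
      (by filter_upwards [happ] with ω hω using hω t)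
    simpa using this
  have hb : ∀ T : ℕ, 1 ≤ T →
      μ {ω | ε * T < |∑ t ∈ Finset.Icc 1 T, (D t ω - ∫ ω, D t ω ∂μ)|} ≤
        ENNReal.ofReal (8 * K / ε ^ 2 * (T : ℝ)⁻¹) := by
    intro T hT
    have hT0 : (0 : ℝ) < T := by exact_mod_cast hT
    have hL : MemLp (fun ω => ∑ t ∈ Finset.Icc 1 T, D' t ω) 2 μ :=
      memLp_finsetSum _ fun t _ => MemLp.of_bound (hD' t).aestronglyMeasurable 1
        (Eventually.of_forall fun ω => by
          rw [Real.norm_eq_abs, abs_le]; constructor <;> linarith [(hD01 t ω).1, (hD01 t ω).2])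
    have h1 := meas_ge_le_variance_div_sq hL (c := ε / 2 * T) (by positivity)
    refine le_trans (measure_mono_ae ?_) (h1.trans (ENNReal.ofReal_le_ofReal ?_))
    · filter_upwards [happ] with ω hω
      intro hlt
      have hlt' : ε * T < |∑ t ∈ Finset.Icc 1 T, (D t ω - ∫ ω, D t ω ∂μ)| := hlt
      change ε / 2 * T ≤
        |∑ t ∈ Finset.Icc 1 T, D' t ω - ∫ ω, ∑ t ∈ Finset.Icc 1 T, D' t ω ∂μ|
      rw [integral_finsetSum _ fun t _ => hint' t, ← Finset.sum_sub_distrib]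
      have h2 : |∑ t ∈ Finset.Icc 1 T, (D t ω - ∫ ω, D t ω ∂μ) -
          ∑ t ∈ Finset.Icc 1 T, (D' t ω - ∫ ω, D' t ω ∂μ)| ≤ ε / 2 * T := by
        rw [← Finset.sum_sub_distrib]
        refine (Finset.abs_sum_le_sum_abs _ _).trans ?_
        have : ∀ t ∈ Finset.Icc 1 T,
            |D t ω - ∫ ω, D t ω ∂μ - (D' t ω - ∫ ω, D' t ω ∂μ)| ≤ ε / 2 := by
          intro t _
          have h3 := abs_le.1 (hω t)
          have h4 := abs_le.1 (hmean t)
          rw [abs_le]; constructor <;> linarith [h3.1, h3.2, h4.1, h4.2]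
        refine (Finset.sum_le_sum this).trans (le_of_eq ?_)
        rw [Finset.sum_const, Nat.card_Icc, nsmul_eq_mul, Nat.add_sub_cancel, mul_comm]
      have h5 := abs_sub_abs_le_abs_sub (∑ t ∈ Finset.Icc 1 T, (D t ω - ∫ ω, D t ω ∂μ))
        (∑ t ∈ Finset.Icc 1 T, (D' t ω - ∫ ω, D' t ω ∂μ))
      linarith
    · have h6 := variance_sum_le_of_finite_range (μ := μ) hD' hD01 hind T
      refine (div_le_div_of_nonneg_right h6 (by positivity)).trans (le_of_eq ?_)
      field_simp; ring
  have hlim : Tendsto (fun T : ℕ => ENNReal.ofReal (8 * K / ε ^ 2 * (T : ℝ)⁻¹)) atTop (𝓝 0) := by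
    have h1 : Tendsto (fun T : ℕ => 8 * K / ε ^ 2 * (T : ℝ)⁻¹) atTop (𝓝 0) := by
      simpa using (tendsto_inv_atTop_nhds_zero_nat (𝕜 := ℝ)).const_mul (8 * (K : ℝ) / ε ^ 2)
    simpa using ENNReal.tendsto_ofReal h1
  refine tendsto_of_tendsto_of_tendsto_of_le_of_le' tendsto_const_nhds hlim
    (Eventually.of_forall fun _ => bot_le) ?_
  filter_upwards [eventually_ge_atTop 1] with T hT using hb T hT

end WeakLaw

section Density

variable {m f : ℝ → ℝ} {B c : ℝ}

/-- The distribution function of `m` under the uniform distribution. -/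
noncomputable def levelCdfLe (m : ℝ → ℝ) (x : ℝ) : ℝ := unif.real {u | m u ≤ x}

theorem le_levelCdfLe (hm : StrictMonoOn m (Icc 0 1)) {v x : ℝ} (hv : v ∈ Icc (0 : ℝ) 1)
    (hx : m v ≤ x) : v ≤ levelCdfLe m x := by
  have h1 : Icc 0 v ⊆ Icc (0 : ℝ) 1 ∩ {u | m u ≤ x} := fun u hu =>
    ⟨⟨hu.1, hu.2.trans hv.2⟩, (hm.monotoneOn ⟨hu.1, hu.2.trans hv.2⟩ hv hu.2).trans hx⟩
  have h2 : volume (Icc 0 v) ≤ unif {u | m u ≤ x} := by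
    have h3 : unif (Icc 0 v) = volume (Icc 0 v) := by
      rw [unif, Measure.restrict_eq_self _ (Icc_subset_Icc le_rfl hv.2)]
    rw [← h3]
    exact measure_mono fun u hu => (h1 hu).2
  have h4 := ENNReal.toReal_mono (measure_ne_top _ _) h2
  rwa [Real.volume_Icc, sub_zero, ENNReal.toReal_ofReal hv.1] at h4

theorem levelCdfLe_le (hm : StrictMonoOn m (Icc 0 1)) {v x : ℝ} (hv : v ∈ Icc (0 : ℝ) 1)
    (hx : x < m v) : levelCdfLe m x ≤ v := by
  have h1 : {u | m u ≤ x} ∩ Icc (0 : ℝ) 1 ⊆ Icc 0 v := fun u hu => by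
    refine ⟨hu.2.1, ?_⟩
    by_contra hc
    have h2 : m v ≤ m u := hm.monotoneOn hv hu.2 (not_le.1 hc).le
    have h3 : m u ≤ x := hu.1
    linarith
  have h2 : unif {u | m u ≤ x} ≤ volume (Icc 0 v) := by
    rw [unif, Measure.restrict_apply' measurableSet_Icc]
    exact measure_mono h1
  have h4 := ENNReal.toReal_mono (by simp) h2
  rwa [Real.volume_Icc, sub_zero, ENNReal.toReal_ofReal hv.1] at h4

/-- If the distribution of `m` under the uniform distribution has a bounded density that is bounded
away from zero on the range of `m`, then the slopes of `m` are bounded from both sides. -/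
theorem slopeBounds_of_density (hcont : ContinuousOn m (Icc 0 1)) (hm : StrictMonoOn m (Icc 0 1))
    (hf : Measurable f) (hf0 : ∀ s, 0 ≤ f s) (hfB : ∀ s, f s ≤ B) (hB : 0 < B) (hc : 0 < c)
    (hfc : ∀ u ∈ Ioo (0 : ℝ) 1, c ≤ f (m u))
    (hcdf : ∀ x : ℚ, levelCdfLe m x = ∫ s in Iic (x : ℝ), f s) : SlopeBounds B c m := by
  have hint : ∀ a b : ℝ, IntegrableOn f (Ioc a b) := fun a b =>
    Measure.integrableOn_of_bounded (M := B) (by simp) hf.aestronglyMeasurable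
      (Eventually.of_forall fun s => by rw [Real.norm_eq_abs, abs_of_nonneg (hf0 s)]; exact hfB s)
  have hsplit : ∀ a b : ℝ, a ≤ b → IntegrableOn f (Iic a) →
      ∫ s in Iic b, f s = (∫ s in Iic a, f s) + ∫ s in Ioc a b, f s := by
    intro a b hab hi
    have hd : Disjoint (Iic a) (Ioc a b) := Set.disjoint_left.2 fun s h1 h2 => not_lt.2 h1 h2.1
    rw [← Iic_union_Ioc_eq_Iic hab, setIntegral_union hd measurableSet_Ioc hi (hint a b)]
  have hup : ∀ x x' : ℚ, x ≤ x' → levelCdfLe m x' - levelCdfLe m x ≤ B * (x' - x) := by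
    intro x x' hxx
    have hxx' : (x : ℝ) ≤ x' := by exact_mod_cast hxx
    rw [hcdf, hcdf]
    by_cases hi : IntegrableOn f (Iic (x : ℝ))
    · rw [hsplit _ _ hxx' hi, add_sub_cancel_left]
      have := norm_setIntegral_le_of_norm_le_const (μ := volume) (s := Ioc (x : ℝ) x') (f := f)
        (C := B) (by simp) (fun s _ => by
          rw [Real.norm_eq_abs, abs_of_nonneg (hf0 s)]; exact hfB s)
      rw [Real.volume_real_Ioc_of_le hxx'] at this
      exact (le_abs_self _).trans this
    · have hi' : ¬ IntegrableOn f (Iic (x' : ℝ)) := fun h =>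
        hi (h.mono_set (Iic_subset_Iic.2 hxx'))
      rw [integral_undef hi, integral_undef hi', sub_zero]
      exact mul_nonneg hB.le (by linarith)
  have hlow : ∀ x x' : ℚ, x ≤ x' → 0 < levelCdfLe m x → (∀ s ∈ Ioc (x : ℝ) x', c ≤ f s) →
      c * (x' - x) ≤ levelCdfLe m x' - levelCdfLe m x := by
    intro x x' hxx hpos hcs
    have hxx' : (x : ℝ) ≤ x' := by exact_mod_cast hxx
    rw [hcdf] at hpos
    have hi : IntegrableOn f (Iic (x : ℝ)) := by
      by_contra h
      rw [integral_undef h] at hpos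
      exact lt_irrefl _ hpos
    rw [hcdf, hcdf, hsplit _ _ hxx' hi, add_sub_cancel_left]
    have h1 : ∫ _ in Ioc (x : ℝ) x', c = c * (x' - x) := by
      rw [setIntegral_const, Real.volume_real_Ioc_of_le hxx', smul_eq_mul, mul_comm]
    rw [← h1]
    exact setIntegral_mono_on (by simp) (hint _ _) measurableSet_Ioc hcs
  intro u hu v hv huv
  rcases huv.eq_or_lt with rfl | huv
  · simp
  have hlt : m u < m v := hm hu hv huv
  constructor
  · refine le_of_forall_pos_le_add fun ε hε => ?_
    have hδ : 0 < ε / (2 * B) := by positivity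
    obtain ⟨x, hx1, hx2⟩ := exists_rat_btwn (show m u - ε / (2 * B) < m u by linarith)
    obtain ⟨x', hx1', hx2'⟩ := exists_rat_btwn (show m v < m v + ε / (2 * B) by linarith)
    have h1 := levelCdfLe_le hm hu hx2
    have h2 := le_levelCdfLe hm hv hx1'.le
    have h3 := hup x x' (by exact_mod_cast (show (x : ℝ) ≤ x' by linarith))
    have h4 : B * ((x' : ℝ) - x) ≤ B * (m v - m u + 2 * (ε / (2 * B))) :=
      mul_le_mul_of_nonneg_left (by linarith) hB.le
    have h5 : B * (m v - m u + 2 * (ε / (2 * B))) = B * (m v - m u) + ε := by field_simp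
    linarith
  · by_contra hcon
    rw [not_le] at hcon
    have hK : (v - u) / c < m v - m u := by rw [div_lt_iff₀ hc]; linarith
    have hK0 : 0 < (v - u) / c := div_pos (by linarith) hc
    set δ := (m v - m u - (v - u) / c) / 2 with hδ
    have hδ0 : 0 < δ := by rw [hδ]; linarith
    obtain ⟨x, hx1, hx2⟩ := exists_rat_btwn (show m u < m u + δ by linarith)
    obtain ⟨x', hx1', hx2'⟩ := exists_rat_btwn (show m v - δ < m v by linarith)
    have hxx : (x : ℝ) < x' := by linarith
    have hsub : Icc u v ⊆ Icc (0 : ℝ) 1 := Icc_subset_Icc hu.1 hv.2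
    have hivt : ∀ s ∈ Ioo (m u) (m v), ∃ w ∈ Ioo u v, m w = s := fun s hs =>
      intermediate_value_Ioo huv.le (hcont.mono hsub) hs
    obtain ⟨w, hw, hwx⟩ := hivt x ⟨hx1, by linarith⟩
    have h1 := le_levelCdfLe hm (hsub (Ioo_subset_Icc_self hw)) hwx.le
    have h2 := levelCdfLe_le hm hv hx2'
    have h3 := hlow x x' (by exact_mod_cast hxx.le) (by linarith [hw.1, hu.1]) (fun s hs => by
      obtain ⟨w', hw', rfl⟩ := hivt s ⟨hx1.trans hs.1, hs.2.trans_lt hx2'⟩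
      exact hfc w' ⟨hu.1.trans_lt hw'.1, hw'.2.trans_le hv.2⟩)
    have h4 : c * ((v - u) / c) < c * ((x' : ℝ) - x) :=
      mul_lt_mul_of_pos_left (by linarith) hc
    rw [mul_div_cancel₀ _ hc.ne'] at h4
    linarith [hw.1]

end Density

section ConditionalLaw

variable {Ω ι : Type*} [Fintype ι]

theorem measurable_levelCdfLe_mix {φ : ι → ℝ → ℝ} (hφ : ∀ r, Measurable (φ r)) (x : ℝ) :
    Measurable fun z : ι → ℝ => levelCdfLe (mix φ z) x := by
  have hs : MeasurableSet {p : (ι → ℝ) × ℝ | mix φ p.1 p.2 ≤ x} :=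
    measurableSet_le (measurable_mix hφ) measurable_const
  exact (measurable_measure_prodMk_left (ν := unif) hs).ennreal_toReal

/-- The conditional distribution function of `zᵀ φ(V)` when `V` is uniform and independent of the
conditioning σ-algebra, with respect to which `z` is measurable. -/
theorem condExp_mix_le {P mΩ : MeasurableSpace Ω} {μ : Measure Ω} [IsProbabilityMeasure μ] (hP : P ≤ mΩ) {φ : ι → ℝ → ℝ}
    (hφ : ∀ r, Measurable (φ r)) {Z : Ω → ι → ℝ} (hZ : Measurable[P] Z) {V Y : Ω → ℝ}
    (hV : Measurable V) (hY : Measurable Y)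
    (hind : Indep P (MeasurableSpace.comap V inferInstance) μ) (hlaw : μ.map V = unif)
    (hYV : ∀ᵐ ω ∂μ, Y ω = mix φ (Z ω) (V ω)) (x : ℝ) :
    μ[Set.indicator {ω | Y ω ≤ x} (fun _ => (1 : ℝ)) | P] =ᵐ[μ]
      fun ω => levelCdfLe (mix φ (Z ω)) x := by
  have hms : MeasurableSet {ω | Y ω ≤ x} := measurableSet_le hY measurable_const
  have hG : Measurable[P] fun ω => levelCdfLe (mix φ (Z ω)) x :=
    (measurable_levelCdfLe_mix hφ x).comp hZ
  have hGint : Integrable (fun ω => levelCdfLe (mix φ (Z ω)) x) μ :=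
    Integrable.of_bound (hG.mono hP le_rfl).aestronglyMeasurable 1
      (Eventually.of_forall fun ω => by
        rw [Real.norm_eq_abs,
          abs_of_nonneg (show 0 ≤ levelCdfLe (mix φ (Z ω)) x from measureReal_nonneg)]
        exact measureReal_le_one)
  refine (ae_eq_condExp_of_forall_setIntegral_eq hP ((integrable_const (1 : ℝ)).indicator hms)
    (fun _ _ _ => hGint.integrableOn) (fun A hA _ => ?_) hG.aestronglyMeasurable).symm
  have hA' : MeasurableSet A := hP _ hA
  set W : Ω → ℝ × (ι → ℝ) := fun ω => (A.indicator 1 ω, Z ω) with hW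
  have hWP : Measurable[P] W :=
    ((@measurable_one ℝ Ω _ P _).indicator hA).prodMk hZ
  have hindW : IndepFun W V μ := by
    rw [IndepFun_iff_Indep]
    exact indep_of_indep_of_le_left hind hWP.comap_le
  set S : Set ((ι → ℝ) × ℝ) := {p | mix φ p.1 p.2 ≤ x} with hS
  have hSm : MeasurableSet S := measurableSet_le (measurable_mix hφ) measurable_const
  set h : (ℝ × (ι → ℝ)) × ℝ → ENNReal := fun p =>
    ENNReal.ofReal p.1.1 * S.indicator 1 (p.1.2, p.2) with hh
  have hhm : Measurable h := by
    refine Measurable.mul (f := fun p : (ℝ × (ι → ℝ)) × ℝ => ENNReal.ofReal p.1.1)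
      (g := fun p => S.indicator 1 (p.1.2, p.2)) ?_ ?_
    · fun_prop
    · exact (measurable_one.indicator hSm).comp (measurable_fst.snd.prodMk measurable_snd)
  have key := hindW.lintegral_comp_prodMk (hWP.mono hP le_rfl) hV hhm
  have h1 : ∫⁻ ω, h (W ω, V ω) ∂μ = μ (A ∩ {ω | Y ω ≤ x}) := by
    rw [← lintegral_indicator_one (hA'.inter hms)]
    refine lintegral_congr_ae ?_
    filter_upwards [hYV] with ω hω
    simp only [hh, hW, indicator_apply, hS, mem_ofPred_eq, ← hω]
    by_cases ha : ω ∈ A <;> by_cases hb : Y ω ≤ x <;> simp [ha, hb]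
  have h2 : ∫⁻ ω, ∫⁻ u, h (W ω, u) ∂(μ.map V) ∂μ =
      ∫⁻ ω in A, ENNReal.ofReal (levelCdfLe (mix φ (Z ω)) x) ∂μ := by
    rw [← lintegral_indicator hA', hlaw]
    refine lintegral_congr fun ω => ?_
    simp only [hh, hW]
    rw [lintegral_const_mul' _ _ ENNReal.ofReal_ne_top]
    have h3 : ∫⁻ u, S.indicator 1 (Z ω, u) ∂unif = unif {u | mix φ (Z ω) u ≤ x} := by
      rw [← lintegral_indicator_one (measurableSet_le (measurable_mix_right hφ _) measurable_const)]
      rfl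
    rw [h3]
    by_cases ha : ω ∈ A
    · rw [indicator_of_mem ha, indicator_of_mem ha, Pi.one_apply, ENNReal.ofReal_one, one_mul,
        levelCdfLe, ofReal_measureReal]
    · simp [ha]
  rw [h1, h2] at key
  have h0 : ∀ ω, 0 ≤ levelCdfLe (mix φ (Z ω)) x := fun ω => measureReal_nonneg
  rw [setIntegral_indicator hms, setIntegral_const, smul_eq_mul, mul_one, Measure.real, key,
    integral_eq_lintegral_of_nonneg_ae (Eventually.of_forall h0)
      (hG.mono hP le_rfl).aestronglyMeasurable]

end ConditionalLaw

section Coordinates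

variable {Ω : Type*} {n p : ℕ} {lb ub : Fin n → ℝ} {y : ℤ → Ω → Fin n → ℝ}

theorem coord_sum (lb ub : Fin n → ℝ) (y : ℤ → Ω → Fin n → ℝ) (t : ℤ) (ω : Ω) :
    ∑ r : Idx n p, coord lb ub y t ω r = 1 := by
  rw [Fintype.sum_option]
  simp only [coord]
  rw [sub_add_eq_add_sub, add_sub_assoc, sub_self, add_zero]

theorem coord_some_mem (hlt : ∀ k, lb k < ub k) {ω : Ω}
    (hy : ∀ t k, y t ω k ∈ Icc (lb k) (ub k)) (t : ℤ) (q : Fin n × Fin p) :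
    coord lb ub y t ω (some q) ∈ Icc (0 : ℝ) (1 / ((n * p : ℕ) : ℝ)) := by
  have h1 : 0 < ub q.1 - lb q.1 := sub_pos.2 (hlt _)
  have h2 := hy (t - ((q.2 : ℕ) + 1)) q.1
  have hn : 0 < n := Fin.pos q.1
  have hp : 0 < p := Fin.pos q.2
  have hN : (0 : ℝ) < ((n * p : ℕ) : ℝ) := by exact_mod_cast Nat.mul_pos hn hp
  simp only [coord]
  refine ⟨div_nonneg (by linarith [h2.1]) (by positivity), ?_⟩
  rw [div_le_div_iff₀ (by positivity) hN]
  nlinarith [h2.2]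

theorem coord_nonneg (hlt : ∀ k, lb k < ub k) {ω : Ω}
    (hy : ∀ t k, y t ω k ∈ Icc (lb k) (ub k)) (t : ℤ) (r : Idx n p) :
    0 ≤ coord lb ub y t ω r := by
  match r with
  | some q => exact (coord_some_mem hlt hy t q).1
  | none =>
    have h1 : ∑ q : Fin n × Fin p, coord lb ub y t ω (some q) ≤ 1 := by
      refine (Finset.sum_le_sum fun q _ => (coord_some_mem hlt hy t q).2).trans ?_
      rw [Finset.sum_const, Finset.card_univ, Fintype.card_prod, Fintype.card_fin,
        Fintype.card_fin, nsmul_eq_mul]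
      rw [mul_one_div]; exact div_self_le_one _
    have h2 := coord_sum (p := p) lb ub y t ω
    rw [Fintype.sum_option] at h2
    linarith

theorem sum_coord_mul_phi (hlt : ∀ k, lb k < ub k) (θ : Idx n p → ℝ → ℝ) (t : ℤ) (ω : Ω) (u : ℝ) :
    ∑ r, coord lb ub y t ω r * phi lb ub θ r u = ∑ q, regressor y t ω q * θ q u := by
  have key : ∀ q : Idx n p, ∑ r, coord lb ub y t ω r * vertex lb ub r q = regressor y t ω q := by
    intro q
    match q with
    | none =>
      have : ∀ r : Idx n p, vertex lb ub r none = 1 := fun r => by cases r <;> rfl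
      simp only [this, mul_one, coord_sum]
      rfl
    | some q =>
      have : ∀ r : Idx n p, vertex lb ub r (some q) = lb q.1 +
          if some q = r then ((n * p : ℕ) : ℝ) * (ub q.1 - lb q.1) else 0 := fun r => by
        cases r <;> simp [vertex]
      simp only [this, mul_add, Finset.sum_add_distrib, ← Finset.sum_mul, coord_sum, mul_ite,
        mul_zero, Finset.sum_ite_eq, Finset.mem_univ, if_true, one_mul]
      have h1 : ub q.1 - lb q.1 ≠ 0 := (sub_pos.2 (hlt _)).ne'
      have hn : 0 < n := Fin.pos q.1
      have hp : 0 < p := Fin.pos q.2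
      have hN : ((n * p : ℕ) : ℝ) ≠ 0 := by exact_mod_cast (Nat.mul_pos hn hp).ne'
      simp only [coord, regressor]
      rw [div_mul_cancel₀ _ (mul_ne_zero hN h1)]
      ring
  simp only [phi, Finset.mul_sum]
  rw [Finset.sum_comm]
  refine Finset.sum_congr rfl fun q _ => ?_
  rw [← key q, Finset.sum_mul]
  refine Finset.sum_congr rfl fun r _ => by ring

theorem measurable_coord [m : MeasurableSpace Ω] {t : ℤ} (hy : ∀ s ≤ t - 1, Measurable (y s)) :
    Measurable fun ω => (coord lb ub y t ω : Idx n p → ℝ) := by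
  have h1 : ∀ q : Fin n × Fin p, Measurable fun ω => coord lb ub y t ω (some q) := fun q =>
    (((measurable_pi_apply q.1).comp (hy _ (by omega))).sub_const _).div_const _
  refine measurable_pi_lambda _ fun r => ?_
  match r with
  | some q => exact h1 q
  | none => exact (Finset.measurable_sum _ fun q _ => h1 q).const_sub 1

theorem continuousOn_phi {θ : Idx n p → ℝ → ℝ} (hθ : ∀ q, ContinuousOn (θ q) (Icc 0 1))
    (r : Idx n p) : ContinuousOn (phi lb ub θ r) (Icc 0 1) :=
  continuousOn_finsetSum _ fun q _ => continuousOn_const.mul (hθ q)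

theorem phi_some_sub_phi_none (θ : Idx n p → ℝ → ℝ) (q : Fin n × Fin p) (u : ℝ) :
    phi lb ub θ (some q) u - phi lb ub θ none u =
      ((n * p : ℕ) : ℝ) * (ub q.1 - lb q.1) * θ (some q) u := by
  simp only [phi, ← Finset.sum_sub_distrib, ← sub_mul]
  rw [Fintype.sum_option]
  simp only [vertex, sub_self, zero_mul, zero_add, add_sub_cancel_left, ite_mul]
  rw [Finset.sum_ite_eq']
  simp

end Coordinates

section ModelDriven

variable {Ω : Type*} [mΩ : MeasurableSpace Ω] {μ : Measure Ω} {n p : ℕ}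
  {θ : Fin n → Idx n p → ℝ → ℝ} {lb ub : Fin n → ℝ} {U y : ℤ → Ω → Fin n → ℝ}

theorem Model.strictMonoOn_phi (h : Model μ θ lb ub U y) (i : Fin n) (r : Idx n p) :
    StrictMonoOn (phi lb ub (θ i) r) (Icc 0 1) := by
  refine strictMonoOn_of_deriv_pos (convex_Icc 0 1) (continuousOn_phi (h.continuous_coef i) r) ?_
  rw [interior_Icc]
  exact h.vertex_mem i r

theorem phi_extend (θ : Fin n → Idx n p → ℝ → ℝ) (i : Fin n) (r : Idx n p) (u : ℝ) :
    phi lb ub (extend θ i) r u = phi lb ub (θ i) r (clip u) := rfl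

theorem Model.continuous_phi_extend (h : Model μ θ lb ub U y) (i : Fin n) (r : Idx n p) :
    Continuous (phi lb ub (extend θ i) r) :=
  continuous_comp_clip (continuousOn_phi (h.continuous_coef i) r)

/-- The max-min form of the `i`-th equation of the model. -/
theorem Model.exists_driven [IsProbabilityMeasure μ] (h : Model μ θ lb ub U y) (hp : 0 < p) (i : Fin n)
    {f : ℤ → Ω → ℝ → ℝ} (hf : CondDensity μ θ lb ub y i f) :
    ∃ B c : ℝ, Driven μ (fun t : ℕ => past y ((t : ℤ) - 1)) (phi lb ub (extend θ i)) B c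
      (fun t ω => coord lb ub y t ω) (fun t ω => y t ω i) (fun t ω => U t ω i) := by
  obtain ⟨B, hB⟩ := hf.bounded
  obtain ⟨c, hc, hlow⟩ := hf.lower
  have hφ : ∀ r, Measurable (phi lb ub (extend θ i) r) := fun r =>
    (h.continuous_phi_extend i r).measurable
  have hVm : ∀ t : ℤ, Measurable fun ω => U t ω i := fun t =>
    (measurable_pi_apply i).comp (h.measurable_U t)
  have hYm : ∀ t : ℤ, Measurable fun ω => y t ω i := fun t =>
    (measurable_pi_apply i).comp (h.measurable_y t)
  have hind : ∀ t : ℤ,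
      Indep (past y (t - 1)) (MeasurableSpace.comap (fun ω => U t ω i) inferInstance) μ := by
    intro t
    refine indep_of_indep_of_le_right (h.indep_past hp t) ?_
    exact measurable_iff_comap_le.1 ((measurable_pi_apply i).comp (comap_measurable (U t)))
  have hZ : ∀ t : ℤ, Measurable[past y (t - 1)] fun ω => (coord lb ub y t ω : Idx n p → ℝ) :=
    fun t => @measurable_coord Ω n p lb ub y (past y (t - 1)) t fun s hs => measurable_past y hs
  have hobs : ∀ t : ℤ, ∀ᵐ ω ∂μ,
      y t ω i = mix (phi lb ub (extend θ i)) (coord lb ub y t ω) (U t ω i) := by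
    intro t
    filter_upwards [h.ae_dgp, h.ae_mem_unitInterval] with ω h1 h2
    rw [h1 t i, mix, sum_coord_mul_phi h.lb_lt_ub]
    simp only [clipped, clip_of_mem (h2 t i)]
  refine ⟨max B 1, c, ⟨by positivity, hc, hφ, fun t => h.past_le _, fun s t hst =>
    past_mono y (by simpa using hst), fun t => hZ t, fun t => ?_, fun t => hVm t, fun t => hind t,
    fun t => h.uniform t i, fun t => hobs t, fun t => ?_, fun t => ?_, fun t => ?_⟩⟩
  · exact (measurable_pi_apply i).comp (measurable_past y (by push_cast; omega))
  · filter_upwards [h.ae_bounded] with ω hω using coord_nonneg h.lb_lt_ub hω t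
  · exact Eventually.of_forall fun ω => coord_sum lb ub y t ω
  · have hcdf : ∀ᵐ ω ∂μ, ∀ x : ℚ,
        levelCdfLe (mix (phi lb ub (extend θ i)) (coord lb ub y t ω)) x =
          ∫ s in Iic (x : ℝ), f t ω s := by
      rw [ae_all_iff]
      intro x
      have h1 := condExp_mix_le (h.past_le _) hφ (hZ t) (hVm t) (hYm t) (hind t) (h.uniform t i)
        (hobs t) x
      filter_upwards [h1, hf.cdf t x] with ω h2 h3
      rw [← h2, h3]
    filter_upwards [hcdf, hB t, hlow t, h.ae_bounded] with ω h1 h2 h3 h4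
    have hw0 := coord_nonneg (p := p) h.lb_lt_ub h4 t
    have hw1 := coord_sum (p := p) lb ub y t ω
    have hmeas : Measurable (f t ω) :=
      @Measurable.of_uncurry_left Ω ℝ ℝ (past y (t - 1)) (borel ℝ) _ (f t) (hf.measurable t) ω
        |> fun hm => by rwa [← BorelSpace.measurable_eq (α := ℝ)] at hm
    refine slopeBounds_of_density (f := f t ω) ?_ ?_ hmeas (hf.nonneg t ω)
      (fun s => (h2 s).trans (le_max_left _ _)) (by positivity) hc (fun u hu => ?_) h1
    · exact continuousOn_finsetSum _ fun r _ =>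
        continuousOn_const.mul (h.continuous_phi_extend i r).continuousOn
    · intro u hu v hv huv
      have hmono : ∀ r, phi lb ub (extend θ i) r u < phi lb ub (extend θ i) r v := fun r => by
        rw [phi_extend, phi_extend, clip_of_mem hu, clip_of_mem hv]
        exact h.strictMonoOn_phi i r hu hv huv
      obtain ⟨r, hr⟩ : ∃ r, 0 < coord (p := p) lb ub y t ω r := by
        by_contra hcon
        push Not at hcon
        have : ∑ r, coord (p := p) lb ub y t ω r ≤ 0 := Finset.sum_nonpos fun r _ => hcon r
        linarith
      exact Finset.sum_lt_sum (fun s _ => mul_le_mul_of_nonneg_left (hmono s).le (hw0 s))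
        ⟨r, Finset.mem_univ r, mul_lt_mul_of_pos_left (hmono r) hr⟩
    · have h5 := (h3 u hu).self_of_nhds
      have h6 : quant lb ub (θ i) y t ω u =
          mix (phi lb ub (extend θ i)) (coord lb ub y t ω) u := by
        simp only [quant, mix, phi_extend, clip_of_mem (Ioo_subset_Icc_self hu)]
      rwa [h6] at h5

end ModelDriven

section QuadraticForms

open Matrix in
theorem quadratic_form_mem_of_spectrum {m : Type*} [Fintype m] [DecidableEq m] {A : Matrix m m ℝ}
    (hA : A.IsHermitian) {c C : ℝ} (h : spectrum ℝ A ⊆ Icc c C) (v : m → ℝ) :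
    c * ∑ q, v q ^ 2 ≤ v ⬝ᵥ A *ᵥ v ∧ v ⬝ᵥ A *ᵥ v ≤ C * ∑ q, v q ^ 2 := by
  have hvv : v ⬝ᵥ v = ∑ q, v q ^ 2 := by simp [dotProduct, sq]
  have hscal : ∀ a : ℝ, (algebraMap ℝ (Matrix m m ℝ) a).IsHermitian := fun a => by
    rw [Algebra.algebraMap_eq_smul_one, IsHermitian, conjTranspose_smul, conjTranspose_one]
    simp
  have hform : ∀ a : ℝ, v ⬝ᵥ (algebraMap ℝ (Matrix m m ℝ) a) *ᵥ v = a * ∑ q, v q ^ 2 := fun a => by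
    rw [Algebra.algebraMap_eq_smul_one, smul_mulVec, one_mulVec, dotProduct_smul, hvv, smul_eq_mul]
  constructor
  · have h1 : (A - algebraMap ℝ _ c).PosSemidef := by
      refine posSemidef_iff_isHermitian_and_spectrum_nonneg.2 ⟨hA.sub (hscal c), ?_⟩
      rw [← spectrum.sub_singleton_eq]
      rintro _ ⟨a, ha, b, rfl, rfl⟩
      exact sub_nonneg.2 (h ha).1
    have h2 := h1.dotProduct_mulVec_nonneg v
    rw [star_trivial, sub_mulVec, dotProduct_sub, hform] at h2
    linarith
  · have h1 : (algebraMap ℝ _ C - A).PosSemidef := by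
      refine posSemidef_iff_isHermitian_and_spectrum_nonneg.2 ⟨(hscal C).sub hA, ?_⟩
      rw [← spectrum.singleton_sub_eq]
      rintro _ ⟨b, rfl, a, ha, rfl⟩
      exact sub_nonneg.2 (h ha).2
    have h2 := h1.dotProduct_mulVec_nonneg v
    rw [star_trivial, sub_mulVec, dotProduct_sub, hform] at h2
    linarith

theorem sum_sum_mul_mul_eq_sq {m : Type*} [Fintype m] (x w : m → ℝ) :
    ∑ h, ∑ h', w h * (x h * x h') * w h' = (∑ h, x h * w h) ^ 2 := by
  rw [sq, Finset.sum_mul_sum]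
  exact Finset.sum_congr rfl fun h _ => Finset.sum_congr rfl fun h' _ => by ring

theorem sq_sum_abs_le {m : Type*} [Fintype m] (v : m → ℝ) :
    (∑ r, |v r|) ^ 2 ≤ Fintype.card m * ∑ r, v r ^ 2 := by
  have := sq_sum_le_card_mul_sum_sq (s := Finset.univ) (f := fun r => |v r|)
  simpa only [sq_abs, Finset.card_univ] using this

end QuadraticForms

section Series

variable {b : ℕ → ℝ → ℝ} {H : ℕ}

theorem continuousOn_series (hb : ∀ h, ContinuousOn (b h) (Icc 0 1)) (γ : Fin H → ℝ) :
    ContinuousOn (series b γ) (Icc 0 1) :=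
  continuousOn_finsetSum _ fun h _ => (hb h).mul continuousOn_const

theorem series_sub (b : ℕ → ℝ → ℝ) (γ γ' : Fin H → ℝ) (u : ℝ) :
    series b (γ - γ') u = series b γ u - series b γ' u := by
  simp only [series, Pi.sub_apply, mul_sub, Finset.sum_sub_distrib]

theorem l2norm_nonneg (g : ℝ → ℝ) : 0 ≤ l2norm g := Real.sqrt_nonneg _

theorem l2norm_sq (g : ℝ → ℝ) : l2norm g ^ 2 = ∫ u in (0 : ℝ)..1, g u ^ 2 :=
  Real.sq_sqrt (intervalIntegral.integral_nonneg zero_le_one fun _ _ => sq_nonneg _)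

theorem intervalIntegrable_of_continuousOn_unit {g : ℝ → ℝ} (hg : ContinuousOn g (Icc 0 1)) :
    IntervalIntegrable g volume 0 1 :=
  ContinuousOn.intervalIntegrable (by rwa [uIcc_of_le zero_le_one])

theorem l2norm_sq_series_eq (hb : ∀ h, ContinuousOn (b h) (Icc 0 1)) (γ : Fin H → ℝ) :
    l2norm (series b γ) ^ 2 =
      ∑ h : Fin H, ∑ h' : Fin H, γ h * (∫ u in (0 : ℝ)..1, b h u * b h' u) * γ h' := by
  have hi : ∀ h h' : Fin H, IntervalIntegrable (fun u => γ h * (b h u * b h' u) * γ h') volume 0 1 :=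
    fun h h' => intervalIntegrable_of_continuousOn_unit
      ((continuousOn_const.mul ((hb h).mul (hb h'))).mul continuousOn_const)
  rw [l2norm_sq]
  have h1 : ∀ u, series b γ u ^ 2 = ∑ h : Fin H, ∑ h' : Fin H, γ h * (b h u * b h' u) * γ h' :=
    fun u => (sum_sum_mul_mul_eq_sq (fun h : Fin H => b h u) γ).symm
  simp only [h1]
  have h2 : ∀ h : Fin H,
      IntervalIntegrable (fun u => ∑ h' : Fin H, γ h * (b h u * b h' u) * γ h') volume 0 1 :=
    fun h => intervalIntegrable_of_continuousOn_unit (continuousOn_finsetSum _ fun h' _ =>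
      (continuousOn_const.mul ((hb h).mul (hb h'))).mul continuousOn_const)
  rw [intervalIntegral.integral_finsetSum fun h _ => h2 h]
  refine Finset.sum_congr rfl fun h _ => ?_
  rw [intervalIntegral.integral_finsetSum fun h' _ => hi h h']
  refine Finset.sum_congr rfl fun h' _ => ?_
  rw [intervalIntegral.integral_mul_const, intervalIntegral.integral_const_mul]

theorem l2norm_sq_series_mem (hb : ∀ h, ContinuousOn (b h) (Icc 0 1)) {c C : ℝ}
    (hgram : spectrum ℝ (Matrix.of fun h h' : Fin H => ∫ u in (0 : ℝ)..1, b h u * b h' u) ⊆ Icc c C)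
    (γ : Fin H → ℝ) :
    c * ∑ h, γ h ^ 2 ≤ l2norm (series b γ) ^ 2 ∧ l2norm (series b γ) ^ 2 ≤ C * ∑ h, γ h ^ 2 := by
  have hA : (Matrix.of fun h h' : Fin H => ∫ u in (0 : ℝ)..1, b h u * b h' u).IsHermitian := by
    ext h h'
    simp only [Matrix.conjTranspose_apply, Matrix.of_apply, star_trivial]
    simp only [mul_comm]
  have h1 := quadratic_form_mem_of_spectrum hA hgram γ
  rw [l2norm_sq_series_eq hb]
  simpa only [dotProduct, Matrix.mulVec, Matrix.of_apply, Finset.mul_sum, mul_assoc] using h1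

end Series

section Design

variable {Ω : Type*} [mΩ : MeasurableSpace Ω] {μ : Measure Ω} {n p : ℕ}
  {lb ub : Fin n → ℝ} {y : ℤ → Ω → Fin n → ℝ} {b : ℕ → ℝ → ℝ}

/-- The sums of the second moments of the max-min coordinates. -/
noncomputable def moment (μ : Measure Ω) (lb ub : Fin n → ℝ) (y : ℤ → Ω → Fin n → ℝ) (T : ℕ)
    (r r' : Idx n p) : ℝ :=
  ∑ t ∈ Finset.Icc 1 T, ∫ ω, coord lb ub y t ω r * coord lb ub y t ω r' ∂μ

theorem designMatrix_one_apply (L T H : ℕ) (q q' : Idx n p × Fin H) :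
    designMatrix μ lb ub y b (fun _ _ _ => 1) L T H q q' =
      (1 / (T : ℝ) * moment μ lb ub y T q.1 q'.1) *
        (1 / (L : ℝ) * ∑ ℓ ∈ Finset.Icc 1 L, b q.2 (grid L ℓ) * b q'.2 (grid L ℓ)) := by
  have h1 : ∀ ℓ t : ℕ, ∫ ω, (1 : ℝ) * xi lb ub y b H t ω (grid L ℓ) q *
      xi lb ub y b H t ω (grid L ℓ) q' ∂μ = b q.2 (grid L ℓ) * b q'.2 (grid L ℓ) *
        ∫ ω, coord lb ub y t ω q.1 * coord lb ub y t ω q'.1 ∂μ := by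
    intro ℓ t
    rw [← integral_const_mul]
    refine integral_congr_ae (Eventually.of_forall fun ω => ?_)
    simp only [xi]; ring
  simp only [designMatrix, Matrix.of_apply, h1]
  simp only [← Finset.mul_sum, ← Finset.sum_mul]
  rw [moment]
  have : 1 / ((L : ℝ) * T) = 1 / (L : ℝ) * (1 / T) := by rw [one_div_mul_one_div]
  rw [this]; ring

theorem sum_prod_mul_eq {m m' : Type*} [Fintype m] [Fintype m'] (S : m → m → ℝ) (B : m' → m' → ℝ)
    (δ : m → ℝ) (w : m' → ℝ) :
    ∑ q : m × m', δ q.1 * w q.2 * ∑ q' : m × m', S q.1 q'.1 * B q.2 q'.2 * (δ q'.1 * w q'.2) =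
      (∑ r, ∑ r', δ r * S r r' * δ r') * ∑ h, ∑ h', w h * B h h' * w h' := by
  rw [Finset.sum_mul_sum, Fintype.sum_prod_type]
  refine Finset.sum_congr rfl fun r _ => Finset.sum_congr rfl fun h _ => ?_
  rw [Finset.sum_mul_sum, Fintype.sum_prod_type, Finset.mul_sum]
  refine Finset.sum_congr rfl fun r' _ => ?_
  rw [Finset.mul_sum]
  exact Finset.sum_congr rfl fun h' _ => by ring

theorem designMatrix_one_form {L T H : ℕ} {c C : ℝ}
    (hdes : spectrum ℝ (designMatrix (p := p) μ lb ub y b (fun _ _ _ => 1) L T H) ⊆ Icc c C)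
    (δ : Idx n p → ℝ) (w : Fin H → ℝ) :
    c * ((∑ r, δ r ^ 2) * ∑ h, w h ^ 2) ≤
      (1 / (T : ℝ) * ∑ r, ∑ r', δ r * moment μ lb ub y T r r' * δ r') *
        (1 / (L : ℝ) * ∑ ℓ ∈ Finset.Icc 1 L, series b w (grid L ℓ) ^ 2) ∧
      (1 / (T : ℝ) * ∑ r, ∑ r', δ r * moment μ lb ub y T r r' * δ r') *
        (1 / (L : ℝ) * ∑ ℓ ∈ Finset.Icc 1 L, series b w (grid L ℓ) ^ 2) ≤
      C * ((∑ r, δ r ^ 2) * ∑ h, w h ^ 2) := by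
  have hA : (designMatrix (p := p) μ lb ub y b (fun _ _ _ => 1) L T H).IsHermitian := by
    ext q q'
    rw [Matrix.conjTranspose_apply, star_trivial, designMatrix_one_apply, designMatrix_one_apply]
    simp only [moment, mul_comm (coord lb ub y _ _ q.1), mul_comm (b q.2 _)]
  have h1 := quadratic_form_mem_of_spectrum hA hdes fun q => δ q.1 * w q.2
  have h2 : ∑ q : Idx n p × Fin H, (δ q.1 * w q.2) ^ 2 = (∑ r, δ r ^ 2) * ∑ h, w h ^ 2 := by
    rw [Finset.sum_mul_sum, Fintype.sum_prod_type]
    exact Finset.sum_congr rfl fun r _ => Finset.sum_congr rfl fun h _ => by ring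
  have h3 : ∑ r, ∑ r', δ r * (1 / (T : ℝ) * moment μ lb ub y T r r') * δ r' =
      1 / (T : ℝ) * ∑ r, ∑ r', δ r * moment μ lb ub y T r r' * δ r' := by
    simp only [Finset.mul_sum]
    exact Finset.sum_congr rfl fun r _ => Finset.sum_congr rfl fun h _ => by ring
  have h4 : ∑ h : Fin H, ∑ h' : Fin H, w h *
      (1 / (L : ℝ) * ∑ ℓ ∈ Finset.Icc 1 L, b h (grid L ℓ) * b h' (grid L ℓ)) * w h' =
      1 / (L : ℝ) * ∑ ℓ ∈ Finset.Icc 1 L, series b w (grid L ℓ) ^ 2 := by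
    have h5 : ∀ u, series b w u ^ 2 = ∑ h : Fin H, ∑ h' : Fin H, w h * (b h u * b h' u) * w h' :=
      fun u => (sum_sum_mul_mul_eq_sq (fun h : Fin H => b h u) w).symm
    simp only [h5]
    simp only [Finset.mul_sum, Finset.sum_mul]
    symm
    rw [Finset.sum_comm]
    refine Finset.sum_congr rfl fun h _ => ?_
    rw [Finset.sum_comm]
    exact Finset.sum_congr rfl fun h' _ => Finset.sum_congr rfl fun ℓ _ => by ring
  rw [h2] at h1
  have h6 : dotProduct (fun q : Idx n p × Fin H => δ q.1 * w q.2)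
      ((designMatrix (p := p) μ lb ub y b (fun _ _ _ => 1) L T H).mulVec
        (fun q => δ q.1 * w q.2)) =
      (1 / (T : ℝ) * ∑ r, ∑ r', δ r * moment μ lb ub y T r r' * δ r') *
        (1 / (L : ℝ) * ∑ ℓ ∈ Finset.Icc 1 L, series b w (grid L ℓ) ^ 2) := by
    rw [← h3, ← h4, ← sum_prod_mul_eq]
    simp only [dotProduct, Matrix.mulVec, designMatrix_one_apply]
  rwa [h6] at h1

end Design

section ModelDesign

variable {Ω : Type*} [mΩ : MeasurableSpace Ω] {μ : Measure Ω} {n p : ℕ}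
  {θ : Fin n → Idx n p → ℝ → ℝ} {lb ub : Fin n → ℝ} {U y : ℤ → Ω → Fin n → ℝ} {b : ℕ → ℝ → ℝ}

theorem Model.integrable_coord_mul [IsProbabilityMeasure μ] (h : Model μ θ lb ub U y) (t : ℤ) (r r' : Idx n p) :
    Integrable (fun ω => coord lb ub y t ω r * coord lb ub y t ω r') μ := by
  have hm : Measurable fun ω => (coord lb ub y t ω : Idx n p → ℝ) :=
    measurable_coord fun s _ => h.measurable_y s
  refine Integrable.of_bound (((measurable_pi_apply r).comp hm).mul
    ((measurable_pi_apply r').comp hm)).aestronglyMeasurable 1 ?_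
  filter_upwards [h.ae_bounded] with ω hω
  have h0 := coord_nonneg (p := p) h.lb_lt_ub hω t
  have h1 := le_one_of_simplex h0 (coord_sum lb ub y t ω)
  rw [Real.norm_eq_abs, abs_of_nonneg (mul_nonneg (h0 r) (h0 r'))]
  exact mul_le_one₀ (h1 r) (h0 r') (h1 r')

theorem Model.sum_moment [IsProbabilityMeasure μ] (h : Model μ θ lb ub U y) (T : ℕ) :
    ∑ r : Idx n p, ∑ r' : Idx n p, moment μ lb ub y T r r' = T := by
  have h1 : ∀ t : ℕ, ∑ r : Idx n p, ∑ r' : Idx n p,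
      ∫ ω, coord lb ub y t ω r * coord lb ub y t ω r' ∂μ = 1 := by
    intro t
    have h2 : ∀ r : Idx n p, ∑ r' : Idx n p,
        ∫ ω, coord lb ub y t ω r * coord lb ub y t ω r' ∂μ =
          ∫ ω, ∑ r' : Idx n p, coord lb ub y t ω r * coord lb ub y t ω r' ∂μ := fun r =>
      (integral_finsetSum _ fun r' _ => h.integrable_coord_mul t r r').symm
    simp only [h2]
    rw [← integral_finsetSum _ fun r _ => integrable_finsetSum _ fun r' _ =>
      h.integrable_coord_mul t r r']
    simp only [← Finset.mul_sum, coord_sum, mul_one, integral_const, probReal_univ, smul_eq_mul]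
  simp only [moment]
  rw [Finset.sum_congr rfl fun r _ => Finset.sum_comm, Finset.sum_comm]
  rw [Finset.sum_congr rfl fun t _ => h1 t]
  simp

/-- The two factors of the design matrix are well conditioned separately. -/
theorem Model.design_bounds [IsProbabilityMeasure μ] (h : Model μ θ lb ub U y) {c C : ℝ} (hc : 0 < c) {L T H : ℕ}
    (hT : 1 ≤ T) (hH : 1 ≤ H)
    (hdes : spectrum ℝ (designMatrix (p := p) μ lb ub y b (fun _ _ _ => 1) L T H) ⊆ Icc c C) :
    0 < C ∧
    (∀ w : Fin H → ℝ, c * ∑ h, w h ^ 2 ≤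
        1 / (L : ℝ) * ∑ ℓ ∈ Finset.Icc 1 L, series b w (grid L ℓ) ^ 2 ∧
      1 / (L : ℝ) * ∑ ℓ ∈ Finset.Icc 1 L, series b w (grid L ℓ) ^ 2 ≤
        C * Fintype.card (Idx n p) * ∑ h, w h ^ 2) ∧
    ∀ δ : Idx n p → ℝ, c / (C * Fintype.card (Idx n p)) * (∑ r, δ r ^ 2) * T ≤
      ∑ r, ∑ r', δ r * moment μ lb ub y T r r' * δ r' := by
  set d : ℝ := ((Fintype.card (Idx n p) : ℕ) : ℝ) with hd
  have hd1 : 1 ≤ d := by rw [hd]; exact_mod_cast Fintype.card_pos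
  have hT0 : (0 : ℝ) < T := by exact_mod_cast hT
  have hones : ∀ w : Fin H → ℝ, c * (d * ∑ h, w h ^ 2) ≤
        1 / (L : ℝ) * ∑ ℓ ∈ Finset.Icc 1 L, series b w (grid L ℓ) ^ 2 ∧
      1 / (L : ℝ) * ∑ ℓ ∈ Finset.Icc 1 L, series b w (grid L ℓ) ^ 2 ≤
        C * (d * ∑ h, w h ^ 2) := by
    intro w
    have h1 := designMatrix_one_form hdes (fun _ => 1) w
    simp only [one_mul, mul_one, h.sum_moment, one_pow, Finset.sum_const, Finset.card_univ,
      nsmul_eq_mul] at h1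
    rwa [one_div_mul_cancel hT0.ne', one_mul] at h1
  have hw0 : ∑ h, (Pi.single (⟨0, hH⟩ : Fin H) (1 : ℝ) : Fin H → ℝ) h ^ 2 = 1 := by
    rw [Finset.sum_eq_single ⟨0, hH⟩] <;> simp +contextual
  obtain ⟨h1, h2⟩ := hones (Pi.single ⟨0, hH⟩ 1)
  have h3 := fun δ : Idx n p → ℝ => (designMatrix_one_form hdes δ (Pi.single ⟨0, hH⟩ 1)).1
  rw [hw0, mul_one] at h1 h2
  simp only [hw0, mul_one] at h3
  set β : ℝ := 1 / (L : ℝ) * ∑ ℓ ∈ Finset.Icc 1 L,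
    series b (Pi.single (⟨0, hH⟩ : Fin H) (1 : ℝ)) (grid L ℓ) ^ 2 with hβ
  have hcd : 0 < c * d := by positivity
  have hβ0 : 0 < β := hcd.trans_le h1
  have hCd : 0 < C * d := hβ0.trans_le h2
  refine ⟨pos_of_mul_pos_left hCd (by linarith), fun w => ⟨?_, ?_⟩, fun δ => ?_⟩
  · have : 0 ≤ ∑ h, w h ^ 2 := Finset.sum_nonneg fun _ _ => sq_nonneg _
    refine le_trans ?_ (hones w).1
    exact mul_le_mul_of_nonneg_left (by nlinarith) hc.le
  · rw [mul_assoc]; exact (hones w).2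
  · have h4 := h3 δ
    set Q := ∑ r, ∑ r', δ r * moment μ lb ub y T r r' * δ r' with hQ
    have hδ : 0 ≤ ∑ r, δ r ^ 2 := Finset.sum_nonneg fun _ _ => sq_nonneg _
    have hQ0 : 0 ≤ 1 / (T : ℝ) * Q := by
      by_contra hcon
      have := mul_neg_of_neg_of_pos (not_le.1 hcon) hβ0
      have := mul_nonneg hc.le hδ
      linarith
    have h5 : c * ∑ r, δ r ^ 2 ≤ 1 / (T : ℝ) * Q * (C * d) :=
      h4.trans (mul_le_mul_of_nonneg_left h2 hQ0)
    have h6 : c * (∑ r, δ r ^ 2) * T ≤ Q * (C * d) := by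
      have h7 := mul_le_mul_of_nonneg_right h5 hT0.le
      have h8 : 1 / (T : ℝ) * Q * (C * d) * T = Q * (C * d) := by field_simp
      rwa [h8] at h7
    rw [div_mul_eq_mul_div, div_mul_eq_mul_div, div_le_iff₀ hCd]
    exact h6

/-- The max-min coordinates as a function of the state. -/
noncomputable def coordOf (lb ub : Fin n → ℝ) (x : Fin n × Fin p → ℝ) : Idx n p → ℝ
  | some q => (x q - lb q.1) / (((n * p : ℕ) : ℝ) * (ub q.1 - lb q.1))
  | none => 1 - ∑ q : Fin n × Fin p, (x q - lb q.1) / (((n * p : ℕ) : ℝ) * (ub q.1 - lb q.1))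

theorem coord_eq_coordOf {Ω : Type*} (lb ub : Fin n → ℝ) (y : ℤ → Ω → Fin n → ℝ) (t : ℤ) (ω : Ω) :
    (coord lb ub y t ω : Idx n p → ℝ) = coordOf lb ub (state y (t - 1) ω) := by
  have h1 : ∀ q : Fin n × Fin p, y (t - ((q.2 : ℕ) + 1)) ω q.1 = state y (t - 1) ω q := fun q => by
    rw [state, sub_sub, add_comm (1 : ℤ)]
  funext r
  cases r <;> simp only [coord, coordOf, h1]

theorem abs_coordOf_sub_le (lb ub : Fin n → ℝ) {x x' : Fin n × Fin p → ℝ} {η : ℝ}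
    (hx : ∀ q, |x q - x' q| ≤ η) (r : Idx n p) :
    |coordOf lb ub x r - coordOf lb ub x' r| ≤
      η * ∑ q : Fin n × Fin p, |((n * p : ℕ) : ℝ) * (ub q.1 - lb q.1)|⁻¹ := by
  have h1 : ∀ q : Fin n × Fin p, |coordOf lb ub x (some q) - coordOf lb ub x' (some q)| ≤
      η * |((n * p : ℕ) : ℝ) * (ub q.1 - lb q.1)|⁻¹ := fun q => by
    simp only [coordOf]
    rw [← sub_div, sub_sub_sub_cancel_right, abs_div, div_eq_mul_inv]
    exact mul_le_mul_of_nonneg_right (hx q) (by positivity)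
  rw [Finset.mul_sum]
  match r with
  | some q =>
    refine (h1 q).trans (Finset.single_le_sum
      (f := fun q : Fin n × Fin p => η * |((n * p : ℕ) : ℝ) * (ub q.1 - lb q.1)|⁻¹)
      (fun q _ => ?_) (Finset.mem_univ q))
    exact mul_nonneg ((abs_nonneg _).trans (hx q)) (by positivity)
  | none =>
    have h2 : coordOf lb ub x none - coordOf lb ub x' none =
        -∑ q : Fin n × Fin p, (coordOf lb ub x (some q) - coordOf lb ub x' (some q)) := by
      simp only [coordOf, Finset.sum_sub_distrib]; ring
    rw [h2, abs_neg]
    exact (Finset.abs_sum_le_sum_abs _ _).trans (Finset.sum_le_sum fun q _ => h1 q)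

theorem measurable_coordOf (lb ub : Fin n → ℝ) :
    Measurable (coordOf lb ub : (Fin n × Fin p → ℝ) → Idx n p → ℝ) := by
  refine measurable_pi_lambda _ fun r => ?_
  cases r with
  | some q => exact ((measurable_pi_apply q).sub_const _).div_const _
  | none => exact (Finset.measurable_sum _ fun q _ =>
      ((measurable_pi_apply q).sub_const _).div_const _).const_sub 1

theorem Model.indepFun_approxState (h : Model μ θ lb ub U y) {K : ℕ} {s t : ℤ} (hst : s + K ≤ t) :
    IndepFun (fun ω => approxState (extend θ) (fun s => clipped U s ω) K s)
      (fun ω => approxState (extend θ) (fun s => clipped U s ω) K t) μ := by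
  have h1 := indep_iSup_of_disjoint (m := fun s => MeasurableSpace.comap (U s) inferInstance)
    (fun s => (h.measurable_U s).comap_le) h.indep (S := Iic s) (T := Ioc (t - K) t)
    (Set.disjoint_left.2 fun r h1 h2 => by have := h2.1; have : r ≤ s := h1; omega)
  have hm : ∀ (S : Set ℤ) (t : ℤ), (∀ r, t - K < r → r ≤ t → r ∈ S) →
      Measurable[⨆ s ∈ S, MeasurableSpace.comap (U s) inferInstance]
        fun ω => approxState (extend θ) (fun s => clipped U s ω) K t := fun S t hS =>
    @measurable_approxState Ω n p (⨆ s ∈ S, MeasurableSpace.comap (U s) inferInstance) _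
      h.measurable_extend _ K t fun r hr1 hr2 => @measurable_clipped Ω n
        (⨆ s ∈ S, MeasurableSpace.comap (U s) inferInstance) U r
        (measurable_iff_comap_le.2 (le_iSup₂ (f := fun s (_ : s ∈ S) =>
          MeasurableSpace.comap (U s) inferInstance) r (hS r hr1 hr2)))
  rw [IndepFun_iff_Indep]
  refine indep_of_indep_of_le_left (indep_of_indep_of_le_right h1 ?_) ?_
  · exact (hm (Ioc (t - K) t) t fun r hr1 hr2 => ⟨hr1, hr2⟩).comap_le
  · exact (hm (Iic s) s fun r _ hr2 => hr2).comap_le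

theorem abs_mul_sub_mul_le {a a' b b' : ℝ} (ha : a ∈ Icc (0 : ℝ) 1) (hb' : b' ∈ Icc (0 : ℝ) 1) :
    |a * b - a' * b'| ≤ |a - a'| + |b - b'| := by
  have h1 : a * b - a' * b' = a * (b - b') + b' * (a - a') := by ring
  rw [h1]
  refine (abs_add_le _ _).trans ?_
  rw [abs_mul, abs_mul, abs_of_nonneg ha.1, abs_of_nonneg hb'.1]
  nlinarith [ha.2, hb'.2, abs_nonneg (b - b'), abs_nonneg (a - a')]

theorem Model.tendsto_measure_moment [IsProbabilityMeasure μ] (h : Model μ θ lb ub U y) (r r' : Idx n p) {ε : ℝ}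
    (hε : 0 < ε) :
    Tendsto (fun T : ℕ => μ {ω | ε * T < |∑ t ∈ Finset.Icc 1 T,
      (coord lb ub y t ω r * coord lb ub y t ω r' -
        ∫ ω, coord lb ub y t ω r * coord lb ub y t ω r' ∂μ)|}) atTop (𝓝 0) := by
  have hcm : ∀ t : ℤ, Measurable fun ω => (coord lb ub y t ω : Idx n p → ℝ) := fun t =>
    measurable_coord fun s _ => h.measurable_y s
  refine tendsto_measure_lt_abs_sum_sub
    (D := fun t ω => coord lb ub y t ω r * coord lb ub y t ω r')
    (fun t => ((measurable_pi_apply r).comp (hcm t)).mul ((measurable_pi_apply r').comp (hcm t)))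
    (fun η hη => ?_) hε
  obtain ⟨m, ρ, A, hρ0, hρ1, happ⟩ := h.exists_approx
  set Λ : ℝ := ∑ q : Fin n × Fin p, |((n * p : ℕ) : ℝ) * (ub q.1 - lb q.1)|⁻¹ with hΛ
  have hlim : Tendsto (fun k : ℕ => ρ ^ k * A * Λ) atTop (𝓝 0) := by
    simpa using ((tendsto_pow_atTop_nhds_zero_of_lt_one hρ0 hρ1).mul_const A).mul_const Λ
  obtain ⟨k, hk⟩ := (hlim.eventually_le_const (by linarith : 0 < η / 2)).exists
  set x' : ℤ → Ω → Fin n × Fin p → ℝ := fun t ω =>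
    approxState (extend θ) (fun s => clipped U s ω) (m * k) t with hx'
  have hx'm : ∀ t, Measurable (x' t) := fun t =>
    measurable_approxState h.measurable_extend _ _ fun s _ _ => measurable_clipped (h.measurable_U s)
  set g : (Fin n × Fin p → ℝ) → ℝ := fun x =>
    clip (coordOf lb ub x r) * clip (coordOf lb ub x r') with hg
  have hgm : Measurable g := by
    have h1 := measurable_coordOf (p := p) lb ub
    exact (continuous_clip.measurable.comp ((measurable_pi_apply r).comp h1)).mul
      (continuous_clip.measurable.comp ((measurable_pi_apply r').comp h1))
  refine ⟨m * k, fun t ω => g (x' ((t : ℤ) - 1) ω), fun t => hgm.comp (hx'm _), fun t ω => ?_,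
    fun s t hst => ?_, ?_⟩
  · have h1 := clip_mem (coordOf lb ub (x' ((t : ℤ) - 1) ω) r)
    have h2 := clip_mem (coordOf lb ub (x' ((t : ℤ) - 1) ω) r')
    exact ⟨mul_nonneg h1.1 h2.1, mul_le_one₀ h1.2 h2.1 h2.2⟩
  · exact (h.indepFun_approxState (K := m * k) (s := (s : ℤ) - 1) (t := (t : ℤ) - 1)
      (by push_cast at hst ⊢; zify at hst; linarith)).comp hgm hgm
  · filter_upwards [happ, h.ae_bounded] with ω h1 h2 t
    have h0 := coord_nonneg (p := p) h.lb_lt_ub h2 t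
    have h3 := le_one_of_simplex h0 (coord_sum lb ub y t ω)
    have h4 : ∀ s, |coord lb ub y t ω s - clip (coordOf lb ub (x' ((t : ℤ) - 1) ω) s)| ≤ η / 2 := by
      intro s
      rw [← clip_of_mem (u := coord lb ub y t ω s) ⟨h0 s, h3 s⟩]
      refine (abs_clip_sub_clip_le _ _).trans ?_
      rw [coord_eq_coordOf]
      exact (abs_coordOf_sub_le lb ub (fun q => h1 k _ q) s).trans hk
    refine (abs_mul_sub_mul_le ⟨h0 r, h3 r⟩ (clip_mem _)).trans ?_
    linarith [h4 r, h4 r']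

/-- The empirical second moment matrix of the max-min coordinates is well conditioned with
probability tending to one. -/
theorem Model.tendsto_measure_not_lower_bound [IsProbabilityMeasure μ] (h : Model μ θ lb ub U y) {κ : ℝ} (hκ : 0 < κ)
    (hmom : ∀ᶠ T : ℕ in atTop, ∀ δ : Idx n p → ℝ, κ * (∑ r, δ r ^ 2) * T ≤
      ∑ r, ∑ r', δ r * moment μ lb ub y T r r' * δ r') :
    Tendsto (fun T : ℕ => μ {ω | ¬ ∀ δ : Idx n p → ℝ,
      κ / (2 * Fintype.card (Idx n p)) * T * (∑ r, |δ r|) ^ 2 ≤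
        ∑ t ∈ Finset.Icc 1 T, (∑ r, coord lb ub y t ω r * δ r) ^ 2}) atTop (𝓝 0) := by
  set d : ℝ := ((Fintype.card (Idx n p) : ℕ) : ℝ) with hd
  have hd0 : 0 < d := by rw [hd]; exact_mod_cast Fintype.card_pos
  set ε : ℝ := κ / (2 * d) with hε
  have hε0 : 0 < ε := by positivity
  have hsum : Tendsto (fun T : ℕ => ∑ r : Idx n p, ∑ r' : Idx n p,
      μ {ω | ε * T < |∑ t ∈ Finset.Icc 1 T, (coord lb ub y t ω r * coord lb ub y t ω r' -
        ∫ ω, coord lb ub y t ω r * coord lb ub y t ω r' ∂μ)|}) atTop (𝓝 0) := by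
    have := tendsto_finsetSum (Finset.univ : Finset (Idx n p)) fun r _ =>
      tendsto_finsetSum (Finset.univ : Finset (Idx n p)) fun r' _ =>
        h.tendsto_measure_moment r r' hε0
    simpa using this
  refine tendsto_of_tendsto_of_tendsto_of_le_of_le' tendsto_const_nhds hsum
    (Eventually.of_forall fun _ => bot_le) ?_
  filter_upwards [hmom] with T hT
  have hsub : {ω | ¬ ∀ δ : Idx n p → ℝ, ε * T * (∑ r, |δ r|) ^ 2 ≤
        ∑ t ∈ Finset.Icc 1 T, (∑ r, coord lb ub y t ω r * δ r) ^ 2} ⊆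
      ⋃ r : Idx n p, ⋃ r' : Idx n p, {ω | ε * T < |∑ t ∈ Finset.Icc 1 T,
        (coord lb ub y t ω r * coord lb ub y t ω r' -
          ∫ ω, coord lb ub y t ω r * coord lb ub y t ω r' ∂μ)|} := by
    intro ω hω
    by_contra hcon
    simp only [mem_iUnion, mem_ofPred_eq, not_exists, not_lt] at hcon
    refine hω fun δ => ?_
    have h1 : ∑ t ∈ Finset.Icc 1 T, (∑ r, coord lb ub y t ω r * δ r) ^ 2 =
        ∑ r, ∑ r', δ r * moment μ lb ub y T r r' * δ r' + ∑ r, ∑ r', δ r *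
          (∑ t ∈ Finset.Icc 1 T, (coord lb ub y t ω r * coord lb ub y t ω r' -
            ∫ ω, coord lb ub y t ω r * coord lb ub y t ω r' ∂μ)) * δ r' := by
      simp only [← Finset.sum_add_distrib, ← add_mul, ← mul_add, moment, add_sub_cancel]
      simp only [← sum_sum_mul_mul_eq_sq]
      rw [Finset.sum_comm]
      refine Finset.sum_congr rfl fun r _ => ?_
      rw [Finset.sum_comm]
      refine Finset.sum_congr rfl fun r' _ => ?_
      rw [← Finset.sum_mul, ← Finset.mul_sum]
    have h2 : |∑ r, ∑ r', δ r * (∑ t ∈ Finset.Icc 1 T,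
          (coord lb ub y t ω r * coord lb ub y t ω r' -
            ∫ ω, coord lb ub y t ω r * coord lb ub y t ω r' ∂μ)) * δ r'| ≤
        ε * T * (∑ r, |δ r|) ^ 2 := by
      rw [sq, Finset.sum_mul_sum, Finset.mul_sum]
      refine (Finset.abs_sum_le_sum_abs _ _).trans (Finset.sum_le_sum fun r _ => ?_)
      rw [Finset.mul_sum]
      refine (Finset.abs_sum_le_sum_abs _ _).trans (Finset.sum_le_sum fun r' _ => ?_)
      rw [abs_mul, abs_mul]
      have h3 := mul_le_mul_of_nonneg_left (hcon r r')
        (mul_nonneg (abs_nonneg (δ r)) (abs_nonneg (δ r')))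
      nlinarith
    have h3 := hT δ
    have h4 := sq_sum_abs_le δ
    have h5 : κ / d * (∑ r, |δ r|) ^ 2 * T ≤ κ * (∑ r, δ r ^ 2) * T := by
      refine mul_le_mul_of_nonneg_right ?_ (Nat.cast_nonneg _)
      rw [div_mul_eq_mul_div, div_le_iff₀ hd0]
      have := mul_le_mul_of_nonneg_left h4 hκ.le
      rw [← hd] at this
      linarith
    have h6 : κ / d = 2 * ε := by rw [hε]; field_simp
    rw [h6] at h5
    have h7 := (abs_le.1 h2).1
    rw [h1]
    linarith
  exact (measure_mono hsub).trans ((measure_iUnion_fintype_le _ _).trans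
    (Finset.sum_le_sum fun r _ => measure_iUnion_fintype_le _ _))

end ModelDesign

section Level

variable {ι : Type*} [Fintype ι]

/-- A sample path for which the weighted empirical process is bounded by `K √T` and the second
moments of the weights are bounded from below. -/
structure RegularPath (φ : ι → ℝ → ℝ) (B c M K κ : ℝ) (T : ℕ) (C : ℕ → ι → ℝ) (Y : ℕ → ℝ) :
    Prop where
  B_pos : 0 < B
  c_pos : 0 < c
  M_pos : 0 < M
  K_nonneg : 0 ≤ K
  κ_pos : 0 < κ
  measurable_coef : ∀ r, Measurable (φ r)
  coef_le : ∀ r, ∀ τ ∈ Icc (0 : ℝ) 1, |φ r τ| ≤ M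
  weight_nonneg : ∀ t r, 0 ≤ C t r
  weight_sum : ∀ t, ∑ r, C t r = 1
  slope : ∀ t, SlopeBounds B c (mix φ (C t))
  empirical : ∀ r, ∀ g : ι → ℝ, (∀ s, |g s| ≤ M) →
    |∑ t ∈ Finset.Icc 1 T, score φ r g (C t) (Y t)| ≤ K * √T
  lower : ∀ δ : ι → ℝ, κ * T * (∑ r, |δ r|) ^ 2 ≤ ∑ t ∈ Finset.Icc 1 T, (∑ r, C t r * δ r) ^ 2

/-- The check loss at the quantile level `τ` of the coefficients `g`. -/
noncomputable def lossAt (T : ℕ) (C : ℕ → ι → ℝ) (Y : ℕ → ℝ) (τ : ℝ) (g : ι → ℝ) : ℝ :=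
  ∑ t ∈ Finset.Icc 1 T, check τ (Y t - ∑ r, C t r * g r)

/-- The conditional mean of the excess loss at the quantile level `τ` of the coefficients `g`. -/
noncomputable def excess (φ : ι → ℝ → ℝ) (T : ℕ) (C : ℕ → ι → ℝ) (τ : ℝ) (g : ι → ℝ) : ℝ :=
  ∑ t ∈ Finset.Icc 1 T,
    ∫ s in (mix φ (C t) τ)..(∑ r, C t r * g r), (levelCdf (mix φ (C t)) s - τ)

/-- The `ℓ¹` distance between `g` and the true coefficients at the quantile level `τ`. -/
def dev (φ : ι → ℝ → ℝ) (τ : ℝ) (g : ι → ℝ) : ℝ := ∑ r, |g r - φ r τ|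

variable {φ : ι → ℝ → ℝ} {B c M K κ : ℝ} {T : ℕ} {C : ℕ → ι → ℝ} {Y : ℕ → ℝ} {τ : ℝ} {g : ι → ℝ}

theorem dev_nonneg (φ : ι → ℝ → ℝ) (τ : ℝ) (g : ι → ℝ) : 0 ≤ dev φ τ g :=
  Finset.sum_nonneg fun _ _ => abs_nonneg _

theorem abs_sub_le_dev (φ : ι → ℝ → ℝ) (τ : ℝ) (g : ι → ℝ) (r : ι) : |g r - φ r τ| ≤ dev φ τ g :=
  Finset.single_le_sum (f := fun r => |g r - φ r τ|) (fun _ _ => abs_nonneg _) (Finset.mem_univ r)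

theorem dev_le_of_abs_le {ρ : ℝ} (h : ∀ r, |g r - φ r τ| ≤ ρ) : dev φ τ g ≤ Fintype.card ι * ρ := by
  refine (Finset.sum_le_sum fun r _ => h r).trans (le_of_eq ?_)
  rw [Finset.sum_const, Finset.card_univ, nsmul_eq_mul]

theorem sum_sub_mix (z : ι → ℝ) :
    ∑ r, z r * g r - mix φ z τ = ∑ r, z r * (g r - φ r τ) := by
  simp only [mix, mul_sub, Finset.sum_sub_distrib]

namespace RegularPath

theorem measurable_mix (h : RegularPath φ B c M K κ T C Y) (t : ℕ) : Measurable (mix φ (C t)) :=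
  measurable_mix_right h.measurable_coef _

theorem weight_le_one (h : RegularPath φ B c M K κ T C Y) (t : ℕ) (r : ι) : C t r ≤ 1 :=
  le_one_of_simplex (h.weight_nonneg t) (h.weight_sum t) r

theorem abs_sum_sub_mix_le (h : RegularPath φ B c M K κ T C Y) (t : ℕ) :
    |∑ r, C t r * g r - mix φ (C t) τ| ≤ dev φ τ g := by
  rw [sum_sub_mix]
  refine (Finset.abs_sum_le_sum_abs _ _).trans (Finset.sum_le_sum fun r _ => ?_)
  rw [abs_mul, abs_of_nonneg (h.weight_nonneg t r)]
  exact mul_le_of_le_one_left (abs_nonneg _) (h.weight_le_one t r)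

theorem dev_le (h : RegularPath φ B c M K κ T C Y) (hτ : τ ∈ Icc (0 : ℝ) 1)
    (hg : ∀ r, |g r| ≤ M) : dev φ τ g ≤ 2 * Fintype.card ι * M := by
  refine (dev_le_of_abs_le (ρ := 2 * M) fun r => (abs_sub _ _).trans ?_).trans (le_of_eq (by ring))
  linarith [hg r, h.coef_le r τ hτ]

theorem levelCdf_mix (h : RegularPath φ B c M K κ T C Y) (hτ : τ ∈ Icc (0 : ℝ) 1) (t : ℕ) :
    levelCdf (mix φ (C t)) (mix φ (C t) τ) = τ :=
  (h.slope t).levelCdf_apply h.B_pos (h.measurable_mix t) hτ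

/-- The empirical excess loss differs from its conditional mean by a martingale, which is controlled
by the weighted empirical process. -/
theorem abs_lossAt_sub_sub_excess_le (h : RegularPath φ B c M K κ T C Y) (hτ : τ ∈ Icc (0 : ℝ) 1)
    (hg : ∀ r, |g r| ≤ M) :
    |lossAt T C Y τ g - lossAt T C Y τ (fun r => φ r τ) - excess φ T C τ g| ≤
      K * √T * dev φ τ g := by
  set δ : ι → ℝ := fun r => g r - φ r τ with hδ
  set ψ : ℕ → ℝ → ℝ := fun t s => (if Y t < s then (1 : ℝ) else 0) - levelCdf (mix φ (C t)) s with hψ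
  have hψm : ∀ t, Measurable (ψ t) := fun t =>
    (monotone_indicator_lt (Y t)).measurable.sub (levelCdf_mono _).measurable
  have hψ1 : ∀ t s, |ψ t s| ≤ 1 := fun t s => by
    have h0 := levelCdf_nonneg (mix φ (C t)) s
    have h1 := levelCdf_le_one (mix φ (C t)) s
    simp only [hψ]
    split_ifs <;> rw [abs_le] <;> constructor <;> linarith
  have h1 : lossAt T C Y τ g - lossAt T C Y τ (fun r => φ r τ) - excess φ T C τ g =
      ∑ t ∈ Finset.Icc 1 T, ∫ s in (mix φ (C t) τ)..(∑ r, C t r * g r), ψ t s := by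
    simp only [lossAt, excess, ← Finset.sum_sub_distrib]
    refine Finset.sum_congr rfl fun t _ => ?_
    rw [check_sub_check, ← mix, ← intervalIntegral.integral_sub]
    · refine intervalIntegral.integral_congr fun s _ => ?_
      simp only [hψ]; ring
    · exact (monotone_indicator_lt (Y t)).intervalIntegrable_sub_const _ _ _
    · exact (levelCdf_mono _).intervalIntegrable_sub_const _ _ _
  have h2 : ∀ t, ∫ s in (mix φ (C t) τ)..(∑ r, C t r * g r), ψ t s =
      ∫ v in (0 : ℝ)..1, (∑ r, C t r * δ r) *
        ψ t (mix φ (C t) τ + (∑ r, C t r * δ r) * v) := by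
    intro t
    rw [intervalIntegral.integral_const_mul, intervalIntegral.mul_integral_comp_add_mul]
    congr 1
    · ring
    · rw [← sum_sub_mix]; ring
  have h3 : ∀ t, IntervalIntegrable (fun v => (∑ r, C t r * δ r) *
      ψ t (mix φ (C t) τ + (∑ r, C t r * δ r) * v)) volume 0 1 := by
    intro t
    refine IntervalIntegrable.const_mul ?_ _
    rw [intervalIntegrable_iff]
    refine Measure.integrableOn_of_bounded (M := 1) (by simp)
      ((hψm t).comp (by fun_prop)).aestronglyMeasurable (Eventually.of_forall fun v => hψ1 t _)
  rw [h1, Finset.sum_congr rfl fun t _ => h2 t,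
    ← intervalIntegral.integral_finsetSum fun t _ => h3 t]
  have h4 := intervalIntegral.norm_integral_le_of_norm_le_const (a := (0 : ℝ)) (b := 1)
    (f := fun v => ∑ t ∈ Finset.Icc 1 T, (∑ r, C t r * δ r) *
      ψ t (mix φ (C t) τ + (∑ r, C t r * δ r) * v)) (C := K * √T * dev φ τ g) ?_
  · simpa using h4
  intro v hv
  rw [uIoc_of_le zero_le_one] at hv
  have hgv : ∀ s, |φ s τ + v * δ s| ≤ M := by
    intro s
    have e : φ s τ + v * δ s = (1 - v) * φ s τ + v * g s := by simp only [hδ]; ring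
    rw [e]
    refine (abs_add_le _ _).trans ?_
    rw [abs_mul, abs_mul, abs_of_nonneg (by linarith [hv.2] : 0 ≤ 1 - v), abs_of_nonneg hv.1.le]
    have a1 := mul_le_mul_of_nonneg_left (h.coef_le s τ hτ) (by linarith [hv.2] : 0 ≤ 1 - v)
    have a2 := mul_le_mul_of_nonneg_left (hg s) hv.1.le
    linarith
  have h5 : ∑ t ∈ Finset.Icc 1 T, (∑ r, C t r * δ r) *
      ψ t (mix φ (C t) τ + (∑ r, C t r * δ r) * v) =
      ∑ r, δ r * ∑ t ∈ Finset.Icc 1 T, score φ r (fun s => φ s τ + v * δ s) (C t) (Y t) := by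
    simp only [Finset.mul_sum]
    rw [Finset.sum_comm]
    refine Finset.sum_congr rfl fun t _ => ?_
    rw [Finset.sum_mul]
    refine Finset.sum_congr rfl fun r _ => ?_
    have e : ∑ s, C t s * (φ s τ + v * δ s) = mix φ (C t) τ + (∑ r, C t r * δ r) * v := by
      simp only [mix, mul_add, Finset.sum_add_distrib, Finset.sum_mul]
      congr 1
      exact Finset.sum_congr rfl fun s _ => by ring
    simp only [score, e, hψ]
    ring
  rw [h5, Real.norm_eq_abs]
  refine (Finset.abs_sum_le_sum_abs _ _).trans ?_
  rw [dev, Finset.mul_sum]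
  refine Finset.sum_le_sum fun r _ => ?_
  rw [abs_mul, mul_comm]
  exact mul_le_mul_of_nonneg_right (h.empirical r _ hgv) (abs_nonneg _)

theorem sum_sq_le_excess (h : RegularPath φ B c M K κ T C Y) (hτ : τ ∈ Icc (0 : ℝ) 1) (g : ι → ℝ) :
    ∑ t ∈ Finset.Icc 1 T, (levelCdf (mix φ (C t)) (∑ r, C t r * g r) - τ) ^ 2 ≤
      4 * B * excess φ T C τ g := by
  rw [excess, Finset.mul_sum]
  refine Finset.sum_le_sum fun t _ => ?_
  have hB := h.B_pos
  have h1 := sq_le_integral_sub (levelCdf_mono (mix φ (C t))) hB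
    ((h.slope t).abs_levelCdf_sub_le hB (h.measurable_mix t)) (h.levelCdf_mix hτ t)
    (∑ r, C t r * g r)
  rw [div_le_iff₀ (by positivity)] at h1
  linarith

theorem excess_nonneg (h : RegularPath φ B c M K κ T C Y) (hτ : τ ∈ Icc (0 : ℝ) 1) (g : ι → ℝ) :
    0 ≤ excess φ T C τ g := by
  have h1 := h.sum_sq_le_excess hτ g
  have hB := h.B_pos
  have h2 : 0 ≤ ∑ t ∈ Finset.Icc 1 T, (levelCdf (mix φ (C t)) (∑ r, C t r * g r) - τ) ^ 2 :=
    Finset.sum_nonneg fun _ _ => sq_nonneg _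
  exact nonneg_of_mul_nonneg_right (h2.trans h1) (by positivity)

theorem excess_le (h : RegularPath φ B c M K κ T C Y) (hτ : τ ∈ Icc (0 : ℝ) 1) (g : ι → ℝ) :
    excess φ T C τ g ≤ T * (B * dev φ τ g ^ 2) := by
  have hB := h.B_pos
  have h1 : ∀ t ∈ Finset.Icc 1 T,
      ∫ s in (mix φ (C t) τ)..(∑ r, C t r * g r), (levelCdf (mix φ (C t)) s - τ) ≤
        B * dev φ τ g ^ 2 := by
    intro t _
    refine (integral_sub_le_sq hB ((h.slope t).abs_levelCdf_sub_le hB (h.measurable_mix t))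
      (h.levelCdf_mix hτ t) _).trans (mul_le_mul_of_nonneg_left ?_ hB.le)
    rw [← sq_abs]
    exact pow_le_pow_left₀ (abs_nonneg _) (h.abs_sum_sub_mix_le t) 2
  refine (Finset.sum_le_sum h1).trans (le_of_eq ?_)
  rw [Finset.sum_const, Nat.card_Icc, nsmul_eq_mul, Nat.add_sub_cancel]

theorem le_excess (h : RegularPath φ B c M K κ T C Y) (hτ : τ ∈ Icc (0 : ℝ) 1) (g : ι → ℝ) :
    κ / 4 * T * min (c * dev φ τ g ^ 2) (min τ (1 - τ) * dev φ τ g) ≤ excess φ T C τ g := by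
  have hB := h.B_pos
  have hc := h.c_pos
  set N := dev φ τ g with hN
  have hN0 : 0 ≤ N := dev_nonneg φ τ g
  rcases hN0.eq_or_lt with hz | hpos
  · rw [← hz]; simpa using h.excess_nonneg hτ g
  have hτ' : 0 ≤ min τ (1 - τ) := le_min hτ.1 (by linarith [hτ.2])
  set m := min (c * N ^ 2) (min τ (1 - τ) * N) with hm
  have hm0 : 0 ≤ m := le_min (by positivity) (by positivity)
  have h1 : ∀ t ∈ Finset.Icc 1 T, 1 / 4 * m * (∑ r, C t r * (g r - φ r τ)) ^ 2 ≤
      N ^ 2 * ∫ s in (mix φ (C t) τ)..(∑ r, C t r * g r), (levelCdf (mix φ (C t)) s - τ) := by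
    intro t _
    have h2 := min_le_integral_sub (levelCdf_mono (mix φ (C t))) (h.levelCdf_mix hτ t) hτ
      (fun s hs => (h.slope t).le_levelCdf_sub hB hc (h.measurable_mix t) hτ hs)
      (fun s hs => (h.slope t).le_sub_levelCdf hc hB (h.measurable_mix t) hτ hs)
      (∑ r, C t r * g r)
    have h3 := h.abs_sum_sub_mix_le (g := g) (τ := τ) t
    rw [sum_sub_mix] at h2 h3
    set x := ∑ r, C t r * (g r - φ r τ) with hx
    refine le_trans ?_ (mul_le_mul_of_nonneg_left h2 (sq_nonneg N))
    have hx2 : x ^ 2 ≤ N * |x| := by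
      rw [← sq_abs, sq]; exact mul_le_mul_of_nonneg_right h3 (abs_nonneg _)
    have h4 : m * x ^ 2 ≤ N ^ 2 * min (c * x ^ 2) (min τ (1 - τ) * |x|) := by
      rw [mul_min_of_nonneg _ _ (sq_nonneg N)]
      refine le_min ?_ ?_
      · refine (mul_le_mul_of_nonneg_right (min_le_left _ _) (sq_nonneg x)).trans (le_of_eq (by ring))
      · refine (mul_le_mul (min_le_right _ _) hx2 (sq_nonneg x) (by positivity)).trans
          (le_of_eq (by ring))
    linarith
  have h2 := Finset.sum_le_sum h1
  rw [← Finset.mul_sum, ← Finset.mul_sum] at h2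
  have h3 := mul_le_mul_of_nonneg_left (h.lower fun r => g r - φ r τ)
    (by positivity : 0 ≤ 1 / 4 * m)
  have h4 : N ^ 2 * (κ / 4 * T * m) ≤ N ^ 2 * excess φ T C τ g := by
    refine le_trans (le_of_eq ?_) (h3.trans h2)
    rw [hN, dev]; ring
  exact le_of_mul_le_mul_left h4 (by positivity)

/-- The change of the loss when one coefficient is changed by `e`. -/
theorem lossAt_update_sub_le [DecidableEq ι] (h : RegularPath φ B c M K κ T C Y) (r : ι) (e : ℝ)
    (hg : ∀ s, |Function.update g r (g r - e) s| ≤ M) :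
    lossAt T C Y τ (Function.update g r (g r - e)) - lossAt T C Y τ g ≤
      |e| * (K * √T + ∑ t ∈ Finset.Icc 1 T, |levelCdf (mix φ (C t)) (∑ s, C t s * g s) - τ| +
        T * (B * |e|)) := by
  set g' := Function.update g r (g r - e) with hg'
  have hdiff : ∀ t, ∑ s, C t s * g' s - ∑ s, C t s * g s = -(C t r * e) := by
    intro t
    rw [← Finset.sum_sub_distrib, Finset.sum_eq_single r]
    · rw [hg', Function.update_self]; ring
    · intro s _ hs
      rw [hg', Function.update_of_ne hs]; ring
    · simp
  have h1 : ∀ t ∈ Finset.Icc 1 T, check τ (Y t - ∑ s, C t s * g' s) -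
      check τ (Y t - ∑ s, C t s * g s) ≤ -e * score φ r g' (C t) (Y t) +
        |e| * (|levelCdf (mix φ (C t)) (∑ s, C t s * g s) - τ| + B * |e|) := by
    intro t _
    refine (check_sub_le τ (Y t) (∑ s, C t s * g s) (∑ s, C t s * g' s)).trans ?_
    rw [hdiff t]
    set F := levelCdf (mix φ (C t)) with hF
    have h2 := (h.slope t).abs_levelCdf_sub_le h.B_pos (h.measurable_mix t) (∑ s, C t s * g' s)
      (∑ s, C t s * g s)
    rw [hdiff t, abs_neg, abs_mul, abs_of_nonneg (h.weight_nonneg t r)] at h2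
    have hB := h.B_pos
    have hC0 := h.weight_nonneg t r
    have hC1 := h.weight_le_one t r
    have h3 : |F (∑ s, C t s * g' s) - τ| ≤ |F (∑ s, C t s * g s) - τ| + B * |e| := by
      have h4 := abs_sub_le (F (∑ s, C t s * g' s)) (F (∑ s, C t s * g s)) τ
      have h5 : B * (C t r * |e|) ≤ B * |e| := mul_le_mul_of_nonneg_left
        (mul_le_of_le_one_left (abs_nonneg _) hC1) hB.le
      linarith
    have h6 : ((if Y t < ∑ s, C t s * g' s then (1 : ℝ) else 0) - τ) * -(C t r * e) =
        -e * score φ r g' (C t) (Y t) + -(C t r * e) * (F (∑ s, C t s * g' s) - τ) := by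
      simp only [score, ← hF]; ring
    rw [h6]
    have h7 : -(C t r * e) * (F (∑ s, C t s * g' s) - τ) ≤
        |e| * |F (∑ s, C t s * g' s) - τ| := by
      refine (le_abs_self _).trans ?_
      rw [abs_mul, abs_neg, abs_mul, abs_of_nonneg hC0]
      exact mul_le_mul_of_nonneg_right (mul_le_of_le_one_left (abs_nonneg _) hC1) (abs_nonneg _)
    have h8 := mul_le_mul_of_nonneg_left h3 (abs_nonneg e)
    linarith
  have h2 := Finset.sum_le_sum h1
  rw [Finset.sum_add_distrib, ← Finset.mul_sum, ← Finset.mul_sum, Finset.sum_add_distrib,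
    Finset.sum_const, Nat.card_Icc, nsmul_eq_mul, Nat.add_sub_cancel] at h2
  have h3 : -e * ∑ t ∈ Finset.Icc 1 T, score φ r g' (C t) (Y t) ≤ |e| * (K * √T) := by
    refine (le_abs_self _).trans ?_
    rw [abs_mul, abs_neg]
    exact mul_le_mul_of_nonneg_left (h.empirical r g' hg) (abs_nonneg _)
  rw [lossAt, lossAt, ← Finset.sum_sub_distrib]
  refine h2.trans ?_
  rw [mul_add, mul_add] at *
  nlinarith

/-- The stochastic error at one quantile level is absorbed by the excess loss, except at the extreme
quantile levels. -/
theorem mul_dev_le (h : RegularPath φ B c M K κ T C Y) (hτ : τ ∈ Icc (0 : ℝ) 1)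
    (hg : ∀ r, |g r| ≤ M) (hT : 1 ≤ T) :
    K * √T * dev φ τ g ≤ 1 / 2 * excess φ T C τ g + 2 * K ^ 2 / (κ * c) +
      if min τ (1 - τ) < 8 * K / (κ * √T) then 2 * Fintype.card ι * M * (K * √T) else 0 := by
  have h1 := h.le_excess hτ g
  have hN0 := dev_nonneg φ τ g
  have hN1 := h.dev_le hτ hg
  have hK := h.K_nonneg
  have hκ := h.κ_pos
  have hc := h.c_pos
  set N := dev φ τ g with hN
  have hT0 : (0 : ℝ) < T := by exact_mod_cast hT
  have hs0 : 0 < √(T : ℝ) := Real.sqrt_pos.2 hT0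
  have hss : √(T : ℝ) * √(T : ℝ) = T := Real.mul_self_sqrt hT0.le
  have hlast : 0 ≤ (if min τ (1 - τ) < 8 * K / (κ * √T) then
      2 * Fintype.card ι * M * (K * √T) else 0 : ℝ) := by
    have hM := h.M_pos
    split_ifs
    · positivity
    · exact le_rfl
  have hmid : 0 ≤ 2 * K ^ 2 / (κ * c) := by positivity
  rcases min_choice (c * N ^ 2) (min τ (1 - τ) * N) with hmin | hmin
  · rw [hmin] at h1
    have h2 : K * √T * N ≤ κ * c / 8 * (T * N ^ 2) + 2 * K ^ 2 / (κ * c) := by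
      have h3 : 2 * K ^ 2 / (κ * c) * (κ * c) = 2 * K ^ 2 := by field_simp
      have h4 : 0 < κ * c := by positivity
      refine le_of_mul_le_mul_right ?_ h4
      have h5 : (√(T : ℝ) * N) ^ 2 = T * N ^ 2 := by rw [mul_pow, sq, hss]
      rw [add_mul, h3, ← h5]
      nlinarith [sq_nonneg (κ * c * (√(T : ℝ) * N) - 4 * K)]
    nlinarith
  · rw [hmin] at h1
    have hτ' : 0 ≤ min τ (1 - τ) := le_min hτ.1 (by linarith [hτ.2])
    split_ifs with hlt
    · have h2 : K * √T * N ≤ 2 * Fintype.card ι * M * (K * √T) := by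
        rw [mul_comm]; exact mul_le_mul_of_nonneg_right hN1 (by positivity)
      have h3 := h.excess_nonneg hτ g
      linarith
    · rw [not_lt, div_le_iff₀ (by positivity)] at hlt
      have h2 : 8 * K * √T ≤ min τ (1 - τ) * κ * T := by
        have h3 := mul_le_mul_of_nonneg_right hlt hs0.le
        have h5 : min τ (1 - τ) * (κ * √(T : ℝ)) * √(T : ℝ) = min τ (1 - τ) * κ * T := by
          linear_combination min τ (1 - τ) * κ * hss
        rwa [h5] at h3
      have h3 := mul_le_mul_of_nonneg_right h2 hN0
      nlinarith

end RegularPath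

end Level

section Grid

theorem grid_mem {L ℓ : ℕ} (hℓ : ℓ ∈ Finset.Icc 1 L) : grid L ℓ ∈ Icc (0 : ℝ) 1 := by
  have h1 : (ℓ : ℝ) ≤ L := by exact_mod_cast (Finset.mem_Icc.1 hℓ).2
  refine ⟨by unfold grid; positivity, ?_⟩
  rw [grid, div_le_one (by positivity)]
  linarith

/-- The number of extreme quantile levels. -/
theorem sum_extreme_le {L : ℕ} (hL : 1 ≤ L) {x : ℝ} (hx : 0 ≤ x) :
    ∑ ℓ ∈ Finset.Icc 1 L, (if min (grid L ℓ) (1 - grid L ℓ) < x then (1 : ℝ) else 0) ≤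
      4 * x * L := by
  have hL' : (1 : ℝ) ≤ L := by exact_mod_cast hL
  have hL0 : (0 : ℝ) < 1 + L := by linarith
  have key : ∀ S : Finset ℕ, S ⊆ Finset.Icc 1 ⌊x * (1 + L)⌋₊ → (S.card : ℝ) ≤ 2 * x * L := by
    intro S hS
    have h1 : S.card ≤ ⌊x * (1 + L)⌋₊ := by simpa using Finset.card_le_card hS
    have h2 : (S.card : ℝ) ≤ x * (1 + L) :=
      (Nat.cast_le.2 h1).trans (Nat.floor_le (by positivity))
    nlinarith
  have h1 : ∑ ℓ ∈ Finset.Icc 1 L, (if grid L ℓ < x then (1 : ℝ) else 0) ≤ 2 * x * L := by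
    rw [Finset.sum_boole]
    refine key _ fun ℓ hℓ => ?_
    obtain ⟨h2, h3⟩ := Finset.mem_filter.1 hℓ
    rw [grid, div_lt_iff₀ hL0] at h3
    exact Finset.mem_Icc.2 ⟨(Finset.mem_Icc.1 h2).1, Nat.le_floor h3.le⟩
  have h2 : ∑ ℓ ∈ Finset.Icc 1 L, (if 1 - grid L ℓ < x then (1 : ℝ) else 0) ≤ 2 * x * L := by
    rw [Finset.sum_boole, ← Finset.card_image_of_injOn (f := fun ℓ => L + 1 - ℓ)]
    · refine key _ fun m hm => ?_
      obtain ⟨ℓ, hℓ, rfl⟩ := Finset.mem_image.1 hm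
      obtain ⟨h2, h3⟩ := Finset.mem_filter.1 hℓ
      obtain ⟨h4, h5⟩ := Finset.mem_Icc.1 h2
      rw [grid, sub_lt_iff_lt_add, ← sub_lt_iff_lt_add', lt_div_iff₀ hL0] at h3
      refine Finset.mem_Icc.2 ⟨by omega, Nat.le_floor ?_⟩
      rw [Nat.cast_sub (by omega)]
      push_cast
      linarith
    · intro ℓ hℓ ℓ' hℓ' heq
      have h2 := Finset.mem_Icc.1 (Finset.mem_filter.1 (Finset.mem_coe.1 hℓ)).1
      have h3 := Finset.mem_Icc.1 (Finset.mem_filter.1 (Finset.mem_coe.1 hℓ')).1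
      simp only at heq
      omega
  have h3 : ∀ ℓ ∈ Finset.Icc 1 L, (if min (grid L ℓ) (1 - grid L ℓ) < x then (1 : ℝ) else 0) ≤
      (if grid L ℓ < x then (1 : ℝ) else 0) + if 1 - grid L ℓ < x then (1 : ℝ) else 0 := by
    intro ℓ _
    by_cases ha : grid L ℓ < x <;> by_cases hb : 1 - grid L ℓ < x <;> simp [ha, hb]
  refine (Finset.sum_le_sum h3).trans ?_
  rw [Finset.sum_add_distrib]
  linarith

end Grid

section Scad

variable {a lam x : ℝ}

theorem scad_zero (hlam : 0 < lam) : scad a lam 0 = 0 := by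
  rw [scad, if_pos hlam.le, mul_zero]

theorem scad_of_le (hx : x ≤ lam) : scad a lam x = lam * x := if_pos hx

theorem scad_of_gt (ha : 1 < a) (hlam : 0 < lam) (hx : a * lam < x) :
    scad a lam x = (a + 1) * lam ^ 2 / 2 := by
  rw [scad, if_neg (by nlinarith), if_neg (not_le.2 hx)]

theorem scad_le (ha : 1 < a) (hlam : 0 < lam) (x : ℝ) : scad a lam x ≤ (a + 1) * lam ^ 2 / 2 := by
  rw [scad]
  split_ifs with h1 h2
  · nlinarith [sq_nonneg lam]
  · rw [div_le_div_iff₀ (by linarith) two_pos]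
    nlinarith [sq_nonneg (x - a * lam)]
  · exact le_rfl

theorem mul_min_le_scad (ha : 1 < a) (x : ℝ) :
    lam * min x lam ≤ scad a lam x := by
  rw [scad]
  split_ifs with h1 h2
  · rw [min_eq_left h1]
  · rw [min_eq_right (not_le.1 h1).le, le_div_iff₀ (by linarith)]
    nlinarith [mul_nonneg (sub_nonneg.2 (not_le.1 h1).le)
      (sub_nonneg.2 (h2.trans (by nlinarith : a * lam ≤ (2 * a - 1) * lam)))]
  · rw [min_eq_right (not_le.1 h1).le]
    nlinarith [sq_nonneg lam]

theorem scad_nonneg (ha : 1 < a) (hlam : 0 < lam) (hx : 0 ≤ x) : 0 ≤ scad a lam x :=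
  (mul_nonneg hlam.le (le_min hx hlam.le)).trans (mul_min_le_scad ha x)

end Scad

section Levels

variable {ι : Type*} [Fintype ι] {φ : ι → ℝ → ℝ} {B c M K κ : ℝ} {T L : ℕ} {C : ℕ → ι → ℝ}
  {Y : ℕ → ℝ} {g g' : ℕ → ι → ℝ}

namespace RegularPath

theorem lossAt_sub_le_of_close (h : RegularPath φ B c M K κ T C Y) {τ : ℝ}
    (hτ : τ ∈ Icc (0 : ℝ) 1) (hT : 1 ≤ T) {g : ι → ℝ} (hg : ∀ r, |g r| ≤ M) {ρ R : ℝ}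
    (hρ : ρ ≤ R / √T) (hclose : ∀ r, |g r - φ r τ| ≤ ρ) :
    lossAt T C Y τ g - lossAt T C Y τ (fun r => φ r τ) ≤
      B * (Fintype.card ι * R) ^ 2 + K * (Fintype.card ι * R) := by
  have hT0 : (0 : ℝ) < T := by exact_mod_cast hT
  have hs0 : 0 < √(T : ℝ) := Real.sqrt_pos.2 hT0
  have hss : √(T : ℝ) * √(T : ℝ) = T := Real.mul_self_sqrt hT0.le
  have hN : dev φ τ g * √T ≤ Fintype.card ι * R := by
    rw [le_div_iff₀ hs0] at hρ
    have h1 := mul_le_mul_of_nonneg_right (dev_le_of_abs_le hclose) hs0.le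
    rw [mul_assoc] at h1
    exact h1.trans (mul_le_mul_of_nonneg_left hρ (Nat.cast_nonneg _))
  have hN0 : 0 ≤ dev φ τ g * √T := mul_nonneg (dev_nonneg φ τ g) hs0.le
  have h1 := (abs_le.1 (h.abs_lossAt_sub_sub_excess_le hτ hg)).2
  have h2 := h.excess_le hτ g
  have h3 : (T : ℝ) * (B * dev φ τ g ^ 2) ≤ B * (Fintype.card ι * R) ^ 2 := by
    have e : (T : ℝ) * (B * dev φ τ g ^ 2) = B * (dev φ τ g * √T) ^ 2 := by
      rw [mul_pow, sq (√(T : ℝ)), hss]; ring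
    rw [e]
    exact mul_le_mul_of_nonneg_left (pow_le_pow_left₀ hN0 hN 2) h.B_pos.le
  have h4 : K * √T * dev φ τ g ≤ K * (Fintype.card ι * R) := by
    rw [mul_assoc, mul_comm (√(T : ℝ))]
    exact mul_le_mul_of_nonneg_left hN h.K_nonneg
  linarith

/-- The basic inequality, summed over the quantile levels. -/
theorem half_sum_excess_le (h : RegularPath φ B c M K κ T C Y) (hT : 1 ≤ T) (hL : 1 ≤ L)
    (hg : ∀ ℓ ∈ Finset.Icc 1 L, ∀ r, |g ℓ r| ≤ M) (hg' : ∀ ℓ ∈ Finset.Icc 1 L, ∀ r, |g' ℓ r| ≤ M)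
    {ρ R D : ℝ} (hρ : ρ ≤ R / √T)
    (hclose : ∀ ℓ ∈ Finset.Icc 1 L, ∀ r, |g' ℓ r - φ r (grid L ℓ)| ≤ ρ)
    (hD : 2 * K ^ 2 / (κ * c) + 64 * Fintype.card ι * M * K ^ 2 / κ +
      (B * (Fintype.card ι * R) ^ 2 + K * (Fintype.card ι * R)) ≤ D) :
    1 / 2 * ∑ ℓ ∈ Finset.Icc 1 L, excess φ T C (grid L ℓ) (g ℓ) ≤
      ∑ ℓ ∈ Finset.Icc 1 L, lossAt T C Y (grid L ℓ) (g ℓ) -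
        ∑ ℓ ∈ Finset.Icc 1 L, lossAt T C Y (grid L ℓ) (g' ℓ) + L * D := by
  have hT0 : (0 : ℝ) < T := by exact_mod_cast hT
  have hs0 : 0 < √(T : ℝ) := Real.sqrt_pos.2 hT0
  have hκ := h.κ_pos
  have hK := h.K_nonneg
  have hM := h.M_pos
  set x := 8 * K / (κ * √T) with hx
  set Q := 2 * Fintype.card ι * M * (K * √T) with hQ
  have hQ0 : 0 ≤ Q := by positivity
  have h1 : ∀ ℓ ∈ Finset.Icc 1 L, 1 / 2 * excess φ T C (grid L ℓ) (g ℓ) ≤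
      lossAt T C Y (grid L ℓ) (g ℓ) - lossAt T C Y (grid L ℓ) (g' ℓ) +
        (2 * K ^ 2 / (κ * c) + (B * (Fintype.card ι * R) ^ 2 + K * (Fintype.card ι * R))) +
        Q * (if min (grid L ℓ) (1 - grid L ℓ) < x then 1 else 0) := by
    intro ℓ hℓ
    have h2 := (abs_le.1 (h.abs_lossAt_sub_sub_excess_le (grid_mem hℓ) (hg ℓ hℓ))).1
    have h3 := h.mul_dev_le (grid_mem hℓ) (hg ℓ hℓ) hT
    have h4 := h.lossAt_sub_le_of_close (grid_mem hℓ) hT (hg' ℓ hℓ) hρ (hclose ℓ hℓ)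
    rw [mul_ite, mul_one, mul_zero]
    linarith
  have h2 := Finset.sum_le_sum h1
  rw [← Finset.mul_sum, Finset.sum_add_distrib, Finset.sum_add_distrib, Finset.sum_sub_distrib,
    Finset.sum_const, Nat.card_Icc, nsmul_eq_mul, Nat.add_sub_cancel, ← Finset.mul_sum] at h2
  have h3 := mul_le_mul_of_nonneg_left (sum_extreme_le hL (by positivity : 0 ≤ x)) hQ0
  have h4 : Q * (4 * x * L) = L * (64 * Fintype.card ι * M * K ^ 2 / κ) := by
    rw [hQ, hx]; field_simp; ring
  have h5 := mul_le_mul_of_nonneg_left hD (Nat.cast_nonneg (α := ℝ) L)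
  linarith

theorem sum_dev_sq_le (h : RegularPath φ B c M K κ T C Y) (hT : 1 ≤ T) (hL : 1 ≤ L)
    (hg : ∀ ℓ ∈ Finset.Icc 1 L, ∀ r, |g ℓ r| ≤ M) {η : ℝ} (hη : 0 < η) :
    ∑ ℓ ∈ Finset.Icc 1 L, dev φ (grid L ℓ) (g ℓ) ^ 2 ≤
      (1 / c + 2 * Fintype.card ι * M / η) * (4 / (κ * T) *
        ∑ ℓ ∈ Finset.Icc 1 L, excess φ T C (grid L ℓ) (g ℓ)) +
      (2 * Fintype.card ι * M) ^ 2 * (4 * η * L) := by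
  have hT0 : (0 : ℝ) < T := by exact_mod_cast hT
  have hκ := h.κ_pos
  have hM := h.M_pos
  have hc := h.c_pos
  set A := 2 * Fintype.card ι * M with hA
  have hA0 : 0 ≤ A := by positivity
  have h1 : ∀ ℓ ∈ Finset.Icc 1 L, dev φ (grid L ℓ) (g ℓ) ^ 2 ≤
      (1 / c + A / η) * (4 / (κ * T) * excess φ T C (grid L ℓ) (g ℓ)) +
        A ^ 2 * (if min (grid L ℓ) (1 - grid L ℓ) < η then 1 else 0) := by
    intro ℓ hℓ
    have hτ := grid_mem hℓ
    have h2 := h.le_excess hτ (g ℓ)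
    have h3 : dev φ (grid L ℓ) (g ℓ) ≤ A := h.dev_le hτ (hg ℓ hℓ)
    have h4 := dev_nonneg φ (grid L ℓ) (g ℓ)
    have h5 := h.excess_nonneg hτ (g ℓ)
    set τ := grid L ℓ
    set N := dev φ τ (g ℓ)
    set m := min (c * N ^ 2) (min τ (1 - τ) * N) with hm
    have h6 : m ≤ 4 / (κ * T) * excess φ T C τ (g ℓ) := by
      rw [div_mul_eq_mul_div, le_div_iff₀ (by positivity)]
      linarith
    have hm0 : 0 ≤ m :=
      le_min (by positivity) (mul_nonneg (le_min hτ.1 (by linarith [hτ.2])) h4)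
    by_cases hlt : min τ (1 - τ) < η
    · rw [if_pos hlt, mul_one]
      have h7 := pow_le_pow_left₀ h4 h3 2
      have h8 : 0 ≤ (1 / c + A / η) * (4 / (κ * T) * excess φ T C τ (g ℓ)) := by positivity
      linarith
    · rw [if_neg hlt, mul_zero, add_zero]
      refine le_trans ?_ (mul_le_mul_of_nonneg_left h6 (by positivity))
      rw [add_mul]
      rcases min_choice (c * N ^ 2) (min τ (1 - τ) * N) with hmin | hmin
      · have h7 : N ^ 2 = 1 / c * m := by rw [hm, hmin]; field_simp
        have h8 : 0 ≤ A / η * m := by positivity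
        linarith
      · have h7 : N ^ 2 ≤ A / η * m := by
          rw [hm, hmin, div_mul_eq_mul_div, le_div_iff₀ hη]
          have h8 := mul_le_mul_of_nonneg_right (not_lt.1 hlt) h4
          have h9 := mul_le_mul h3 h8 (by positivity) hA0
          linarith
        have h8 : 0 ≤ 1 / c * m := by positivity
        linarith
  have h2 := Finset.sum_le_sum h1
  rw [Finset.sum_add_distrib, ← Finset.mul_sum, ← Finset.mul_sum, ← Finset.mul_sum] at h2
  have h3 := mul_le_mul_of_nonneg_left (sum_extreme_le hL hη.le) (sq_nonneg A)
  linarith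

/-- If the excess loss is of order one, then moving one coefficient by an amount of order `x`
changes the loss by at most a multiple of `x √T`. -/
theorem sum_lossAt_update_sub_le [DecidableEq ι] (h : RegularPath φ B c M K κ T C Y) (hT : 1 ≤ T)
    (r : ι) {e : ℕ → ℝ} (hg : ∀ ℓ ∈ Finset.Icc 1 L, ∀ s,
      |Function.update (g ℓ) r (g ℓ r - e ℓ) s| ≤ M) {x A D : ℝ} (hx : 0 < x) (hx' : x * √T ≤ 1)
    (hA : 0 ≤ A) (he : ∑ ℓ ∈ Finset.Icc 1 L, e ℓ ^ 2 ≤ L * (A * x ^ 2))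
    (hE : ∑ ℓ ∈ Finset.Icc 1 L, excess φ T C (grid L ℓ) (g ℓ) ≤ 2 * (L * D)) :
    ∑ ℓ ∈ Finset.Icc 1 L, lossAt T C Y (grid L ℓ) (Function.update (g ℓ) r (g ℓ r - e ℓ)) -
      ∑ ℓ ∈ Finset.Icc 1 L, lossAt T C Y (grid L ℓ) (g ℓ) ≤
      L * (x * √T * (1 / 2 * K * (A + 1) + 1 / 2 * (A + 8 * B * D) + B * A)) := by
  have hT0 : (0 : ℝ) < T := by exact_mod_cast hT
  have hs0 : 0 < √(T : ℝ) := Real.sqrt_pos.2 hT0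
  have hss : √(T : ℝ) * √(T : ℝ) = T := Real.mul_self_sqrt hT0.le
  have hK := h.K_nonneg
  have hB := h.B_pos
  set s := √(T : ℝ) with hs
  have h1 : ∀ ℓ ∈ Finset.Icc 1 L,
      lossAt T C Y (grid L ℓ) (Function.update (g ℓ) r (g ℓ r - e ℓ)) -
        lossAt T C Y (grid L ℓ) (g ℓ) ≤
      (1 / 2 * K * s / x + 1 / 2 * s / x + T * B) * e ℓ ^ 2 + 1 / 2 * K * s * x +
        1 / 2 * x * s * (4 * B) * excess φ T C (grid L ℓ) (g ℓ) := by
    intro ℓ hℓ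
    refine (h.lossAt_update_sub_le r (e ℓ) (hg ℓ hℓ)).trans ?_
    rw [← hs]
    have h2 := h.sum_sq_le_excess (grid_mem hℓ) (g ℓ)
    set S := ∑ t ∈ Finset.Icc 1 T, |levelCdf (mix φ (C t)) (∑ s, C t s * g ℓ s) - grid L ℓ| with hS
    have h3 : S ^ 2 ≤ T * (4 * B * excess φ T C (grid L ℓ) (g ℓ)) := by
      have h4 := sq_sum_le_card_mul_sum_sq (s := Finset.Icc 1 T)
        (f := fun t => |levelCdf (mix φ (C t)) (∑ s, C t s * g ℓ s) - grid L ℓ|)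
      simp only [sq_abs, Nat.card_Icc, Nat.add_sub_cancel] at h4
      exact h4.trans (mul_le_mul_of_nonneg_left h2 hT0.le)
    set E := excess φ T C (grid L ℓ) (g ℓ)
    have h4 : |e ℓ| ≤ 1 / 2 * (e ℓ ^ 2 / x + x) := by
      have h5 : e ℓ ^ 2 / x + x = (|e ℓ| ^ 2 + x ^ 2) / x := by rw [sq_abs]; field_simp
      rw [h5, ← mul_div_assoc, le_div_iff₀ hx]
      nlinarith [sq_nonneg (|e ℓ| - x)]
    have h5 : |e ℓ| * S ≤ 1 / 2 * s / x * e ℓ ^ 2 + 1 / 2 * x * s * (4 * B) * E := by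
      have h6 : |e ℓ| * S ≤ 1 / 2 * s / x * e ℓ ^ 2 + 1 / 2 * x / s * S ^ 2 := by
        have h7 : 1 / 2 * s / x * e ℓ ^ 2 + 1 / 2 * x / s * S ^ 2 - |e ℓ| * S =
            1 / 2 * (s * |e ℓ| - x * S) ^ 2 / (x * s) := by
          rw [← sq_abs (e ℓ)]
          field_simp
          ring
        have h8 : 0 ≤ 1 / 2 * (s * |e ℓ| - x * S) ^ 2 / (x * s) := by positivity
        linarith
      have h7 := mul_le_mul_of_nonneg_left h3 (by positivity : 0 ≤ 1 / 2 * x / s)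
      have h8 : 1 / 2 * x / s * (T * (4 * B * E)) = 1 / 2 * x * s * (4 * B) * E := by
        rw [← hss]; field_simp
      linarith
    have h6 : |e ℓ| * (K * s) ≤ 1 / 2 * K * s / x * e ℓ ^ 2 + 1 / 2 * K * s * x := by
      refine (mul_le_mul_of_nonneg_right h4 (by positivity)).trans (le_of_eq ?_)
      ring
    have h7 : |e ℓ| * (T * (B * |e ℓ|)) = T * B * e ℓ ^ 2 := by
      rw [← sq_abs]; ring
    linarith
  have h2 := Finset.sum_le_sum h1
  rw [Finset.sum_sub_distrib, Finset.sum_add_distrib, Finset.sum_add_distrib, ← Finset.mul_sum,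
    Finset.sum_const, Nat.card_Icc, nsmul_eq_mul, Nat.add_sub_cancel, ← Finset.mul_sum] at h2
  have h3 := mul_le_mul_of_nonneg_left he
    (by positivity : 0 ≤ 1 / 2 * K * s / x + 1 / 2 * s / x + T * B)
  have h4 := mul_le_mul_of_nonneg_left hE (by positivity : 0 ≤ 1 / 2 * x * s * (4 * B))
  have h5 : (1 / 2 * K * s / x + 1 / 2 * s / x + T * B) * (L * (A * x ^ 2)) =
      L * (x * s * (1 / 2 * K * A + 1 / 2 * A) + B * A * (x * s) * (x * s)) := by
    rw [← hss]; field_simp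
  have h6 : B * A * (x * s) * (x * s) ≤ B * A * (x * s) :=
    mul_le_of_le_one_right (by positivity) hx'
  have h7 := mul_le_mul_of_nonneg_left h6 (Nat.cast_nonneg (α := ℝ) L)
  linarith

end RegularPath

end Levels

section Selection

variable {n p H L T : ℕ} {φ : Idx n p → ℝ → ℝ} {B c M K κ : ℝ} {C : ℕ → Idx n p → ℝ} {Y : ℕ → ℝ}
  {b : ℕ → ℝ → ℝ} {a lam : ℝ}

/-- The criterion in terms of the weights `C_t`. -/
noncomputable def criterion (b : ℕ → ℝ → ℝ) (a lam : ℝ) (L T : ℕ) (C : ℕ → Idx n p → ℝ)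
    (Y : ℕ → ℝ) (γ : Idx n p → Fin H → ℝ) : ℝ :=
  1 / ((L : ℝ) * T) * ∑ ℓ ∈ Finset.Icc 1 L,
    lossAt T C Y (grid L ℓ) (fun r => series b (γ r) (grid L ℓ)) + penalty b a lam γ

theorem objective_eq_criterion {Ω : Type*} (lb ub : Fin n → ℝ) (y : ℤ → Ω → Fin n → ℝ) (i : Fin n)
    (ω : Ω) (γ : Idx n p → Fin H → ℝ) :
    objective lb ub y i b a lam L T H ω γ =
      criterion b a lam L T (fun t => coord lb ub y t ω) (fun t => y t ω i) γ := by
  have h : ∀ (t : ℕ) (τ : ℝ), ∑ q : Idx n p × Fin H, xi lb ub y b H t ω τ q * γ q.1 q.2 =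
      ∑ r, coord lb ub y t ω r * series b (γ r) τ := by
    intro t τ
    rw [Fintype.sum_prod_type]
    simp only [xi, series, Finset.mul_sum, mul_assoc]
  simp only [objective, criterion, lossAt, h]

theorem penalty_nonneg (ha : 1 < a) (hlam : 0 < lam) (γ : Idx n p → Fin H → ℝ) :
    0 ≤ penalty b a lam γ :=
  Finset.sum_nonneg fun _ _ => scad_nonneg ha hlam (l2norm_nonneg _)

theorem penalty_le (ha : 1 < a) (hlam : 0 < lam) (γ : Idx n p → Fin H → ℝ) :
    penalty b a lam γ ≤ Fintype.card (Fin n × Fin p) * ((a + 1) * lam ^ 2 / 2) := by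
  refine (Finset.sum_le_sum fun q _ => scad_le ha hlam _).trans (le_of_eq ?_)
  rw [Finset.sum_const, Finset.card_univ, nsmul_eq_mul]

/-- If the penalties of the nonzero coefficients have reached their maximum, then each penalty of a
zero coefficient is at most the increase of the total penalty. -/
theorem scad_le_penalty_sub (ha : 1 < a) (hlam : 0 < lam) {γ γ' : Idx n p → Fin H → ℝ}
    (hsplit : ∀ q : Fin n × Fin p, l2norm (series b (γ' (some q) - γ' none)) = 0 ∨
      a * lam < l2norm (series b (γ (some q) - γ none)))
    {q : Fin n × Fin p} (hq : l2norm (series b (γ' (some q) - γ' none)) = 0) :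
    scad a lam (l2norm (series b (γ (some q) - γ none))) ≤
      penalty b a lam γ - penalty b a lam γ' := by
  rw [penalty, penalty, ← Finset.sum_sub_distrib]
  have h1 : ∀ q : Fin n × Fin p, 0 ≤ scad a lam (l2norm (series b (γ (some q) - γ none))) -
      scad a lam (l2norm (series b (γ' (some q) - γ' none))) := by
    intro q
    rcases hsplit q with h | h
    · rw [h, scad_zero hlam, sub_zero]
      exact scad_nonneg ha hlam (l2norm_nonneg _)
    · rw [scad_of_gt ha hlam h]
      exact sub_nonneg.2 (scad_le ha hlam _)
  refine le_trans (le_of_eq ?_)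
    (Finset.single_le_sum (f := fun q => scad a lam (l2norm (series b (γ (some q) - γ none))) -
      scad a lam (l2norm (series b (γ' (some q) - γ' none)))) (fun q _ => h1 q) (Finset.mem_univ q))
  rw [hq, scad_zero hlam, sub_zero]

/-- Passing from a function to nearby functions changes the squared norm of a difference by at most
the squared errors. -/
theorem l2norm_sq_sub_le {f₁ f₂ : ℝ → ℝ} {γ₁ γ₂ δ₁ δ₂ : Fin H → ℝ}
    (hb : ∀ h, ContinuousOn (b h) (Icc 0 1)) (hf₁ : ContinuousOn f₁ (Icc 0 1))
    (hf₂ : ContinuousOn f₂ (Icc 0 1)) {ρ : ℝ}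
    (h₁ : ∀ u ∈ Icc (0 : ℝ) 1, |f₁ u - series b δ₁ u| ≤ ρ)
    (h₂ : ∀ u ∈ Icc (0 : ℝ) 1, |f₂ u - series b δ₂ u| ≤ ρ) :
    l2norm (fun u => f₁ u - f₂ u) ^ 2 ≤ 5 * (l2norm (series b (γ₁ - γ₂)) ^ 2 +
      l2norm (series b (γ₁ - δ₁)) ^ 2 + l2norm (series b (γ₂ - δ₂)) ^ 2 + 2 * ρ ^ 2) := by
  simp only [l2norm_sq]
  have hi : ∀ w : Fin H → ℝ, IntervalIntegrable (fun u => series b w u ^ 2) volume 0 1 := fun w =>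
    intervalIntegrable_of_continuousOn_unit ((continuousOn_series hb w).pow 2)
  have h3 : ∫ u in (0 : ℝ)..1, (series b (γ₁ - γ₂) u ^ 2 + series b (γ₁ - δ₁) u ^ 2 +
      series b (γ₂ - δ₂) u ^ 2 + 2 * ρ ^ 2) =
      (∫ u in (0 : ℝ)..1, series b (γ₁ - γ₂) u ^ 2) + (∫ u in (0 : ℝ)..1, series b (γ₁ - δ₁) u ^ 2) +
      (∫ u in (0 : ℝ)..1, series b (γ₂ - δ₂) u ^ 2) + 2 * ρ ^ 2 := by
    rw [intervalIntegral.integral_add (((hi _).add (hi _)).add (hi _)) (by simp),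
      intervalIntegral.integral_add ((hi _).add (hi _)) (hi _),
      intervalIntegral.integral_add (hi _) (hi _)]
    simp
  rw [← h3, ← intervalIntegral.integral_const_mul]
  refine intervalIntegral.integral_mono_on zero_le_one
    (intervalIntegrable_of_continuousOn_unit ((hf₁.sub hf₂).pow 2))
    (((((hi _).add (hi _)).add (hi _)).add (by simp)).const_mul _) fun u hu => ?_
  have e₁ : (f₁ u - series b δ₁ u) ^ 2 ≤ ρ ^ 2 := by
    rw [← sq_abs]; exact pow_le_pow_left₀ (abs_nonneg _) (h₁ u hu) 2
  have e₂ : (f₂ u - series b δ₂ u) ^ 2 ≤ ρ ^ 2 := by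
    rw [← sq_abs]; exact pow_le_pow_left₀ (abs_nonneg _) (h₂ u hu) 2
  simp only [series_sub]
  set x₁ := series b γ₁ u - series b γ₂ u
  set x₂ := series b γ₁ u - series b δ₁ u with hx₂
  set x₃ := series b γ₂ u - series b δ₂ u with hx₃
  set x₄ := f₁ u - series b δ₁ u with hx₄
  set x₅ := f₂ u - series b δ₂ u with hx₅
  have e : f₁ u - f₂ u = x₁ - x₂ + x₃ + x₄ - x₅ := by
    simp only [x₁, hx₂, hx₃, hx₄, hx₅]; ring
  rw [e]
  nlinarith [sq_nonneg (x₁ + x₂), sq_nonneg (x₁ - x₃), sq_nonneg (x₁ - x₄), sq_nonneg (x₁ + x₅),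
    sq_nonneg (x₂ + x₃), sq_nonneg (x₂ + x₄), sq_nonneg (x₂ - x₅), sq_nonneg (x₃ - x₄),
    sq_nonneg (x₃ + x₅), sq_nonneg (x₄ + x₅)]

/-- The estimated coefficient functions are close to the approximating ones if the deviations at the
grid points are small on average. -/
theorem sum_sq_sub_le {c₁ σ ρ : ℝ} (hc₁ : 0 < c₁) (hL : 1 ≤ L) {γ γ' : Idx n p → Fin H → ℝ}
    (hdes : ∀ w : Fin H → ℝ, c₁ * ∑ h, w h ^ 2 ≤
      1 / (L : ℝ) * ∑ ℓ ∈ Finset.Icc 1 L, series b w (grid L ℓ) ^ 2)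
    (happ : ∀ r, ∀ u ∈ Icc (0 : ℝ) 1, |φ r u - series b (γ' r) u| ≤ ρ)
    (hdev : ∑ ℓ ∈ Finset.Icc 1 L,
      dev φ (grid L ℓ) (fun r => series b (γ r) (grid L ℓ)) ^ 2 ≤ L * σ) (r : Idx n p) :
    ∑ h, (γ r - γ' r) h ^ 2 ≤ 2 / c₁ * (σ + ρ ^ 2) := by
  have hL0 : (0 : ℝ) < L := by exact_mod_cast hL
  have h1 : ∀ ℓ ∈ Finset.Icc 1 L, series b (γ r - γ' r) (grid L ℓ) ^ 2 ≤
      2 * dev φ (grid L ℓ) (fun r => series b (γ r) (grid L ℓ)) ^ 2 + 2 * ρ ^ 2 := by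
    intro ℓ hℓ
    rw [series_sub]
    have h2 := abs_sub_le_dev φ (grid L ℓ) (fun r => series b (γ r) (grid L ℓ)) r
    have h3 := happ r _ (grid_mem hℓ)
    have h4 := pow_le_pow_left₀ (abs_nonneg _) h2 2
    have h5 := pow_le_pow_left₀ (abs_nonneg _) h3 2
    rw [sq_abs] at h4 h5
    nlinarith [sq_nonneg ((series b (γ r) (grid L ℓ) - φ r (grid L ℓ)) -
      (φ r (grid L ℓ) - series b (γ' r) (grid L ℓ)))]
  have h2 := Finset.sum_le_sum h1
  rw [Finset.sum_add_distrib, ← Finset.mul_sum, Finset.sum_const, Nat.card_Icc, nsmul_eq_mul,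
    Nat.add_sub_cancel] at h2
  have h3 := hdes (γ r - γ' r)
  rw [one_div_mul_eq_div, le_div_iff₀ hL0] at h3
  rw [div_mul_eq_mul_div, le_div_iff₀ hc₁]
  refine le_of_mul_le_mul_right ?_ hL0
  linarith

set_option maxHeartbeats 800000 in
/-- Model selection on a regular sample path: a minimizer of the criterion sets the coefficients
that are zero in the approximating model to zero. -/
theorem RegularPath.l2norm_eq_zero (h : RegularPath φ B c M K κ T C Y) (hT : 1 ≤ T) (hL : 1 ≤ L)
    (hb : ∀ h, ContinuousOn (b h) (Icc 0 1)) (hφ : ∀ r, ContinuousOn (φ r) (Icc 0 1))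
    (ha : 1 < a) (hlam : 0 < lam) {Γ : Set (Idx n p → Fin H → ℝ)}
    (hΓM : ∀ γ ∈ Γ, ∀ r, ∀ u ∈ Icc (0 : ℝ) 1, |series b (γ r) u| ≤ M)
    (hΓ : ∀ γ ∈ Γ, ∀ q, Function.update γ (some q) (γ none) ∈ Γ)
    {c₁ C₁ c₂ C₂ : ℝ} (hc₁ : 0 < c₁) (hC₁ : 0 ≤ C₁) (hc₂ : 0 < c₂) (hC₂ : 0 ≤ C₂)
    (hdes : ∀ w : Fin H → ℝ,
      c₁ * ∑ h, w h ^ 2 ≤ 1 / (L : ℝ) * ∑ ℓ ∈ Finset.Icc 1 L, series b w (grid L ℓ) ^ 2 ∧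
      1 / (L : ℝ) * ∑ ℓ ∈ Finset.Icc 1 L, series b w (grid L ℓ) ^ 2 ≤ C₁ * ∑ h, w h ^ 2)
    (hgram : ∀ w : Fin H → ℝ, c₂ * ∑ h, w h ^ 2 ≤ l2norm (series b w) ^ 2 ∧
      l2norm (series b w) ^ 2 ≤ C₂ * ∑ h, w h ^ 2)
    {γ' : Idx n p → Fin H → ℝ} (hγ' : γ' ∈ Γ) {ρ R D σ η s₀ : ℝ} (hρ : ρ ≤ R / √T)
    (happ : ∀ r, ∀ u ∈ Icc (0 : ℝ) 1, |φ r u - series b (γ' r) u| ≤ ρ)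
    (hsplit : ∀ q : Fin n × Fin p, l2norm (series b (γ' (some q) - γ' none)) = 0 ∨
      s₀ ≤ l2norm (fun u => φ (some q) u - φ none u) ^ 2)
    (hD : 2 * K ^ 2 / (κ * c) + 64 * Fintype.card (Idx n p) * M * K ^ 2 / κ +
      (B * (Fintype.card (Idx n p) * R) ^ 2 + K * (Fintype.card (Idx n p) * R)) ≤ D)
    (hη : 0 < η)
    (hσ : (1 / c + 2 * Fintype.card (Idx n p) * M / η) * (8 / κ * (D / T +
        Fintype.card (Fin n × Fin p) * ((a + 1) * lam ^ 2 / 2))) +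
      (2 * Fintype.card (Idx n p) * M) ^ 2 * (4 * η) ≤ σ)
    (hs₀ : 5 * ((a * lam) ^ 2 + 2 * (C₂ * (2 / c₁ * (σ + ρ ^ 2))) + 2 * ρ ^ 2) < s₀)
    (hlam₁ : 1 ≤ lam * √T) (hlam₂ : D < lam * √T)
    (hlam₃ : 1 / 2 * K * (C₁ / c₂ + 1) + 1 / 2 * (C₁ / c₂ + 8 * B * D) + B * (C₁ / c₂) < lam * √T)
    {γ : Idx n p → Fin H → ℝ} (hγ : γ ∈ Γ) (hmin : IsMinOn (criterion b a lam L T C Y) Γ γ)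
    {q : Fin n × Fin p} (hq : l2norm (series b (γ' (some q) - γ' none)) = 0) :
    l2norm (series b (γ (some q) - γ none)) = 0 := by
  have hT0 : (0 : ℝ) < T := by exact_mod_cast hT
  have hL0 : (0 : ℝ) < L := by exact_mod_cast hL
  have hs0 : 0 < √(T : ℝ) := Real.sqrt_pos.2 hT0
  have hss : √(T : ℝ) * √(T : ℝ) = T := Real.mul_self_sqrt hT0.le
  have hκ := h.κ_pos
  have hM := h.M_pos
  have hc := h.c_pos
  set g : ℕ → Idx n p → ℝ := fun ℓ r => series b (γ r) (grid L ℓ) with hg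
  set g' : ℕ → Idx n p → ℝ := fun ℓ r => series b (γ' r) (grid L ℓ) with hg'
  have hgM : ∀ ℓ ∈ Finset.Icc 1 L, ∀ r, |g ℓ r| ≤ M := fun ℓ hℓ r => hΓM γ hγ r _ (grid_mem hℓ)
  have hgM' : ∀ ℓ ∈ Finset.Icc 1 L, ∀ r, |g' ℓ r| ≤ M := fun ℓ hℓ r => hΓM γ' hγ' r _ (grid_mem hℓ)
  -- comparison of criteria, multiplied by `L T`
  have hcomp : ∀ γ₁ ∈ Γ, ∑ ℓ ∈ Finset.Icc 1 L, lossAt T C Y (grid L ℓ) (g ℓ) +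
      L * T * penalty b a lam γ ≤ ∑ ℓ ∈ Finset.Icc 1 L,
        lossAt T C Y (grid L ℓ) (fun r => series b (γ₁ r) (grid L ℓ)) +
      L * T * penalty b a lam γ₁ := by
    intro γ₁ hγ₁
    have h1 : criterion b a lam L T C Y γ ≤ criterion b a lam L T C Y γ₁ := hmin hγ₁
    have h2 := mul_le_mul_of_nonneg_left h1 (by positivity : (0 : ℝ) ≤ L * T)
    have h3 : (L : ℝ) * T * (1 / (L * T)) = 1 := by field_simp
    simp only [criterion, mul_add, ← mul_assoc, h3, one_mul] at h2
    simpa only [mul_assoc] using h2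
  have hbasic := h.half_sum_excess_le hT hL hgM hgM' hρ
    (fun ℓ hℓ r => by rw [abs_sub_comm]; exact happ r _ (grid_mem hℓ)) hD
  have hcomp' := hcomp γ' hγ'
  -- consistency
  have hrough : ∑ ℓ ∈ Finset.Icc 1 L, excess φ T C (grid L ℓ) (g ℓ) ≤
      2 * (L * (D + T * (Fintype.card (Fin n × Fin p) * ((a + 1) * lam ^ 2 / 2)))) := by
    have h1 := mul_le_mul_of_nonneg_left (penalty_le (b := b) ha hlam γ')
      (by positivity : (0 : ℝ) ≤ L * T)
    have h2 := mul_nonneg (by positivity : (0 : ℝ) ≤ L * T) (penalty_nonneg (b := b) ha hlam γ)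
    linarith
  have hdev : ∑ ℓ ∈ Finset.Icc 1 L, dev φ (grid L ℓ) (g ℓ) ^ 2 ≤ L * σ := by
    refine (h.sum_dev_sq_le hT hL hgM hη).trans ?_
    have h1 := mul_le_mul_of_nonneg_left hrough (by positivity : (0 : ℝ) ≤ 4 / (κ * T))
    have h2 := mul_le_mul_of_nonneg_left h1
      (by positivity : (0 : ℝ) ≤ 1 / c + 2 * Fintype.card (Idx n p) * M / η)
    have h3 : 4 / (κ * T) * (2 * (L * (D + T * (Fintype.card (Fin n × Fin p) *
        ((a + 1) * lam ^ 2 / 2))))) = L * (8 / κ * (D / T +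
        Fintype.card (Fin n × Fin p) * ((a + 1) * lam ^ 2 / 2))) := by
      field_simp
      ring
    rw [h3] at h2
    have h4 := mul_le_mul_of_nonneg_left hσ hL0.le
    linarith
  have hclose : ∀ r, l2norm (series b (γ r - γ' r)) ^ 2 ≤ C₂ * (2 / c₁ * (σ + ρ ^ 2)) := fun r =>
    (hgram _).2.trans (mul_le_mul_of_nonneg_left
      (sum_sq_sub_le hc₁ hL (fun w => (hdes w).1) happ hdev r) hC₂)
  have hsplit' : ∀ q : Fin n × Fin p, l2norm (series b (γ' (some q) - γ' none)) = 0 ∨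
      a * lam < l2norm (series b (γ (some q) - γ none)) := by
    intro q
    refine (hsplit q).imp_right fun h1 => ?_
    by_contra hle
    have h2 := pow_le_pow_left₀ (l2norm_nonneg _) (not_lt.1 hle) 2
    have h3 := l2norm_sq_sub_le (γ₁ := γ (some q)) (γ₂ := γ none) hb (hφ (some q)) (hφ none)
      (happ (some q)) (happ none)
    linarith [hclose (some q), hclose none]
  -- fast rate
  have hpen := scad_le_penalty_sub ha hlam hsplit' hq
  set x := l2norm (series b (γ (some q) - γ none)) with hx
  have hx0 : 0 ≤ x := l2norm_nonneg _
  have hscad0 := scad_nonneg (a := a) (lam := lam) ha hlam hx0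
  have hLTs := mul_le_mul_of_nonneg_left hpen (by positivity : (0 : ℝ) ≤ L * T)
  have hE : ∑ ℓ ∈ Finset.Icc 1 L, excess φ T C (grid L ℓ) (g ℓ) ≤ 2 * (L * D) := by
    have h1 := mul_nonneg (by positivity : (0 : ℝ) ≤ L * T) hscad0
    linarith
  have hscad : T * scad a lam x ≤ D := by
    have h1 : 0 ≤ ∑ ℓ ∈ Finset.Icc 1 L, excess φ T C (grid L ℓ) (g ℓ) :=
      Finset.sum_nonneg fun ℓ hℓ => h.excess_nonneg (grid_mem hℓ) _
    refine le_of_mul_le_mul_left ?_ hL0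
    linarith
  have hmins := (mul_le_mul_of_nonneg_left (mul_min_le_scad (lam := lam) ha x) hT0.le).trans hscad
  have hxlam : x < lam := by
    by_contra hle
    rw [min_eq_right (not_lt.1 hle)] at hmins
    have h1 : (T : ℝ) * (lam * lam) = (lam * √T) * (lam * √T) := by
      linear_combination -(lam * lam) * hss
    have h2 := mul_le_mul_of_nonneg_left hlam₁ (zero_le_one.trans hlam₁)
    linarith
  rw [min_eq_left hxlam.le] at hmins
  have hxT : x * √T ≤ 1 := by
    have h1 : (T : ℝ) * (lam * x) = (lam * √T) * (x * √T) := by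
      linear_combination -(lam * x) * hss
    by_contra hlt
    have h2 := mul_le_mul_of_nonneg_left (not_le.1 hlt).le (zero_le_one.trans hlam₁)
    linarith
  by_contra hne
  have hxpos : 0 < x := lt_of_le_of_ne hx0 (Ne.symm hne)
  -- comparison with the restricted estimator
  set γ₁ := Function.update γ (some q) (γ none) with hγ₁
  have hγ₁Γ : γ₁ ∈ Γ := hΓ γ hγ q
  have hupd : ∀ ℓ, (fun r => series b (γ₁ r) (grid L ℓ)) =
      Function.update (g ℓ) (some q) (g ℓ (some q) - series b (γ (some q) - γ none) (grid L ℓ)) := by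
    intro ℓ
    funext r
    rcases eq_or_ne r (some q) with rfl | hr
    · simp only [hγ₁, hg, Function.update_self, series_sub, sub_sub_cancel]
    · simp only [hγ₁, hg, Function.update_of_ne hr]
  have he : ∑ ℓ ∈ Finset.Icc 1 L, series b (γ (some q) - γ none) (grid L ℓ) ^ 2 ≤
      L * (C₁ / c₂ * x ^ 2) := by
    have h1 := (hdes (γ (some q) - γ none)).2
    rw [one_div_mul_eq_div, div_le_iff₀ hL0] at h1
    have h2 : ∑ h, (γ (some q) - γ none) h ^ 2 ≤ x ^ 2 / c₂ := by
      rw [le_div_iff₀ hc₂, mul_comm]; exact (hgram _).1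
    have h3 := mul_le_mul_of_nonneg_left h2 hC₁
    rw [div_mul_eq_mul_div, ← mul_div_assoc', mul_comm (L : ℝ)]
    exact h1.trans (mul_le_mul_of_nonneg_right h3 hL0.le)
  have hstep := h.sum_lossAt_update_sub_le hT (some q) (L := L) (g := g)
    (e := fun ℓ => series b (γ (some q) - γ none) (grid L ℓ))
    (fun ℓ hℓ s => by rw [← hupd]; exact hΓM γ₁ hγ₁Γ s _ (grid_mem hℓ)) hxpos hxT
    (div_nonneg hC₁ hc₂.le) he hE
  have hcomp₁ := hcomp γ₁ hγ₁Γ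
  simp only [hupd] at hcomp₁
  have hpen₁ : penalty b a lam γ - penalty b a lam γ₁ = lam * x := by
    rw [penalty, penalty, ← Finset.sum_sub_distrib, Finset.sum_eq_single q]
    · have h1 : γ₁ (some q) - γ₁ none = 0 := by
        rw [hγ₁, Function.update_self, Function.update_of_ne (by simp), sub_self]
      have h2 : l2norm (series b (0 : Fin H → ℝ)) = 0 := by simp [l2norm, series]
      rw [h1, h2, scad_zero hlam, sub_zero, scad_of_le hxlam.le]
    · intro q' _ hq'
      rw [hγ₁, Function.update_of_ne (by simpa using hq'), Function.update_of_ne (by simp), sub_self]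
    · simp
  have hfin : L * T * (lam * x) ≤ L * (x * √T * (1 / 2 * K * (C₁ / c₂ + 1) +
      1 / 2 * (C₁ / c₂ + 8 * B * D) + B * (C₁ / c₂))) := by
    rw [← hpen₁]
    linarith
  have h1 : (L : ℝ) * T * (lam * x) = L * (x * √T * (lam * √T)) := by
    linear_combination -(L * lam * x) * hss
  rw [h1] at hfin
  have h2 := le_of_mul_le_mul_left (le_of_mul_le_mul_left hfin hL0)
    (by positivity : 0 < x * √(T : ℝ))
  linarith

end Selection

section Probability

variable {Ω : Type*} [MeasurableSpace Ω] {μ : Measure Ω} [IsProbabilityMeasure μ]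

theorem tendsto_measure_one_of_compl {s : ℕ → Set Ω}
    (h : ∀ ε : ℝ, 0 < ε → ∀ᶠ T in atTop, μ (s T)ᶜ ≤ ENNReal.ofReal ε) :
    Tendsto (fun T => μ (s T)) atTop (𝓝 1) := by
  have h0 : Tendsto (fun T => μ (s T)ᶜ) atTop (𝓝 0) := by
    rw [ENNReal.tendsto_nhds_zero]
    intro ε hε
    rcases eq_or_ne ε ⊤ with rfl | htop
    · exact Eventually.of_forall fun _ => le_top
    · filter_upwards [h ε.toReal (ENNReal.toReal_pos hε.ne' htop)] with T hT
      rwa [ENNReal.ofReal_toReal htop] at hT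
  have h1 : Tendsto (fun T => 1 - μ (s T)ᶜ) atTop (𝓝 (1 - 0)) :=
    ENNReal.Tendsto.sub tendsto_const_nhds h0 (Or.inl ENNReal.one_ne_top)
  rw [tsub_zero] at h1
  refine tendsto_of_tendsto_of_tendsto_of_le_of_le h1 tendsto_const_nhds (fun T => ?_)
    fun _ => prob_le_one
  rw [tsub_le_iff_right]
  calc (1 : ENNReal) = μ univ := measure_univ.symm
    _ = μ (s T ∪ (s T)ᶜ) := by rw [union_compl_self]
    _ ≤ _ := measure_union_le _ _

/-- With high probability the sample path is regular. -/
theorem Driven.exists_regularPath {ι : Type*} [Fintype ι] [Nonempty ι] {P : ℕ → MeasurableSpace Ω}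
    {φ : ι → ℝ → ℝ} {B c : ℝ} {C : ℕ → Ω → ι → ℝ} {Y V : ℕ → Ω → ℝ}
    (hD : Driven μ P φ B c C Y V) {M κ : ℝ} (hM : 0 < M) (hκ : 0 < κ)
    (hφM : ∀ r, ∀ τ ∈ Icc (0 : ℝ) 1, |φ r τ| ≤ M)
    (hlow : Tendsto (fun T : ℕ => μ {ω | ¬ ∀ δ : ι → ℝ, κ * T * (∑ r, |δ r|) ^ 2 ≤
      ∑ t ∈ Finset.Icc 1 T, (∑ r, C t ω r * δ r) ^ 2}) atTop (𝓝 0)) {ε : ℝ} (hε : 0 < ε) :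
    ∃ K : ℝ, 0 ≤ K ∧ ∀ᶠ T : ℕ in atTop,
      μ {ω | ¬ RegularPath φ B c M K κ T (fun t => C t ω) (fun t => Y t ω)} ≤ ENNReal.ofReal ε := by
  set d : ℝ := ((Fintype.card ι : ℕ) : ℝ) with hd
  have hd0 : 0 < d := by rw [hd]; exact_mod_cast Fintype.card_pos
  choose k hk using fun r =>
    hD.exists_forall_measure_score_le hM r (by positivity : 0 < ε / (2 * d))
  refine ⟨∑ r, |k r|, Finset.sum_nonneg fun _ _ => abs_nonneg _, ?_⟩
  have hkK : ∀ r, k r ≤ ∑ r, |k r| := fun r => (le_abs_self _).trans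
    (Finset.single_le_sum (f := fun r => |k r|) (fun _ _ => abs_nonneg _) (Finset.mem_univ r))
  have hae : ∀ᵐ ω ∂μ, ∀ t, (∀ r, 0 ≤ C t ω r) ∧ ∑ r, C t ω r = 1 ∧
      SlopeBounds B c (mix φ (C t ω)) := by
    rw [ae_all_iff]
    intro t
    filter_upwards [hD.weight_nonneg t, hD.weight_sum t, hD.slope t] with ω h1 h2 h3
    exact ⟨h1, h2, h3⟩
  have hlow' := (ENNReal.tendsto_nhds_zero.1 hlow) (ENNReal.ofReal (ε / 2))
    (ENNReal.ofReal_pos.2 (by positivity))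
  filter_upwards [hlow', eventually_ge_atTop 1] with T hT1 hT
  set S₀ : Set Ω := {ω | ¬ ∀ t, (∀ r, 0 ≤ C t ω r) ∧ ∑ r, C t ω r = 1 ∧
      SlopeBounds B c (mix φ (C t ω))}
  set S₁ : ι → Set Ω := fun r => {ω | ∃ g : ι → ℝ, (∀ s, |g s| ≤ M) ∧
      k r * √T < |∑ t ∈ Finset.Icc 1 T, score φ r g (C t ω) (Y t ω)|}
  set S₂ : Set Ω := {ω | ¬ ∀ δ : ι → ℝ, κ * T * (∑ r, |δ r|) ^ 2 ≤
      ∑ t ∈ Finset.Icc 1 T, (∑ r, C t ω r * δ r) ^ 2}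
  have hsub : {ω | ¬ RegularPath φ B c M (∑ r, |k r|) κ T (fun t => C t ω) (fun t => Y t ω)} ⊆
      S₀ ∪ ((⋃ r, S₁ r) ∪ S₂) := by
    intro ω hω
    by_contra hcon
    simp only [mem_union, mem_iUnion, not_or, not_exists] at hcon
    obtain ⟨h0, h1, h2⟩ := hcon
    have h0' := not_not.1 h0
    refine hω ⟨hD.B_pos, hD.c_pos, hM, Finset.sum_nonneg fun _ _ => abs_nonneg _, hκ,
      hD.measurable_coef, hφM, fun t => (h0' t).1, fun t => (h0' t).2.1, fun t => (h0' t).2.2,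
      fun r g hg => ?_, not_not.1 h2⟩
    by_contra hlt
    exact h1 r ⟨g, hg, (mul_le_mul_of_nonneg_right (hkK r) (Real.sqrt_nonneg _)).trans_lt
      (not_le.1 hlt)⟩
  have hS₁ : μ (⋃ r, S₁ r) ≤ ENNReal.ofReal (ε / 2) := by
    refine (measure_iUnion_fintype_le μ S₁).trans ((Finset.sum_le_sum fun r _ => hk r T hT).trans ?_)
    rw [Finset.sum_const, Finset.card_univ, nsmul_eq_mul, ← ENNReal.ofReal_natCast, ← hd,
      ← ENNReal.ofReal_mul hd0.le]
    refine ENNReal.ofReal_le_ofReal (le_of_eq ?_)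
    field_simp
  calc _ ≤ μ (S₀ ∪ ((⋃ r, S₁ r) ∪ S₂)) := measure_mono hsub
    _ ≤ μ S₀ + μ ((⋃ r, S₁ r) ∪ S₂) := measure_union_le _ _
    _ ≤ μ S₀ + (μ (⋃ r, S₁ r) + μ S₂) := by gcongr; exact measure_union_le _ _
    _ ≤ 0 + (ENNReal.ofReal (ε / 2) + ENNReal.ofReal (ε / 2)) :=
      add_le_add (le_of_eq (ae_iff.1 hae)) (add_le_add hS₁ hT1)
    _ = ENNReal.ofReal ε := by
      rw [zero_add, ← ENNReal.ofReal_add (by positivity) (by positivity), add_halves]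

end Probability

section Rates

variable {π : ℝ} {H L : ℕ → ℕ} {lam : ℕ → ℝ}

theorem Tuning.eventually_lt_mul_sqrt (h : Tuning π H L lam) (A : ℝ) :
    ∀ᶠ T : ℕ in atTop, A < lam T * √T := by
  filter_upwards [h.lam_rate.eventually_ge_atTop (|A| + 1), eventually_ge_atTop 1] with T h1 hT
  have hT0 : (0 : ℝ) < T := by exact_mod_cast hT
  have h2 : (0 : ℝ) < (T : ℝ) ^ (-(1 / 2) : ℝ) := Real.rpow_pos_of_pos hT0 _
  have h3 : (0 : ℝ) ≤ (H T : ℝ) ^ (1 / 2 - π) := Real.rpow_nonneg (Nat.cast_nonneg _) _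
  rw [le_div_iff₀ (by linarith)] at h1
  have h4 : (|A| + 1) * (T : ℝ) ^ (-(1 / 2) : ℝ) ≤ lam T := by
    have h5 : 0 ≤ (|A| + 1) * (H T : ℝ) ^ (1 / 2 - π) := by positivity
    linarith
  have h5 : (T : ℝ) ^ (-(1 / 2) : ℝ) * √T = 1 := by
    rw [Real.sqrt_eq_rpow, ← Real.rpow_add hT0]; norm_num
  have h6 := mul_le_mul_of_nonneg_right h4 (Real.sqrt_nonneg (T : ℝ))
  rw [mul_assoc, h5, mul_one] at h6
  linarith [le_abs_self A]

theorem Tuning.tendsto_rpow (h : Tuning π H L lam) (hπ : 0 < π) :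
    Tendsto (fun T => (H T : ℝ) ^ (-π)) atTop (𝓝 0) :=
  (tendsto_rpow_neg_atTop hπ).comp (tendsto_natCast_atTop_atTop.comp h.H_top)

theorem Tuning.exists_rpow_le (h : Tuning π H L lam) :
    ∃ R : ℝ, 0 ≤ R ∧ ∀ᶠ T : ℕ in atTop, (H T : ℝ) ^ (-π) ≤ R / √T := by
  obtain ⟨R, hR0, hR⟩ := h.H_lower.exists_nonneg
  refine ⟨R, hR0, ?_⟩
  filter_upwards [hR.bound, h.H_top.eventually_ge_atTop 1, eventually_ge_atTop 1] with T h1 hH hT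
  have hT0 : (0 : ℝ) < T := by exact_mod_cast hT
  have hH1 : (1 : ℝ) ≤ H T := by exact_mod_cast hH
  rw [norm_one, mul_one, Real.norm_eq_abs] at h1
  have h2 := (le_abs_self _).trans h1
  rw [← Real.sqrt_eq_rpow, mul_comm, ← le_div_iff₀ (Real.sqrt_pos.2 hT0)] at h2
  exact (Real.rpow_le_rpow_of_exponent_le hH1 (by linarith)).trans h2

end Rates

section Assembly

variable {Ω : Type*} {n p : ℕ} {lb ub : Fin n → ℝ} {θ : Fin n → Idx n p → ℝ → ℝ}

theorem exists_forall_abs_phi_extend_le (i : Fin n)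
    (hθ : ∀ q, ContinuousOn (θ i q) (Icc 0 1)) :
    ∃ M : ℝ, ∀ r, ∀ u ∈ Icc (0 : ℝ) 1, |phi lb ub (extend θ i) r u| ≤ M := by
  choose m hm using fun r => isCompact_Icc.exists_bound_of_continuousOn
    (continuousOn_phi (lb := lb) (ub := ub) hθ r)
  refine ⟨∑ r, |m r|, fun r u hu => ?_⟩
  rw [phi_extend, clip_of_mem hu]
  exact ((hm r u hu).trans (le_abs_self _)).trans
    (Finset.single_le_sum (f := fun r => |m r|) (fun _ _ => abs_nonneg _) (Finset.mem_univ r))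

theorem l2norm_congr {f g : ℝ → ℝ} (h : ∀ u ∈ Icc (0 : ℝ) 1, f u = g u) : l2norm f = l2norm g := by
  rw [l2norm, l2norm, intervalIntegral.integral_congr fun u hu => ?_]
  rw [uIcc_of_le zero_le_one] at hu
  simp only [h u hu]

theorem l2norm_const_mul (k : ℝ) (f : ℝ → ℝ) : l2norm (fun u => k * f u) = |k| * l2norm f := by
  simp only [l2norm, mul_pow, intervalIntegral.integral_const_mul]
  rw [Real.sqrt_mul (sq_nonneg k), Real.sqrt_sq_eq_abs]

/-- The coefficient functions that do not vanish are bounded away from zero. -/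
theorem exists_separation (hlt : ∀ k, lb k < ub k) (i : Fin n) :
    ∃ s₀ : ℝ, 0 < s₀ ∧ ∀ q : Fin n × Fin p, l2norm (θ i (some q)) = 0 ∨
      s₀ ≤ l2norm (fun u => phi lb ub (extend θ i) (some q) u - phi lb ub (extend θ i) none u) ^ 2 := by
  have h1 : ∀ q : Fin n × Fin p, ∀ᶠ s in 𝓝[>] (0 : ℝ), l2norm (θ i (some q)) = 0 ∨
      s ≤ l2norm
        (fun u => phi lb ub (extend θ i) (some q) u - phi lb ub (extend θ i) none u) ^ 2 := by
    intro q
    by_cases hq : l2norm (θ i (some q)) = 0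
    · exact Eventually.of_forall fun _ => Or.inl hq
    have h2 : l2norm (fun u => phi lb ub (extend θ i) (some q) u - phi lb ub (extend θ i) none u) =
        |((n * p : ℕ) : ℝ) * (ub q.1 - lb q.1)| * l2norm (θ i (some q)) := by
      rw [← l2norm_const_mul]
      refine l2norm_congr fun u hu => ?_
      rw [phi_extend, phi_extend, clip_of_mem hu, phi_some_sub_phi_none]
    have h3 : ((n * p : ℕ) : ℝ) * (ub q.1 - lb q.1) ≠ 0 :=
      mul_ne_zero (Nat.cast_ne_zero.2 (mul_ne_zero q.1.pos.ne' q.2.pos.ne'))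
        (sub_pos.2 (hlt q.1)).ne'
    have h4 : 0 < l2norm
        (fun u => phi lb ub (extend θ i) (some q) u - phi lb ub (extend θ i) none u) ^ 2 := by
      rw [h2]
      exact pow_pos (mul_pos (abs_pos.2 h3) (lt_of_le_of_ne (l2norm_nonneg _) (Ne.symm hq))) 2
    exact (eventually_nhdsWithin_of_eventually_nhds (eventually_le_nhds h4)).mono
      fun _ hs => Or.inr hs
  obtain ⟨s, hs, hs0⟩ := ((eventually_all.2 h1).and self_mem_nhdsWithin).exists
  exact ⟨s, hs0, hs⟩

/-- Vanishing errors eventually meet the accuracy required for selection. -/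
theorem exists_accuracy {a : ℝ} {lam ρ : ℕ → ℝ} (hlam : Tendsto lam atTop (𝓝 0))
    (hρ : Tendsto ρ atTop (𝓝 0)) {c₁ C₂ s₀ : ℝ} (hc₁ : 0 < c₁) (hC₂ : 0 ≤ C₂) (hs₀ : 0 < s₀)
    (A W κ D Q : ℝ) :
    ∃ η σ : ℝ, 0 < η ∧ (∀ᶠ T : ℕ in atTop,
      (1 / A + W / η) * (8 / κ * (D / T + Q * ((a + 1) * lam T ^ 2 / 2))) + W ^ 2 * (4 * η) ≤ σ) ∧
      ∀ᶠ T : ℕ in atTop,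
        5 * ((a * lam T) ^ 2 + 2 * (C₂ * (2 / c₁ * (σ + ρ T ^ 2))) + 2 * ρ T ^ 2) < s₀ := by
  obtain ⟨σ, hσ0, hσ⟩ : ∃ σ : ℝ, 0 < σ ∧ 5 * (2 * (C₂ * (2 / c₁ * σ))) < s₀ := by
    refine ⟨s₀ * c₁ / (40 * (C₂ + 1)), by positivity, ?_⟩
    have h1 : 5 * (2 * (C₂ * (2 / c₁ * (s₀ * c₁ / (40 * (C₂ + 1)))))) =
        s₀ * (C₂ / (2 * (C₂ + 1))) := by
      field_simp; ring
    rw [h1]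
    refine mul_lt_of_lt_one_right hs₀ ?_
    rw [div_lt_one (by positivity)]
    linarith
  refine ⟨σ / (8 * (W ^ 2 + 1)), σ, by positivity, ?_, ?_⟩
  · set η := σ / (8 * (W ^ 2 + 1)) with hη
    have h1 : W ^ 2 * (4 * η) ≤ σ / 2 := by
      have h2 : W ^ 2 * (4 * η) = σ / 2 * (W ^ 2 / (W ^ 2 + 1)) := by
        rw [hη]; field_simp; ring
      rw [h2]
      refine mul_le_of_le_one_right (by positivity) ?_
      rw [div_le_one (by positivity)]
      linarith
    have h2 : Tendsto (fun T : ℕ => (1 / A + W / η) *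
        (8 / κ * (D / T + Q * ((a + 1) * lam T ^ 2 / 2)))) atTop
        (𝓝 ((1 / A + W / η) * (8 / κ * (0 + Q * ((a + 1) * 0 ^ 2 / 2))))) :=
      (((tendsto_const_div_atTop_nhds_zero_nat D).add
        ((((hlam.pow 2).const_mul (a + 1)).div_const 2).const_mul Q)).const_mul _).const_mul _
    have h3 : (1 / A + W / η) * (8 / κ * (0 + Q * ((a + 1) * 0 ^ 2 / 2))) < σ / 2 := by
      have : (1 / A + W / η) * (8 / κ * (0 + Q * ((a + 1) * 0 ^ 2 / 2))) = 0 := by ring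
      rw [this]; positivity
    filter_upwards [h2.eventually_lt_const h3] with T hT
    linarith
  · have h2 : Tendsto (fun T : ℕ => 5 * ((a * lam T) ^ 2 + 2 * (C₂ * (2 / c₁ * (σ + ρ T ^ 2))) +
        2 * ρ T ^ 2)) atTop
        (𝓝 (5 * ((a * 0) ^ 2 + 2 * (C₂ * (2 / c₁ * (σ + 0 ^ 2))) + 2 * 0 ^ 2))) :=
      ((((hlam.const_mul a).pow 2).add
        ((((tendsto_const_nhds.add (hρ.pow 2)).const_mul _).const_mul _).const_mul 2)).add
        ((hρ.pow 2).const_mul 2)).const_mul 5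
    refine h2.eventually_lt_const (lt_of_eq_of_lt ?_ hσ)
    ring

end Assembly

/-- Consistency of model selection. -/
theorem tendsto_measure_l2norm_thetaHat_eq_zero {Ω : Type*} [MeasurableSpace Ω] (μ : Measure Ω) [IsProbabilityMeasure μ]
    {n p : ℕ} (θ : Fin n → Idx n p → ℝ → ℝ) (lb ub : Fin n → ℝ)
    (U y : ℤ → Ω → Fin n → ℝ) (hmodel : Model μ θ lb ub U y)
    (i : Fin n)
    (f : ℤ → Ω → ℝ → ℝ) (hf : CondDensity μ θ lb ub y i f)
    (b : ℕ → ℝ → ℝ) (G : (H : ℕ) → Idx n p → Set (Fin H → ℝ)) (π : ℝ)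
    (hb : Basis (θ i) lb ub b G π)
    (H L : ℕ → ℕ) (lam : ℕ → ℝ)
    (hmat : Nonsingular μ (θ i) lb ub y b f H L)
    (htune : Tuning π H L lam)
    (a : ℝ) (ha : 1 < a)
    (γhat : (T : ℕ) → Ω → Idx n p → Fin (H T) → ℝ)
    (hmin : ∀ᶠ T in atTop, ∀ᵐ ω ∂μ,
      γhat T ω ∈ {γ | ∀ r, γ r ∈ G (H T) r} ∧
      IsMinOn (objective lb ub y i b a (lam T) (L T) T (H T) ω)
        {γ | ∀ r, γ r ∈ G (H T) r} (γhat T ω))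
    (q : Fin n × Fin p) (hq : l2norm (θ i (some q)) = 0) :
    Tendsto (fun T => μ {ω | l2norm (thetaHat lb ub b (γhat T ω) q) = 0})
      atTop (𝓝 1) := by
  have hp : 0 < p := q.2.pos
  have hcont : ∀ r, ContinuousOn (phi lb ub (extend θ i) r) (Icc 0 1) := fun r =>
    (hmodel.continuous_phi_extend i r).continuousOn
  obtain ⟨B, c, hD⟩ := hmodel.exists_driven hp i hf
  obtain ⟨c₂, hc₂, C₂', hgram⟩ := hb.gram
  obtain ⟨c₁, hc₁, C₁, hdesign⟩ := hmat.design
  obtain ⟨M₁, hM₁⟩ := hb.bounded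
  obtain ⟨M₂, hM₂⟩ := exists_forall_abs_phi_extend_le (lb := lb) (ub := ub) i
    (hmodel.continuous_coef i)
  obtain ⟨A, happrox⟩ := hb.approx
  obtain ⟨R, hR0, hR⟩ := htune.exists_rpow_le
  obtain ⟨s₀, hs₀, hsep⟩ := exists_separation (θ := θ) hmodel.lb_lt_ub i
  set M : ℝ := |M₁| + |M₂| + 1 with hM
  have hMpos : 0 < M := by positivity
  have hM₁M : M₁ ≤ M := by linarith [le_abs_self M₁, abs_nonneg M₂]
  have hM₂M : M₂ ≤ M := by linarith [le_abs_self M₂, abs_nonneg M₁]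
  set C₂ : ℝ := max C₂' 0 with hC₂
  set d : ℝ := ((Fintype.card (Idx n p) : ℕ) : ℝ) with hd
  have hd0 : 0 < d := by rw [hd]; exact_mod_cast Fintype.card_pos
  have hgram' : ∀ H : ℕ, ∀ w : Fin H → ℝ, c₂ * ∑ h, w h ^ 2 ≤ l2norm (series b w) ^ 2 ∧
      l2norm (series b w) ^ 2 ≤ C₂ * ∑ h, w h ^ 2 := fun H w => by
    have h1 := l2norm_sq_series_mem hb.continuous_basis (hgram H) w
    exact ⟨h1.1, h1.2.trans (mul_le_mul_of_nonneg_right (le_max_left _ _)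
      (Finset.sum_nonneg fun _ _ => sq_nonneg _))⟩
  have hbounds : ∀ᶠ T : ℕ in atTop, 0 < C₁ ∧
      (∀ w : Fin (H T) → ℝ, c₁ * ∑ h, w h ^ 2 ≤
          1 / (L T : ℝ) * ∑ ℓ ∈ Finset.Icc 1 (L T), series b w (grid (L T) ℓ) ^ 2 ∧
        1 / (L T : ℝ) * ∑ ℓ ∈ Finset.Icc 1 (L T), series b w (grid (L T) ℓ) ^ 2 ≤
          C₁ * d * ∑ h, w h ^ 2) ∧
      ∀ δ : Idx n p → ℝ, c₁ / (C₁ * d) * (∑ r, δ r ^ 2) * T ≤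
        ∑ r, ∑ r', δ r * moment μ lb ub y T r r' * δ r' := by
    filter_upwards [hdesign, eventually_ge_atTop 1, htune.H_top.eventually_ge_atTop 1]
      with T h1 hT hH
    exact hmodel.design_bounds hc₁ hT hH h1
  have hC₁ : 0 < C₁ := by
    obtain ⟨T, hT⟩ := hbounds.exists
    exact hT.1
  have hlow := hmodel.tendsto_measure_not_lower_bound (κ := c₁ / (C₁ * d)) (by positivity)
    (hbounds.mono fun T hT => hT.2.2)
  set κ : ℝ := c₁ / (C₁ * d) / (2 * d) with hκ
  have hκ0 : 0 < κ := by positivity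
  refine tendsto_measure_one_of_compl fun ε hε => ?_
  obtain ⟨K, hK0, hK⟩ := hD.exists_regularPath (M := M) (κ := κ) hMpos hκ0
    (fun r τ hτ => (hM₂ r τ hτ).trans hM₂M) hlow hε
  set D : ℝ := 2 * K ^ 2 / (κ * c) + 64 * d * M * K ^ 2 / κ +
    (B * (d * (|A| * R)) ^ 2 + K * (d * (|A| * R))) with hDdef
  have hρ0 : Tendsto (fun T => A * (H T : ℝ) ^ (-π)) atTop (𝓝 0) := by
    simpa using (htune.tendsto_rpow hb.pi_pos).const_mul A
  obtain ⟨η, σ, hη, hσ, hacc⟩ := exists_accuracy (a := a) htune.lam_zero hρ0 hc₁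
    (le_max_right C₂' 0) hs₀ c (2 * d * M) κ D (Fintype.card (Fin n × Fin p) : ℕ)
  filter_upwards [hK, hbounds, hR, hσ, hacc, hmin, htune.H_top.eventually happrox,
    htune.eventually_lt_mul_sqrt 1, htune.eventually_lt_mul_sqrt D,
    htune.eventually_lt_mul_sqrt (1 / 2 * K * (C₁ * d / c₂ + 1) +
      1 / 2 * (C₁ * d / c₂ + 8 * B * D) + B * (C₁ * d / c₂)),
    htune.L_top.eventually_ge_atTop 1, eventually_ge_atTop 1]
    with T hKT hbT hRT hσT haccT hminT happT hl1 hl2 hl3 hL hT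
  obtain ⟨γ', hγ'G, hγ'S, hγ'A⟩ := happT
  have hT0 : (0 : ℝ) < T := by exact_mod_cast hT
  have hlam : 0 < lam T := pos_of_mul_pos_left (one_pos.trans hl1) (Real.sqrt_nonneg _)
  refine le_trans ?_ hKT
  refine measure_mono_ae ?_
  filter_upwards [hminT] with ω hω hcompl hreg
  refine hcompl ?_
  have hzero := hreg.l2norm_eq_zero (C₁ := C₁ * d) (γ' := γ') (ρ := A * (H T : ℝ) ^ (-π))
    (R := |A| * R) (D := D) (q := q) hT hL hb.continuous_basis hcont ha hlam
    (Γ := {γ | ∀ r, γ r ∈ G (H T) r})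
    (fun γ hγ r u hu => (hM₁ _ r _ (hγ r) u hu).trans hM₁M)
    (fun γ hγ q r => by
      rcases eq_or_ne r (some q) with rfl | hr
      · rw [Function.update_self]; exact hb.compatible _ q (hγ none)
      · rw [Function.update_of_ne hr]; exact hγ r)
    hc₁ (by positivity) hc₂ (le_max_right _ _) hbT.2.1 (hgram' _) hγ'G
    (by
      rw [mul_div_assoc]
      exact (mul_le_mul_of_nonneg_right (le_abs_self A)
        (Real.rpow_nonneg (Nat.cast_nonneg _) _)).trans
        (mul_le_mul_of_nonneg_left hRT (abs_nonneg A)))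
    (fun r u hu => by rw [phi_extend, clip_of_mem hu]; exact hγ'A r u hu)
    (fun q => (hsep q).imp_left (hγ'S q)) le_rfl hη hσT haccT hl1.le hl2 hl3 hω.1
    (fun γ hγ => by
      have h1 := hω.2 hγ
      simp only [mem_ofPred_eq, objective_eq_criterion] at h1
      exact h1)
    (hγ'S q hq)
  have h1 : thetaHat lb ub b (γhat T ω) q = fun u => (((n * p : ℕ) : ℝ) * (ub q.1 - lb q.1))⁻¹ *
      series b (γhat T ω (some q) - γhat T ω none) u := by
    funext u
    rw [series_sub, thetaHat, div_eq_inv_mul]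
  rw [mem_ofPred_eq, h1, l2norm_const_mul, hzero, mul_zero]

end SQVAR

theorem theorem2 {Ω : Type*} [MeasurableSpace Ω] (μ : Measure Ω) [IsProbabilityMeasure μ]
    {n p : ℕ} (θ : Fin n → SQVAR.Idx n p → ℝ → ℝ) (lb ub : Fin n → ℝ)
    (U y : ℤ → Ω → Fin n → ℝ) (hmodel : SQVAR.Model μ θ lb ub U y)
    (i : Fin n)
    (f : ℤ → Ω → ℝ → ℝ) (hf : SQVAR.CondDensity μ θ lb ub y i f)
    (b : ℕ → ℝ → ℝ) (G : (H : ℕ) → SQVAR.Idx n p → Set (Fin H → ℝ)) (π : ℝ)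
    (hb : SQVAR.Basis (θ i) lb ub b G π)
    (H L : ℕ → ℕ) (lam : ℕ → ℝ)
    (hmat : SQVAR.Nonsingular μ (θ i) lb ub y b f H L)
    (htune : SQVAR.Tuning π H L lam)
    (a : ℝ) (ha : 1 < a)
    (γhat : (T : ℕ) → Ω → SQVAR.Idx n p → Fin (H T) → ℝ)
    (hmeas : ∀ T, Measurable (γhat T))
    (hmin : ∀ᶠ T in atTop, ∀ᵐ ω ∂μ,
      γhat T ω ∈ {γ | ∀ r, γ r ∈ G (H T) r} ∧
      IsMinOn (SQVAR.objective lb ub y i b a (lam T) (L T) T (H T) ω)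
        {γ | ∀ r, γ r ∈ G (H T) r} (γhat T ω))
    (q : Fin n × Fin p) (hq : SQVAR.l2norm (θ i (some q)) = 0) :
    Tendsto (fun T => μ {ω | SQVAR.l2norm (SQVAR.thetaHat lb ub b (γhat T ω) q) = 0})
      atTop (𝓝 1) := by
  exact SQVAR.tendsto_measure_l2norm_thetaHat_eq_zero μ θ lb ub U y hmodel i f hf b G π hb H L lam hmat
    htune a ha γhat hmin q hq
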